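/- Conventions. A real (unital, associative) Fréchet algebra is a real algebra with a complete Hausdorff topology defined by countably many submultiplicative seminorms. For such an algebra $A$ and $n\ge 0$, $G=\mathrm{GL}_n(A)\subset M_n(A)$ is regarded as a Fréchet Lie group, each tangent space being identified with $M_n(A)$; a map is smooth if it sends smooth curves to smooth curves. For a compact finite-dimensional Lie group $K\subset G$ (the image of an injective smooth homomorphism from a compact Lie group), a smooth $K$-equivariant deformation retraction of $G$ onto $K$ is a smooth map $h\colon G\times\mathbb R\to G$ such that $h(\cdot,1)=\mathrm{id}$, $h(\cdot,0)$ is a retraction of $G$ onto $K$, and $h(kg,t)=k\,h(g,t)$ for all $k\in K$. For a real Banach space $V$: * $C^\bullet_{\mathrm{diff}}(G,V)$ is the complex with $C^m_{\mathrm{diff}}(G,V)$ the space of smooth maps $f\colon G^m\to V$ such that $f(g_1,\dots,g_m)=0$ whenever some $g_j=1$, with the bar differential $$(\delta f)(g_1,\dots,g_{m+1})=f(g_2,\dots,g_{m+1})+\sum_{i=1}^{m}(-1)^i f(\dots,g_ig_{i+1},\dots)+(-1)^{m+1}f(g_1,\dots,g_m).$$ * $A^\bullet(K\backslash G,V)$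 is the complex of smooth $V$-valued differential forms on $K\backslash G$, that is, of those smooth $V$-valued forms on $G$ which are invariant under left translation by $K$ and vanish when one argument is tangent to the left $K$-orbits. $A^\bullet(K\backslash G,V)^G$ is the subcomplex of forms invariant under right translation by $G$. * $\mathrm{Tot}\,A^0(EG,A^\bullet(K\backslash G,V))^G$ is the total complex of the bicomplex which in bidegree $(m,q)$ consists of the $G$-equivariant smooth maps $G^{m+1}\to A^q(K\backslash G,V)$ (with $G$ acting by simultaneous right multiplication) vanishing on all $(h_0,\dots,h_m)$ with $h_j=h_{j+1}$ for some $j$, with differentials the alternating sum of the face maps and $(-1)^m$ times the de Rham differential. There are canonical maps of complexes $$C^\bullet_{\mathrm{diff}}(G,V)\longrightarrow \mathrm{Tot}\,A^0(EG,A^\bullet(K\backslash G,V))^G\longleftarrow A^\bullet(K\backslash G,V)^G .$$ The first sends $f$ to $(h_0,\dots,h_m)\mapsto f(h_0h_1^{-1},\dots,h_{m-1}h_m^{-1})$, regarded as a constant function on $K\backslash G$. The second sends a form to the corresponding constant family on $G=(EG)_0$. Theorem. (A) Let $A$ be a real Fréchet algebra, $n\ge 0$, and let $K\subset G=\mathrm{GL}_n(A)$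 be a compact finite-dimensional Lie group such that $G$ admits a smooth $K$-equivariant deformation retraction onto $K$. Then for every real Banach space $V$ both of the above maps are quasi-isomorphisms. In particular $C^\bullet_{\mathrm{diff}}(G,V)$ and $A^\bullet(K\backslash G,V)^G$ are quasi-isomorphic. (B) Let $X$ be a complex manifold of dimension $d$, let $B\subset X$ be an open subset biholomorphic to the polydisc $\{z\in\mathbb C^d:|z_i|<1 \text{ for all } i\}$, and let $\mathcal O(B)$ be the algebra of holomorphic functions on $B$ with the topology of uniform convergence on compact subsets. Then for every $n\ge 0$ the group $\mathrm{GL}_n(\mathcal O(B))$ admits a smooth $U_n$-equivariant deformation retraction onto its subgroup $U_n$ of constant unitary matrices. Consequently, for every real Banach space $V$, both maps of the zigzag for $G=\mathrm{GL}_n(\mathcal O(B))$ and $K=U_n$ are quasi-isomorphisms, so $C^\bullet_{\mathrm{diff}}(\mathrm{GL}_n(\mathcal O(B)),V)$ and $A^\bullet(U_n\backslash \mathrm{GL}_n(\mathcal O(B)),V)^{\mathrm{GL}_n(\mathcal O(B))}$ are quasi-isomorphic. -/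

import Mathlib

open CategoryTheory
open scoped ContDiff Manifold Topology

universe u v w

noncomputable section

namespace FrechetLie

/-! ### Smooth curves -/

section Curves

variable {E : Type*} [AddCommGroup E] [Module ℝ E] [TopologicalSpace E] [ContinuousSMul ℝ E]

/-- A smooth (`C^∞`) curve in a topological vector space: all iterated derivatives exist. -/
def IsSmoothCurve (γ : ℝ → E) : Prop :=
  ∃ c : ℕ → ℝ → E, c 0 = γ ∧ ∀ k t, HasDerivAt (c k) (c (k + 1) t) t

/-- The derivative of a curve is the limit of its difference quotients. -/
theorem hasDerivAt_iff_tendsto_quotient [IsTopologicalAddGroup E] {γ : ℝ → E} {v : E} {t : ℝ} :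
    HasDerivAt γ v t ↔
      Filter.Tendsto (fun s => (s - t)⁻¹ • (γ s - γ t)) (𝓝[≠] t) (𝓝 v) := by
  rw [hasDerivAt_iff_hasFDerivAt, hasFDerivAt_iff_isLittleOTVS,
    Asymptotics.isLittleOTVS_iff_tendsto_inv_smul]
  · have h1 : Filter.Tendsto (fun s => (s - t)⁻¹ • (γ s - γ t)) (𝓝[≠] t) (𝓝 v) ↔
        Filter.Tendsto (fun s => (s - t)⁻¹ • (γ s - γ t) - v) (𝓝[≠] t) (𝓝 0) := by
      rw [tendsto_sub_nhds_zero_iff]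
    rw [h1]
    have h2 : (fun s => (s - t)⁻¹ • (γ s - γ t) - v) =ᶠ[𝓝[≠] t]
        (fun s => (s - t)⁻¹ • (γ s - γ t - ContinuousLinearMap.toSpanSingleton ℝ v (s - t))) := by
      filter_upwards [self_mem_nhdsWithin] with s hs
      have : s - t ≠ 0 := sub_ne_zero.2 hs
      simp [smul_sub, smul_smul, inv_mul_cancel₀ this]
    rw [Filter.tendsto_congr' h2]
    constructor
    · exact fun h => h.mono_left nhdsWithin_le_nhds
    · intro h
      rw [← nhdsNE_sup_pure, Filter.tendsto_sup]
      refine ⟨h, ?_⟩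
      rw [Filter.tendsto_pure_left]
      intro s hs
      simpa using mem_of_mem_nhds hs
  · filter_upwards with s hs
    have : s = t := by linarith
    simp [this]

/-- A family of curves closed under taking derivatives consists of smooth curves. -/
theorem IsSmoothCurve.of_closed (S : Set (ℝ → E))
    (hS : ∀ f ∈ S, ∃ f' ∈ S, ∀ t, HasDerivAt f (f' t) t) {γ : ℝ → E} (hγ : γ ∈ S) :
    IsSmoothCurve γ := by
  choose! D hD hD' using hS
  refine ⟨fun k => D^[k] γ, rfl, fun k t => ?_⟩
  have hk : ∀ k, D^[k] γ ∈ S := by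
    intro k
    induction k with
    | zero => exact hγ
    | succ k ih => rw [Function.iterate_succ_apply']; exact hD _ ih
  have := hD' _ (hk k) t
  simpa only [Function.iterate_succ_apply'] using this

theorem hasDerivAt_mul_curve {R : Type*} [Ring R] [Algebra ℝ R] [TopologicalSpace R]
    [IsTopologicalRing R] [ContinuousSMul ℝ R] {a b : ℝ → R} {a' b' : R} {t : ℝ}
    (ha : HasDerivAt a a' t) (hb : HasDerivAt b b' t) :
    HasDerivAt (fun s => a s * b s) (a' * b t + a t * b') t := by
  rw [hasDerivAt_iff_tendsto_quotient] at *
  have hac : Filter.Tendsto a (𝓝[≠] t) (𝓝 (a t)) := by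
    have h0 : Filter.Tendsto (fun s : ℝ => s - t) (𝓝[≠] t) (𝓝 0) := by
      have : Filter.Tendsto (fun s : ℝ => s - t) (𝓝 t) (𝓝 (t - t)) :=
        (continuous_id.sub continuous_const).tendsto t
      rw [sub_self] at this
      exact this.mono_left nhdsWithin_le_nhds
    have h1 := (h0.smul ha).add_const (a t)
    rw [zero_smul, zero_add] at h1
    refine h1.congr' ?_
    filter_upwards [self_mem_nhdsWithin] with s hs
    have : s - t ≠ 0 := sub_ne_zero.2 hs
    simp [smul_smul, mul_inv_cancel₀ this]
  have h := (ha.mul_const (b t)).add (hac.mul hb)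
  refine h.congr' ?_
  filter_upwards with s
  simp only [smul_mul_assoc, mul_smul_comm, ← smul_add]
  congr 1
  noncomm_ring

theorem hasDerivAt_add_curve [IsTopologicalAddGroup E] {a b : ℝ → E} {a' b' : E} {t : ℝ}
    (ha : HasDerivAt a a' t) (hb : HasDerivAt b b' t) :
    HasDerivAt (fun s => a s + b s) (a' + b') t := by
  rw [hasDerivAt_iff_tendsto_quotient] at *
  refine (ha.add hb).congr fun s => ?_
  rw [← smul_add]
  congr 1
  abel

theorem IsSmoothCurve.mul {R : Type*} [Ring R] [Algebra ℝ R] [TopologicalSpace R]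
    [IsTopologicalRing R] [ContinuousSMul ℝ R] {a b : ℝ → R}
    (ha : IsSmoothCurve a) (hb : IsSmoothCurve b) : IsSmoothCurve (fun t => a t * b t) := by
  obtain ⟨c, rfl, hc⟩ := ha
  obtain ⟨e, rfl, he⟩ := hb
  let S : AddSubmonoid (ℝ → R) :=
    AddSubmonoid.closure {f | ∃ i j : ℕ, f = fun t => c i t * e j t}
  have hgen : ∀ i j, (fun t => c i t * e j t) ∈ S :=
    fun i j => AddSubmonoid.subset_closure ⟨i, j, rfl⟩
  refine IsSmoothCurve.of_closed (S : Set (ℝ → R)) (fun f hf => ?_) (hgen 0 0)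
  induction hf using AddSubmonoid.closure_induction with
  | mem f hf =>
    obtain ⟨i, j, rfl⟩ := hf
    exact ⟨_, S.add_mem (hgen (i + 1) j) (hgen i (j + 1)),
      fun t => hasDerivAt_mul_curve (hc i t) (he j t)⟩
  | zero => exact ⟨0, S.zero_mem, fun t => by
      rw [hasDerivAt_iff_tendsto_quotient]; simpa using! tendsto_const_nhds⟩
  | add f g _ _ hf hg =>
    obtain ⟨f', hf', hf⟩ := hf
    obtain ⟨g', hg', hg⟩ := hg
    exact ⟨_, S.add_mem hf' hg', fun t => hasDerivAt_add_curve (hf t) (hg t)⟩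

end Curves

/-! ### Fréchet algebras -/

/-- A (real, associative, unital) Fréchet algebra: the topology is complete and Hausdorff, and is
defined by a countable family of submultiplicative seminorms. -/
class IsFrechetAlgebra (A : Type*) [Ring A] [Algebra ℝ A] [UniformSpace A] : Prop extends
    IsUniformAddGroup A, IsTopologicalRing A, ContinuousSMul ℝ A, T2Space A, CompleteSpace A where
  exists_seminorms : ∃ p : ℕ → Seminorm ℝ A,
    WithSeminorms p ∧ ∀ i a b, p i (a * b) ≤ p i a * p i b

/-! ### The group of units of a topological algebra

For `R` the algebra of `n × n` matrices over `A`, the group `Rˣ` is `GL_n(A)`. -/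

section Units

variable {R : Type u} [Ring R] [Algebra ℝ R] [TopologicalSpace R] [IsTopologicalRing R]
  [ContinuousSMul ℝ R]

/-- Smooth curves in the Lie group `Rˣ`, with the smooth structure induced from `R` by
`g ↦ (g, g⁻¹)`. (Over a Fréchet algebra the second condition follows from the first.) -/
structure IsSmoothUnitCurve (c : ℝ → Rˣ) : Prop where
  val : IsSmoothCurve fun t => (c t : R)
  inv : IsSmoothCurve fun t => ((c t)⁻¹ : Rˣ).val

theorem IsSmoothUnitCurve.mul' {a b : ℝ → Rˣ} (ha : IsSmoothUnitCurve a)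
    (hb : IsSmoothUnitCurve b) : IsSmoothUnitCurve fun t => a t * b t where
  val := by simpa using! ha.val.mul hb.val
  inv := by simpa using! hb.inv.mul ha.inv

theorem IsSmoothUnitCurve.inv' {a : ℝ → Rˣ} (ha : IsSmoothUnitCurve a) :
    IsSmoothUnitCurve fun t => (a t)⁻¹ where
  val := ha.inv
  inv := by simpa using! ha.val

/-- The Lie algebra of a subgroup `K`: the velocities at `1` of the smooth curves in `Rˣ` that
stay in `K`. -/
def lieAlgebraOf (K : Subgroup Rˣ) : Set R :=
  {b | ∃ c : ℝ → Rˣ, IsSmoothUnitCurve c ∧ (∀ t, c t ∈ K) ∧ c 0 = 1 ∧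
    HasDerivAt (fun t => (c t : R)) b 0}

/-- `Rˣ` retracts onto `K` by a smooth `K`-equivariant deformation `h : Rˣ × ℝ → Rˣ`, where
`h(·, 1)` is the identity and `h(·, 0)` is a retraction onto `K`; `K` acts by left
multiplication. A map is smooth when it sends smooth curves to smooth curves. -/
def IsSmoothEquivariantDeformationRetract (K : Subgroup Rˣ) : Prop :=
  ∃ h : Rˣ → ℝ → Rˣ,
    (∀ (c : ℝ → Rˣ) (s : ℝ → ℝ), IsSmoothUnitCurve c → ContDiff ℝ ∞ s →
      IsSmoothUnitCurve fun t => h (c t) (s t)) ∧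
    (∀ g, h g 1 = g) ∧ (∀ g, h g 0 ∈ K) ∧ (∀ k ∈ K, h k 0 = k) ∧
    ∀ k ∈ K, ∀ g t, h (k * g) t = k * h g t

/-- A smooth homomorphism from a Lie group `L` to `Rˣ`: it sends smooth curves to smooth
curves. -/
def IsSmoothHom {d : ℕ} {L : Type*} [Group L] [TopologicalSpace L]
    [ChartedSpace (EuclideanSpace ℝ (Fin d)) L] (ι : L →* Rˣ) : Prop :=
  ∀ γ : ℝ → L, ContMDiff 𝓘(ℝ) (𝓡 d) ∞ γ → IsSmoothUnitCurve fun t => ι (γ t)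

/-- The exponential of `a`, as a unit. (Over a Fréchet algebra, `exp a` is always a unit.) -/
def expUnit (a : R) : Rˣ :=
  open Classical in if h : IsUnit (NormedSpace.exp a) then h.unit else 1

/-- The curve `t ↦ exp(t x g⁻¹) g` in `Rˣ`, through `g` with velocity `x`. -/
def flow (g : Rˣ) (x : R) (t : ℝ) : Rˣ :=
  expUnit (t • (x * (g⁻¹ : Rˣ).val)) * g

theorem flow_mul (g y : Rˣ) (x : R) (t : ℝ) : flow (g * y) (x * y) t = flow g x t * y := by
  simp [flow, mul_assoc]

end Units

/-! ### Differential forms on `K \ Rˣ` -/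

section Forms

variable (R : Type u) [Ring R] [Algebra ℝ R] [TopologicalSpace R] [IsTopologicalRing R]
  [ContinuousSMul ℝ R]
variable (V : Type v) [NormedAddCommGroup V] [NormedSpace ℝ V]

/-- Families of `q`-forms on `Rˣ` with values in `V`, with parameters in `(Rˣ)^p`, before imposing
smoothness. Tangent vectors of `Rˣ` at any point are regarded as elements of `R`. -/
abbrev RawForm (p q : ℕ) : Type (max u v) :=
  (Fin p → Rˣ) → Rˣ → R [⋀^Fin q]→ₗ[ℝ] V

variable {R V}

/-- `α(h; g; x₁, …, x_q)` is smooth jointly in all variables. -/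
def IsSmoothForm {p q : ℕ} (α : RawForm R V p q) : Prop :=
  ∀ (h : Fin p → ℝ → Rˣ) (c : ℝ → Rˣ) (x : Fin q → ℝ → R),
    (∀ j, IsSmoothUnitCurve (h j)) → IsSmoothUnitCurve c → (∀ i, IsSmoothCurve (x i)) →
      ContDiff ℝ ∞ fun t => α (fun j => h j t) (c t) (fun i => x i t)

/-- `α` is (the pullback to `Rˣ` of) a form on `K \ Rˣ`: it is invariant under left translation by
`K`, and vanishes when one of the vectors is tangent to the `K`-orbit. -/
def IsBasicForm (K : Subgroup Rˣ) {p q : ℕ} (α : RawForm R V p q) : Prop :=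
  (∀ h g, ∀ k ∈ K, ∀ x : Fin q → R, α h (k * g) (fun i => k * x i) = α h g x) ∧
  (∀ h (g : Rˣ), ∀ x : Fin q → R, ∀ i, ∀ b ∈ lieAlgebraOf K, x i = b * g → α h g x = 0)

/-- `η` is the exterior derivative of `α` along `Rˣ` (the parameters being fixed):
`η(g; x₀, …, x_q) = ∑ (-1)^i ∂_{x_i} α(g; x₀, …, x̂_i, …, x_q)`, the usual formula in a linear
coordinate. -/
def IsExtDeriv {p q : ℕ} (α : RawForm R V p q) (η : RawForm R V p (q + 1)) : Prop :=
  ∀ h g (x : Fin (q + 1) → R), ∃ y : Fin (q + 1) → V,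
    (∀ i : Fin (q + 1), HasDerivAt (fun t : ℝ => α h (flow g (x i) t) (i.removeNth x)) (y i) 0) ∧
      η h g x = ∑ i : Fin (q + 1), (-1 : ℝ) ^ (i : ℕ) • y i

theorem IsExtDeriv.unique {p q : ℕ} {α : RawForm R V p q} {η η' : RawForm R V p (q + 1)}
    (h : IsExtDeriv α η) (h' : IsExtDeriv α η') : η = η' := by
  funext z g
  ext x
  obtain ⟨y, hy, e⟩ := h z g x
  obtain ⟨y', hy', e'⟩ := h' z g x
  have : y = y' := funext fun i => (hy i).unique (hy' i)
  rw [e, e', this]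

theorem IsExtDeriv.zero {p q : ℕ} : IsExtDeriv (0 : RawForm R V p q) 0 := by
  intro z g x
  exact ⟨0, fun i => by simpa using! hasDerivAt_const (0 : ℝ) (0 : V), by simp⟩

theorem IsExtDeriv.add {p q : ℕ} {α α' : RawForm R V p q} {η η' : RawForm R V p (q + 1)}
    (h : IsExtDeriv α η) (h' : IsExtDeriv α' η') : IsExtDeriv (α + α') (η + η') := by
  intro z g x
  obtain ⟨y, hy, e⟩ := h z g x
  obtain ⟨y', hy', e'⟩ := h' z g x
  refine ⟨y + y', fun i => by simpa using! (hy i).add (hy' i), ?_⟩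
  simp [e, e', Finset.sum_add_distrib]

theorem IsExtDeriv.smul {p q : ℕ} {α : RawForm R V p q} {η : RawForm R V p (q + 1)}
    (r : ℝ) (h : IsExtDeriv α η) : IsExtDeriv (r • α) (r • η) := by
  intro z g x
  obtain ⟨y, hy, e⟩ := h z g x
  refine ⟨r • y, fun i => by simpa using! (hy i).const_smul r, ?_⟩
  simp [e, Finset.smul_sum, smul_comm r]

variable (V)

/-- Smooth families of smooth forms on `K \ Rˣ`. -/
def smoothForms (K : Subgroup Rˣ) (p q : ℕ) : Submodule ℝ (RawForm R V p q) where
  carrier := {α | IsSmoothForm α ∧ IsBasicForm K α}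
  zero_mem' := ⟨fun _ _ _ _ _ _ => contDiff_const, fun _ _ _ _ _ => rfl,
    fun _ _ _ _ _ _ _ => rfl⟩
  add_mem' {α α'} h h' := by
    refine ⟨fun a b c ha hb hc => (h.1 a b c ha hb hc).add (h'.1 a b c ha hb hc),
      fun a g k hk x => ?_, fun a g x i b hb e => ?_⟩
    · exact congrArg₂ (· + ·) (h.2.1 a g k hk x) (h'.2.1 a g k hk x)
    · refine (congrArg₂ (· + ·) (h.2.2 a g x i b hb e) (h'.2.2 a g x i b hb e)).trans ?_
      exact add_zero 0
  smul_mem' r α h := by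
    refine ⟨fun a b c ha hb hc => (h.1 a b c ha hb hc).const_smul r,
      fun a g k hk x => ?_, fun a g x i b hb e => ?_⟩
    · exact congrArg (r • ·) (h.2.1 a g k hk x)
    · exact (congrArg (r • ·) (h.2.2 a g x i b hb e)).trans (smul_zero r)

/-- Degree `q` of the de Rham complex `A^•(K \ Rˣ, V)`, in smooth families parametrised by
`(Rˣ)^p`; by the exponential law these are the smooth maps from `(Rˣ)^p` to `A^q(K \ Rˣ, V)`, and
`p = 0` gives `A^q(K \ Rˣ, V)` itself. The clause on the exterior derivative `η` of `α` (that it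
exists, is smooth and basic, and is closed) holds for every smooth form when `R` is a Fréchet
algebra; it is included only so that `d` is visibly a differential. -/
def deRham (K : Subgroup Rˣ) (p q : ℕ) : Submodule ℝ (RawForm R V p q) where
  carrier := {α | α ∈ smoothForms V K p q ∧
    ∃ η ∈ smoothForms V K p (q + 1), IsExtDeriv α η ∧ IsExtDeriv η 0}
  zero_mem' := ⟨zero_mem _, 0, zero_mem _, .zero, .zero⟩
  add_mem' {α α'} h h' := by
    obtain ⟨h, η, hη, e, f⟩ := h
    obtain ⟨h', η', hη', e', f'⟩ := h'
    exact ⟨add_mem h h', η + η', add_mem hη hη', e.add e', by simpa using f.add f'⟩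
  smul_mem' r α h := by
    obtain ⟨h, η, hη, e, f⟩ := h
    exact ⟨Submodule.smul_mem _ r h, r • η, Submodule.smul_mem _ r hη, e.smul r,
      by simpa using f.smul r⟩

variable {V}

theorem exists_extDeriv {K : Subgroup Rˣ} {p q : ℕ} (α : deRham V K p q) :
    ∃ η : deRham V K p (q + 1), IsExtDeriv α.1 η.1 := by
  obtain ⟨_, η, hη, e, f⟩ := α.2
  exact ⟨⟨η, hη, 0, zero_mem _, f, .zero⟩, e⟩

theorem extDeriv_unique {K : Subgroup Rˣ} {p q : ℕ} {α : deRham V K p q}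
    {η η' : deRham V K p (q + 1)} (h : IsExtDeriv α.1 η.1) (h' : IsExtDeriv α.1 η'.1) : η = η' :=
  Subtype.ext (h.unique h')

/-- The de Rham differential. -/
def extD (K : Subgroup Rˣ) (p q : ℕ) : deRham V K p q →ₗ[ℝ] deRham V K p (q + 1) where
  toFun α := (exists_extDeriv α).choose
  map_add' α α' := extDeriv_unique (exists_extDeriv (α + α')).choose_spec
    ((exists_extDeriv α).choose_spec.add (exists_extDeriv α').choose_spec)
  map_smul' r α := extDeriv_unique (exists_extDeriv (r • α)).choose_spec
    ((exists_extDeriv α).choose_spec.smul r)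

theorem extD_spec {K : Subgroup Rˣ} {p q : ℕ} (α : deRham V K p q) :
    IsExtDeriv α.1 (extD K p q α).1 :=
  (exists_extDeriv α).choose_spec

theorem extD_eq {K : Subgroup Rˣ} {p q : ℕ} {α : deRham V K p q} {η : deRham V K p (q + 1)}
    (h : IsExtDeriv α.1 η.1) : extD K p q α = η :=
  extDeriv_unique (extD_spec α) h

theorem extD_extD {K : Subgroup Rˣ} {p q : ℕ} (α : deRham V K p q) :
    extD K p (q + 1) (extD K p q α) = 0 := by
  refine extD_eq ?_
  obtain ⟨_, η, hη, e, f⟩ := α.2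
  rw [(extD_spec α).unique e]
  exact f

/-- Invariance under the right action of `Rˣ` on the parameters and on `K \ Rˣ`. -/
def IsInvariantForm {p q : ℕ} (α : RawForm R V p q) : Prop :=
  ∀ (y : Rˣ) h g (x : Fin q → R),
    α (fun j => h j * y) (g * y) (fun i => x i * y) = α h g x

theorem IsExtDeriv.invariant {p q : ℕ} {α : RawForm R V p q} {η : RawForm R V p (q + 1)}
    (hα : IsInvariantForm α) (e : IsExtDeriv α η) : IsInvariantForm η := by
  intro y h g x
  obtain ⟨a, ha, ea⟩ := e (fun j => h j * y) (g * y) (fun i => x i * y)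
  obtain ⟨b, hb, eb⟩ := e h g x
  have : a = b := by
    funext i
    refine (ha i).unique ?_
    have hh := hb i
    have : (fun t : ℝ => α (fun j => h j * y) (flow (g * y) (x i * y) t)
        (i.removeNth fun i => x i * (y : R))) =
        fun t : ℝ => α h (flow g (x i) t) (i.removeNth x) := by
      funext t
      rw [flow_mul]
      exact hα y h (flow g (x i) t) (i.removeNth x)
    rw [this]
    exact hh
  rw [ea, eb, this]

variable (V)

/-- The `Rˣ`-invariants `A^q(K \ Rˣ, V)^{Rˣ}`. -/
def invariantForms (K : Subgroup Rˣ) (q : ℕ) : Submodule ℝ (RawForm R V 0 q) where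
  carrier := {α | α ∈ deRham V K 0 q ∧ IsInvariantForm α}
  zero_mem' := ⟨zero_mem _, fun _ _ _ _ => rfl⟩
  add_mem' h h' := ⟨add_mem h.1 h'.1, fun y a g x =>
    congrArg₂ (· + ·) (h.2 y a g x) (h'.2 y a g x)⟩
  smul_mem' r _ h := ⟨Submodule.smul_mem _ r h.1, fun y a g x =>
    congrArg (r • ·) (h.2 y a g x)⟩

/-- The conormalised cochains of degree `m`, with values in `q`-forms: the invariants
`A^0((E Rˣ)_m, A^q(K \ Rˣ, V))^{Rˣ}` that vanish on degenerate simplices, where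
`(E Rˣ)_m = (Rˣ)^(m+1)`. -/
def bicomplex (K : Subgroup Rˣ) (m q : ℕ) : Submodule ℝ (RawForm R V (m + 1) q) where
  carrier := {α | α ∈ deRham V K (m + 1) q ∧ IsInvariantForm α ∧
    ∀ (h : Fin (m + 1) → Rˣ) (j : Fin m), h j.castSucc = h j.succ → α h = 0}
  zero_mem' := ⟨zero_mem _, fun _ _ _ _ => rfl, fun _ _ _ => rfl⟩
  add_mem' {α α'} h h' := ⟨add_mem h.1 h'.1, fun y a g x =>
    congrArg₂ (· + ·) (h.2.1 y a g x) (h'.2.1 y a g x),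
    fun a j e => by simp [h.2.2 a j e, h'.2.2 a j e]⟩
  smul_mem' r α h := ⟨Submodule.smul_mem _ r h.1, fun y a g x =>
    congrArg (r • ·) (h.2.1 y a g x), fun a j e => by simp [h.2.2 a j e]⟩

variable {V}

/-- The de Rham differential on invariant forms. -/
def invariantD (K : Subgroup Rˣ) (q : ℕ) :
    invariantForms V K q →ₗ[ℝ] invariantForms V K (q + 1) :=
  ((deRham V K 0 (q + 1)).subtype ∘ₗ extD K 0 q ∘ₗ
    Submodule.inclusion (p := invariantForms V K q) fun _ h => h.1).codRestrict _
      fun α => ⟨Subtype.property _, (extD_spec ⟨α.1, α.2.1⟩).invariant α.2.2⟩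

theorem invariantD_spec {K : Subgroup Rˣ} {q : ℕ} (α : invariantForms V K q) :
    IsExtDeriv α.1 (invariantD K q α).1 :=
  extD_spec ⟨α.1, α.2.1⟩

theorem invariantD_invariantD {K : Subgroup Rˣ} {q : ℕ} (α : invariantForms V K q) :
    invariantD K (q + 1) (invariantD K q α) = 0 := by
  have h : extD K 0 (q + 1) (extD K 0 q ⟨α.1, α.2.1⟩) = 0 := extD_extD _
  exact Subtype.ext (congrArg Subtype.val h :)

/-- The de Rham differential on the bicomplex. -/
def bicomplexD (K : Subgroup Rˣ) (m q : ℕ) :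
    bicomplex V K m q →ₗ[ℝ] bicomplex V K m (q + 1) :=
  ((deRham V K (m + 1) (q + 1)).subtype ∘ₗ extD K (m + 1) q ∘ₗ
    Submodule.inclusion (p := bicomplex V K m q) fun _ h => h.1).codRestrict _
      fun α => ⟨Subtype.property _, (extD_spec ⟨α.1, α.2.1⟩).invariant α.2.2.1, by
        intro h j e
        funext g
        ext x
        obtain ⟨y, hy, ey⟩ := extD_spec ⟨α.1, α.2.1⟩ h g x
        have : y = 0 := funext fun i => (hy i).unique (by
          simpa [α.2.2.2 h j e] using! hasDerivAt_const (0 : ℝ) (0 : V))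
        refine ey.trans ?_
        simp [this]⟩

theorem bicomplexD_spec {K : Subgroup Rˣ} {m q : ℕ} (α : bicomplex V K m q) :
    IsExtDeriv α.1 (bicomplexD K m q α).1 :=
  extD_spec ⟨α.1, α.2.1⟩

theorem bicomplexD_bicomplexD {K : Subgroup Rˣ} {m q : ℕ} (α : bicomplex V K m q) :
    bicomplexD K m (q + 1) (bicomplexD K m q α) = 0 := by
  have h : extD K (m + 1) (q + 1) (extD K (m + 1) q ⟨α.1, α.2.1⟩) = 0 := extD_extD _
  exact Subtype.ext (congrArg Subtype.val h :)

theorem bicomplexD_eq {K : Subgroup Rˣ} {m q : ℕ} {α : bicomplex V K m q}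
    {η : bicomplex V K m (q + 1)} (h : IsExtDeriv α.1 η.1) : bicomplexD K m q α = η :=
  Subtype.ext ((bicomplexD_spec α).unique h)

end Forms

/-! ### Simplicial coboundaries -/

section Simplicial

variable {G : Type*} [Group G] {W : Type*} [AddCommGroup W] [Module ℝ W]

/-- The coboundary `∑ (-1)^i ∂_i^*` for the simplicial set `EG`, whose `i`-th face omits the
`i`-th entry. -/
def homCoboundary {m : ℕ} (F : (Fin (m + 1) → G) → W) (h : Fin (m + 2) → G) : W :=
  ∑ i : Fin (m + 2), (-1 : ℝ) ^ (i : ℕ) • F (fun j => h (i.succAbove j))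

/-- The `i`-th face of the nerve `BG`: it omits `g_1` if `i = 0`, omits the last entry if
`i = m + 1`, and multiplies `g_i` and `g_{i+1}` otherwise. -/
def barFace {m : ℕ} (i : Fin (m + 2)) (g : Fin (m + 1) → G) (j : Fin m) : G :=
  if (j : ℕ) + 1 < i then g j.castSucc
  else if (j : ℕ) + 1 = i then g j.castSucc * g j.succ else g j.succ

/-- The coboundary `∑ (-1)^i ∂_i^*` for the nerve `BG`. -/
def barCoboundary {m : ℕ} (f : (Fin m → G) → W) (g : Fin (m + 1) → G) : W :=
  ∑ i : Fin (m + 2), (-1 : ℝ) ^ (i : ℕ) • f (barFace i g)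

/-- The quotient map `EG → EG / G = BG` for the right action of `G`,
`(h_0, …, h_m) ↦ (h_0 h_1⁻¹, …, h_{m-1} h_m⁻¹)`. -/
def toBar {m : ℕ} (h : Fin (m + 1) → G) (j : Fin m) : G :=
  h j.castSucc * (h j.succ)⁻¹

theorem toBar_surjective {m : ℕ} : Function.Surjective (toBar : (Fin (m + 1) → G) → Fin m → G) := by
  intro g
  refine ⟨fun i => (Fin.partialProd g i)⁻¹, funext fun j => ?_⟩
  simpa [toBar] using Fin.partialProd_right_inv g j

theorem barFace_toBar {m : ℕ} (h : Fin (m + 2) → G) (i : Fin (m + 2)) :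
    barFace i (toBar h) = toBar (fun j => h (i.succAbove j)) := by
  funext j
  simp only [barFace, toBar]
  split_ifs with h1 h2
  · rw [Fin.succAbove_of_castSucc_lt _ _ (by simp [Fin.lt_def]; omega),
      Fin.succAbove_of_castSucc_lt _ _ (by simp [Fin.lt_def]; omega)]
    rfl
  · rw [Fin.succAbove_of_castSucc_lt _ _ (by simp [Fin.lt_def]; omega),
      Fin.succAbove_of_le_castSucc _ _ (by simp [Fin.le_def]; omega)]
    simp [mul_assoc]
  · rw [Fin.succAbove_of_le_castSucc _ _ (by simp [Fin.le_def]; omega),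
      Fin.succAbove_of_le_castSucc _ _ (by simp [Fin.le_def]; omega)]
    rfl

theorem homCoboundary_toBar {m : ℕ} (f : (Fin m → G) → W) (h : Fin (m + 2) → G) :
    homCoboundary (fun h => f (toBar h)) h = barCoboundary f (toBar h) := by
  simp only [homCoboundary, barCoboundary, barFace_toBar]

theorem homCoboundary_homCoboundary {m : ℕ} (F : (Fin (m + 1) → G) → W) :
    homCoboundary (homCoboundary F) = 0 := by
  funext h
  simp only [homCoboundary, Finset.smul_sum, smul_smul, ← pow_add, Pi.zero_apply]
  rw [← Finset.sum_product' (f := fun (i : Fin (m + 3)) (j : Fin (m + 2)) =>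
    (-1 : ℝ) ^ ((i : ℕ) + j) • F fun k => h (i.succAbove (j.succAbove k)))]
  refine Finset.sum_involution (fun p _ => (p.1.succAbove p.2, p.2.predAbove p.1)) ?_ ?_ ?_ ?_
  · rintro ⟨i, j⟩ _
    simp [Fin.neg_one_pow_succAbove_add_predAbove, Fin.succAbove_succAbove_succAbove_predAbove]
  · rintro ⟨i, j⟩ _ _ e
    exact Fin.succAbove_ne i j (congrArg Prod.fst e)
  · simp
  · rintro ⟨i, j⟩ _
    simp [Fin.succAbove_succAbove_predAbove, Fin.predAbove_predAbove_succAbove]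

theorem barCoboundary_barCoboundary {m : ℕ} (f : (Fin m → G) → W) :
    barCoboundary (barCoboundary f) = 0 := by
  funext g
  obtain ⟨h, rfl⟩ := toBar_surjective g
  rw [← homCoboundary_toBar]
  simp only [← homCoboundary_toBar]
  exact congrFun (homCoboundary_homCoboundary fun h => f (toBar h)) h

/-- The coboundary of a cochain that vanishes on degenerate simplices does so too. -/
theorem homCoboundary_normalized {m : ℕ} {F : (Fin (m + 1) → G) → W}
    (hF : ∀ (h : Fin (m + 1) → G) (j : Fin m), h j.castSucc = h j.succ → F h = 0)
    (h : Fin (m + 2) → G) (j : Fin (m + 1)) (e : h j.castSucc = h j.succ) :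
    homCoboundary F h = 0 := by
  rw [homCoboundary, Fintype.sum_eq_add j.castSucc j.succ (by simp [Fin.ext_iff])]
  · have : (fun k => h (j.castSucc.succAbove k)) = fun k => h (j.succ.succAbove k) := by
      funext k
      rcases lt_trichotomy k j with hk | rfl | hk
      · rw [Fin.succAbove_of_castSucc_lt _ _ (by simpa using hk),
          Fin.succAbove_of_castSucc_lt _ _ (by simp only [Fin.lt_def] at *; simp; omega)]
      · simp [e]
      · rw [Fin.succAbove_of_le_castSucc _ _ (by simpa using hk.le),
          Fin.succAbove_of_le_castSucc _ _ (by simp only [Fin.lt_def, Fin.le_def] at *; simp; omega)]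
    rw [this]
    simp [pow_succ]
  · rintro i ⟨h1, h2⟩
    have h1' : (i : ℕ) ≠ j := fun h => h1 (Fin.ext h)
    have h2' : (i : ℕ) ≠ j + 1 := fun h => h2 (Fin.ext h)
    have hi := i.2
    have hj := j.2
    suffices hk : ∃ k : Fin m, (i.succAbove k.castSucc = j.castSucc ∧ i.succAbove k.succ = j.succ) by
      obtain ⟨k, e1, e2⟩ := hk
      rw [hF _ k (by rw [e1, e2, e]), smul_zero]
    rcases lt_or_gt_of_ne h1' with hlt | hgt
    · refine ⟨⟨j - 1, by omega⟩, ?_, ?_⟩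
      · rw [Fin.succAbove_of_le_castSucc _ _ (by simp [Fin.le_def]; omega)]
        ext; simp; omega
      · rw [Fin.succAbove_of_le_castSucc _ _ (by simp [Fin.le_def]; omega)]
        ext; simp; omega
    · refine ⟨⟨j, by omega⟩, ?_, ?_⟩
      · rw [Fin.succAbove_of_castSucc_lt _ _ (by simp [Fin.lt_def]; omega)]
        ext; simp
      · rw [Fin.succAbove_of_castSucc_lt _ _ (by simp [Fin.lt_def]; omega)]
        ext; simp

end Simplicial

/-! ### Differentiable cochains, and the columns of the bicomplex -/

section Cochains

variable {R : Type u} [Ring R] [Algebra ℝ R] [TopologicalSpace R] [IsTopologicalRing R]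
  [ContinuousSMul ℝ R]
variable {V : Type v} [NormedAddCommGroup V] [NormedSpace ℝ V]

variable (R V) in
/-- `C^m_diff(Rˣ, V)`: the smooth maps `(Rˣ)^m → V` that vanish on degenerate simplices, i.e. the
conormalisation of the cosimplicial vector space of smooth maps `(B Rˣ)_m → V`. -/
def diffCochains (m : ℕ) : Submodule ℝ ((Fin m → Rˣ) → V) where
  carrier := {f | (∀ c : Fin m → ℝ → Rˣ, (∀ j, IsSmoothUnitCurve (c j)) →
      ContDiff ℝ ∞ fun t => f fun j => c j t) ∧
    ∀ g : Fin m → Rˣ, (∃ j, g j = 1) → f g = 0}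
  zero_mem' := ⟨fun _ _ => contDiff_const, fun _ _ => rfl⟩
  add_mem' {f f'} h h' := ⟨fun c hc => (h.1 c hc).add (h'.1 c hc), fun g hg => by
    simp [h.2 g hg, h'.2 g hg]⟩
  smul_mem' r f h := ⟨fun c hc => (h.1 c hc).const_smul r, fun g hg => by simp [h.2 g hg]⟩

/-- The differential `∑ (-1)^i ∂_i^*` of `C^•_diff(Rˣ, V)`. -/
def diffD (m : ℕ) : diffCochains R V m →ₗ[ℝ] diffCochains R V (m + 1) where
  toFun f := ⟨barCoboundary f.1, by
    refine ⟨fun c hc => ?_, fun g hg => ?_⟩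
    · refine ContDiff.sum fun i _ => ContDiff.const_smul _ ?_
      refine f.2.1 (fun j t => barFace i (fun k => c k t) j) fun j => ?_
      simp only [barFace]
      split_ifs
      · exact hc _
      · exact (hc _).mul' (hc _)
      · exact hc _
    · obtain ⟨h, rfl⟩ := toBar_surjective g
      obtain ⟨j, hj⟩ := hg
      rw [← homCoboundary_toBar]
      refine homCoboundary_normalized (fun h j e => f.2.2 _ ⟨j, ?_⟩) h j ?_
      · simp [toBar, e]
      · simpa [toBar, mul_inv_eq_one] using hj⟩
  map_add' f f' := by
    ext g
    simp [barCoboundary, Finset.sum_add_distrib]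
  map_smul' r f := by
    ext g
    simp [barCoboundary, Finset.smul_sum, smul_comm r]

theorem diffD_diffD {m : ℕ} (f : diffCochains R V m) : diffD (m + 1) (diffD m f) = 0 :=
  Subtype.ext (barCoboundary_barCoboundary f.1)

theorem alternatingMap_sum_apply {ι : Type*} {q : ℕ} (s : Finset ι) (f : ι → R [⋀^Fin q]→ₗ[ℝ] V)
    (x : Fin q → R) : (∑ i ∈ s, f i) x = ∑ i ∈ s, f i x := by
  classical
  induction s using Finset.induction_on with
  | empty => simp
  | insert a s ha ih => simp [Finset.sum_insert ha, ih]

/-- Substitution in the parameters. -/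
theorem deRham_reparam {K : Subgroup Rˣ} {p p' q : ℕ} (s : Fin p → Fin p') {α : RawForm R V p q}
    (h : α ∈ deRham V K p q) : (fun z => α fun j => z (s j)) ∈ deRham V K p' q := by
  have key : ∀ {q : ℕ} {α : RawForm R V p q}, α ∈ smoothForms V K p q →
      (fun z => α fun j => z (s j)) ∈ smoothForms V K p' q := fun h =>
    ⟨fun a c x ha hc hx => h.1 (fun j => a (s j)) c x (fun j => ha _) hc hx,
      fun a => h.2.1 _, fun a => h.2.2 _⟩
  obtain ⟨h, η, hη, e, f⟩ := h
  exact ⟨key h, _, key hη, fun z => e _, fun z => f _⟩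

/-- The coboundary on the bicomplex, for the simplicial manifold `E Rˣ`. -/
def bicomplexδ (K : Subgroup Rˣ) (m q : ℕ) :
    bicomplex V K m q →ₗ[ℝ] bicomplex V K (m + 1) q where
  toFun α := ⟨homCoboundary α.1, by
    refine ⟨?_, fun y h g x => ?_, homCoboundary_normalized α.2.2.2⟩
    · have : homCoboundary α.1 =
          ∑ i : Fin (m + 2), (-1 : ℝ) ^ (i : ℕ) • fun z => α.1 fun j => z (i.succAbove j) := by
        funext z
        simp [homCoboundary]
      rw [this]
      exact sum_mem fun i _ => Submodule.smul_mem _ _ (deRham_reparam _ α.2.1)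
    · simp only [homCoboundary, Finset.sum_apply, Pi.smul_apply, alternatingMap_sum_apply,
        AlternatingMap.smul_apply]
      exact Finset.sum_congr rfl fun i _ => congrArg _ (α.2.2.1 y _ g x)⟩
  map_add' α α' := by
    apply Subtype.ext
    funext z
    simp [homCoboundary, Finset.sum_add_distrib]
  map_smul' r α := by
    apply Subtype.ext
    funext z
    simp [homCoboundary, Finset.smul_sum, smul_comm r]

theorem bicomplexδ_bicomplexδ {K : Subgroup Rˣ} {m q : ℕ} (α : bicomplex V K m q) :
    bicomplexδ K (m + 1) q (bicomplexδ K m q α) = 0 :=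
  Subtype.ext (homCoboundary_homCoboundary α.1)

theorem bicomplexD_bicomplexδ {K : Subgroup Rˣ} {m q : ℕ} (α : bicomplex V K m q) :
    bicomplexD K (m + 1) q (bicomplexδ K m q α) = bicomplexδ K m (q + 1) (bicomplexD K m q α) := by
  refine bicomplexD_eq fun z g x => ?_
  choose y hy e using fun i : Fin (m + 2) => bicomplexD_spec α (fun j => z (i.succAbove j)) g x
  refine ⟨∑ i : Fin (m + 2), (-1 : ℝ) ^ (i : ℕ) • y i, fun k => ?_, ?_⟩
  · have := HasDerivAt.fun_sum (u := Finset.univ) fun i (_ : i ∈ Finset.univ) =>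
      (hy i k).const_smul ((-1 : ℝ) ^ (i : ℕ))
    simpa [bicomplexδ, homCoboundary, alternatingMap_sum_apply] using! this
  · simp only [bicomplexδ, homCoboundary, LinearMap.coe_mk, AddHom.coe_mk, Finset.sum_apply,
      Pi.smul_apply, alternatingMap_sum_apply, AlternatingMap.smul_apply, e, Finset.smul_sum]
    rw [Finset.sum_comm]
    exact Finset.sum_congr rfl fun _ _ => Finset.sum_congr rfl fun _ _ => smul_comm _ _ _

end Cochains

/-! ### Total complexes -/

section Total

variable {X : ℕ → ℕ → Type w} [∀ m q, AddCommGroup (X m q)] [∀ m q, Module ℝ (X m q)]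

variable (X) in
/-- The total space in degree `n` of a first quadrant bigraded vector space: families of elements
of the `X m q` that vanish unless `m + q = n`. -/
def totSpace (n : ℕ) : Submodule ℝ (∀ m q, X m q) where
  carrier := {α | ∀ m q, m + q ≠ n → α m q = 0}
  zero_mem' _ _ _ := rfl
  add_mem' h h' m q e := by simp [h m q e, h' m q e]
  smul_mem' r α h m q e := by simp [h m q e]

/-- The total differential `δ + (-1)^m d` on families of elements of `X m q`. -/
def totD (δ : ∀ m q, X m q →ₗ[ℝ] X (m + 1) q) (d : ∀ m q, X m q →ₗ[ℝ] X m (q + 1))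
    (α : ∀ m q, X m q) : ∀ m q, X m q
  | 0, 0 => 0
  | m + 1, 0 => δ m 0 (α m 0)
  | 0, q + 1 => d 0 q (α 0 q)
  | m + 1, q + 1 => δ m (q + 1) (α m (q + 1)) + (-1 : ℝ) ^ (m + 1) • d (m + 1) q (α (m + 1) q)

variable (δ : ∀ m q, X m q →ₗ[ℝ] X (m + 1) q) (d : ∀ m q, X m q →ₗ[ℝ] X m (q + 1))

/-- The total differential in degree `n`. -/
def totDiff (n : ℕ) : totSpace X n →ₗ[ℝ] totSpace X (n + 1) where
  toFun α := ⟨totD δ d α.1, by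
    rintro (_ | m) (_ | q) h
    · rfl
    · simp only [totD]
      rw [α.2 0 q (by omega), map_zero]
    · simp only [totD]
      rw [α.2 m 0 (by omega), map_zero]
    · simp only [totD]
      rw [α.2 m (q + 1) (by omega), α.2 (m + 1) q (by omega), map_zero, map_zero, smul_zero,
        add_zero]⟩
  map_add' α α' := by
    apply Subtype.ext
    funext m q
    rcases m with _ | m <;> rcases q with _ | q <;> simp [totD]
    abel
  map_smul' r α := by
    apply Subtype.ext
    funext m q
    rcases m with _ | m <;> rcases q with _ | q <;> simp [totD, smul_comm r]

theorem totDiff_totDiff (hδ : ∀ m q x, δ (m + 1) q (δ m q x) = 0)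
    (hd : ∀ m q x, d m (q + 1) (d m q x) = 0)
    (hδd : ∀ m q x, d (m + 1) q (δ m q x) = δ m (q + 1) (d m q x)) (n : ℕ) (α : totSpace X n) :
    totDiff δ d (n + 1) (totDiff δ d n α) = 0 := by
  apply Subtype.ext
  funext m q
  rcases m with _ | _ | m <;> rcases q with _ | _ | q <;>
    simp [totDiff, totD, hδ, hd, hδd, pow_succ]

/-- The total complex. -/
def total (hδ : ∀ m q x, δ (m + 1) q (δ m q x) = 0)
    (hd : ∀ m q x, d m (q + 1) (d m q x) = 0)
    (hδd : ∀ m q x, d (m + 1) q (δ m q x) = δ m (q + 1) (d m q x)) :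
    CochainComplex (ModuleCat.{w} ℝ) ℕ :=
  CochainComplex.of (fun n => ModuleCat.of ℝ (totSpace X n))
    (fun n => ModuleCat.ofHom (totDiff δ d n)) fun n => by
      apply ModuleCat.hom_ext
      exact LinearMap.ext fun α => totDiff_totDiff δ d hδ hd hδd n α

variable (X) in
/-- The inclusion of `X m q` into the total space. -/
def totSingle {m q n : ℕ} (h : m + q = n) : X m q →ₗ[ℝ] totSpace X n :=
  (LinearMap.single ℝ (fun m => ∀ q, X m q) m ∘ₗ LinearMap.single ℝ (X m) q).codRestrict _ <| by
    intro x m' q' h'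
    by_cases hm : m' = m
    · subst hm
      have hq : q' ≠ q := by omega
      simp [hq]
    · simp [hm]

theorem totSingle_same {m q n : ℕ} (h : m + q = n) (x : X m q) :
    (totSingle X h x).1 m q = x := by
  change Pi.single (M := fun m => ∀ q, X m q) m (Pi.single q x) m q = x
  simp

theorem totSingle_ne {m q n m' q' : ℕ} (h : m + q = n) (x : X m q) (h' : ¬ (m' = m ∧ q' = q)) :
    (totSingle X h x).1 m' q' = 0 := by
  change Pi.single (M := fun m => ∀ q, X m q) m (Pi.single q x) m' q' = 0
  by_cases hm : m' = m
  · subst hm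
    have hq : q' ≠ q := by tauto
    simp [hq]
  · simp [hm]

theorem totDiff_totSingle {m q n : ℕ} (h : m + q = n) (x : X m q) :
    totDiff δ d n (totSingle X h x) =
      totSingle X (show m + 1 + q = n + 1 by omega) (δ m q x) +
        (-1 : ℝ) ^ m • totSingle X (show m + (q + 1) = n + 1 by omega) (d m q x) := by
  have e1 : ∀ m' q', δ m' q' ((totSingle X h x).1 m' q') =
      (totSingle X (show m + 1 + q = n + 1 by omega) (δ m q x)).1 (m' + 1) q' := by
    intro m' q'
    by_cases h' : m' = m ∧ q' = q
    · obtain ⟨rfl, rfl⟩ := h'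
      rw [totSingle_same, totSingle_same]
    · rw [totSingle_ne _ _ h', totSingle_ne _ _ (by omega), map_zero]
  have e2 : ∀ m' q', (-1 : ℝ) ^ m' • d m' q' ((totSingle X h x).1 m' q') = (-1 : ℝ) ^ m •
      (totSingle X (show m + (q + 1) = n + 1 by omega) (d m q x)).1 m' (q' + 1) := by
    intro m' q'
    by_cases h' : m' = m ∧ q' = q
    · obtain ⟨rfl, rfl⟩ := h'
      rw [totSingle_same, totSingle_same]
    · rw [totSingle_ne _ _ h', totSingle_ne _ _ (by omega), map_zero, smul_zero, smul_zero]
  apply Subtype.ext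
  funext m' q'
  show totD δ d _ m' q' = _ + (-1 : ℝ) ^ m • _
  rcases m' with _ | m' <;> rcases q' with _ | q' <;> simp only [totD]
  · rw [totSingle_ne _ _ (by omega), totSingle_ne _ _ (by omega), smul_zero, add_zero]
  · have := e2 0 q'
    rw [pow_zero, one_smul] at this
    rw [this, totSingle_ne (m' := 0) (q' := q' + 1) _ (δ m q x) (by omega), zero_add]
  · rw [e1, totSingle_ne (m' := m' + 1) (q' := 0) _ (d m q x) (by omega), smul_zero, add_zero]
  · rw [e1, e2]

theorem totDiff_totSingle_of_d_eq_zero {m q n : ℕ} (h : m + q = n) {x : X m q} (hx : d m q x = 0) :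
    totDiff δ d n (totSingle X h x) =
      totSingle X (show m + 1 + q = n + 1 by omega) (δ m q x) := by
  rw [totDiff_totSingle, hx, map_zero, smul_zero, add_zero]

theorem totDiff_totSingle_of_δ_eq_zero {q n : ℕ} (h : 0 + q = n) {x : X 0 q} (hx : δ 0 q x = 0) :
    totDiff δ d n (totSingle X h x) =
      totSingle X (show 0 + (q + 1) = n + 1 by omega) (d 0 q x) := by
  rw [totDiff_totSingle, hx, map_zero, zero_add, pow_zero, one_smul]

end Total

/-! ### The zigzag -/

section Zigzag

variable (R : Type u) [Ring R] [Algebra ℝ R] [TopologicalSpace R] [IsTopologicalRing R]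
  [ContinuousSMul ℝ R]
variable (V : Type v) [NormedAddCommGroup V] [NormedSpace ℝ V]

/-- The complex `C^•_diff(Rˣ, V)` of differentiable cochains. -/
def diffComplex : CochainComplex (ModuleCat.{max u v} ℝ) ℕ :=
  CochainComplex.of (fun m => ModuleCat.of ℝ (diffCochains R V m))
    (fun m => ModuleCat.ofHom (diffD m)) fun _ =>
      ModuleCat.hom_ext (LinearMap.ext fun f => diffD_diffD f)

variable {R}
variable (K : Subgroup Rˣ)

/-- The complex `A^•(K \ Rˣ, V)^{Rˣ}` of invariant forms. -/
def invariantComplex : CochainComplex (ModuleCat.{max u v} ℝ) ℕ :=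
  CochainComplex.of (fun q => ModuleCat.of ℝ (invariantForms V K q))
    (fun q => ModuleCat.ofHom (invariantD K q)) fun _ =>
      ModuleCat.hom_ext (LinearMap.ext fun α => invariantD_invariantD α)

/-- The complex `Tot A^0(E Rˣ, A^•(K \ Rˣ, V))^{Rˣ}`. -/
def middleComplex : CochainComplex (ModuleCat.{max u v} ℝ) ℕ :=
  total (X := fun m q => bicomplex V K m q) (bicomplexδ K) (bicomplexD K)
    (fun _ _ => bicomplexδ_bicomplexδ) (fun _ _ => bicomplexD_bicomplexD)
    (fun _ _ => bicomplexD_bicomplexδ)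

variable {V}

/-- The inclusion `C^m_diff(Rˣ, V) = A^0((E Rˣ)_m, V)^{Rˣ} → A^0((E Rˣ)_m, A^0(K \ Rˣ, V))^{Rˣ}` of
functions constant along `K \ Rˣ`. -/
def diffEdge (m : ℕ) : diffCochains R V m →ₗ[ℝ] bicomplex V K m 0 where
  toFun f := ⟨fun h _ => AlternatingMap.constOfIsEmpty ℝ R (Fin 0) (f.1 (toBar h)), by
    refine ⟨⟨⟨fun h c x hh _ _ => ?_, fun _ _ _ _ _ => rfl, fun _ _ _ i => i.elim0⟩,
      0, zero_mem _, fun h g x => ⟨0, fun i => hasDerivAt_const _ _, by simp⟩, .zero⟩,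
      fun y h g x => ?_, fun h j e => ?_⟩
    · exact f.2.1 (fun j t => toBar (fun k => h k t) j) fun j => (hh _).mul' (hh _).inv'
    · have : toBar (fun j => h j * y) = toBar h := by
        funext j
        simp [toBar]
      simp [this]
    · funext g
      ext x
      exact f.2.2 _ ⟨j, by simp [toBar, e]⟩⟩
  map_add' f f' := rfl
  map_smul' r f := rfl

/-- The inclusion `A^q(K \ Rˣ, V)^{Rˣ} → A^0((E Rˣ)_0, A^q(K \ Rˣ, V))^{Rˣ}` of constant families. -/
def invariantEdge (q : ℕ) : invariantForms V K q →ₗ[ℝ] bicomplex V K 0 q where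
  toFun α := ⟨fun _ => α.1 Fin.elim0, by
    refine ⟨?_, fun y h g x => ?_, fun _ j => j.elim0⟩
    · have := deRham_reparam (p' := 1) (Fin.elim0 : Fin 0 → Fin 1) α.2.1
      convert! this using 3
    · have h0 : (fun j : Fin 0 => (Fin.elim0 j : Rˣ) * y) = Fin.elim0 := Subsingleton.elim _ _
      have := α.2.2 y Fin.elim0 g x
      rwa [h0] at this⟩
  map_add' f f' := rfl
  map_smul' r f := rfl

theorem bicomplexδ_diffEdge {m : ℕ} (f : diffCochains R V m) :
    bicomplexδ K m 0 (diffEdge K m f) = diffEdge K (m + 1) (diffD m f) := by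
  apply Subtype.ext
  funext h g
  ext x
  change (homCoboundary (fun z (_ : Rˣ) => AlternatingMap.constOfIsEmpty ℝ R (Fin 0)
    (f.1 (toBar z))) h g) x = barCoboundary f.1 (toBar h)
  rw [← homCoboundary_toBar]
  simp [homCoboundary, alternatingMap_sum_apply]

theorem bicomplexD_diffEdge {m : ℕ} (f : diffCochains R V m) :
    bicomplexD K m 0 (diffEdge K m f) = 0 :=
  bicomplexD_eq fun _ _ _ => ⟨0, fun _ => hasDerivAt_const _ _, by simp⟩

theorem bicomplexδ_invariantEdge {q : ℕ} (α : invariantForms V K q) :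
    bicomplexδ K 0 q (invariantEdge K q α) = 0 := by
  apply Subtype.ext
  funext h g
  change homCoboundary (fun _ => α.1 Fin.elim0) h g = 0
  simp [homCoboundary, Fin.sum_univ_two]

theorem bicomplexD_invariantEdge {q : ℕ} (α : invariantForms V K q) :
    bicomplexD K 0 q (invariantEdge K q α) = invariantEdge K (q + 1) (invariantD K q α) :=
  bicomplexD_eq fun _ => invariantD_spec α Fin.elim0

theorem diffEdge_comm {n : ℕ} (f : diffCochains R V n) :
    totDiff (X := fun m q => bicomplex V K m q) (bicomplexδ K) (bicomplexD K) n
        (totSingle (fun m q => bicomplex V K m q) (add_zero n) (diffEdge K n f)) =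
      totSingle (fun m q => bicomplex V K m q) (add_zero (n + 1))
        (diffEdge K (n + 1) (diffD n f)) := by
  rw [totDiff_totSingle_of_d_eq_zero _ _ _ (bicomplexD_diffEdge K f), bicomplexδ_diffEdge]

theorem invariantEdge_comm {n : ℕ} (α : invariantForms V K n) :
    totDiff (X := fun m q => bicomplex V K m q) (bicomplexδ K) (bicomplexD K) n
        (totSingle (fun m q => bicomplex V K m q) (zero_add n) (invariantEdge K n α)) =
      totSingle (fun m q => bicomplex V K m q) (zero_add (n + 1))
        (invariantEdge K (n + 1) (invariantD K n α)) := by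
  rw [totDiff_totSingle_of_δ_eq_zero _ _ _ (bicomplexδ_invariantEdge K α),
    bicomplexD_invariantEdge]

theorem diffComplex_d (n : ℕ) :
    (diffComplex R V).d n (n + 1) = ModuleCat.ofHom (diffD (R := R) (V := V) n) := by
  unfold diffComplex
  simp [CochainComplex.of.d]

theorem invariantComplex_d (n : ℕ) :
    (invariantComplex V K).d n (n + 1) = ModuleCat.ofHom (invariantD (V := V) K n) := by
  unfold invariantComplex
  simp [CochainComplex.of.d]

theorem middleComplex_d (n : ℕ) : (middleComplex V K).d n (n + 1) =
    ModuleCat.ofHom (totDiff (X := fun m q => bicomplex V K m q) (bicomplexδ K) (bicomplexD K) n) := by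
  unfold middleComplex total
  simp [CochainComplex.of.d]

/-- The canonical map `C^•_diff(Rˣ, V) → Tot A^0(E Rˣ, A^•(K \ Rˣ, V))^{Rˣ}`. -/
def diffToMiddle : diffComplex R V ⟶ middleComplex V K :=
  CochainComplex.ofHom
    (fun n => ModuleCat.ofHom
      (totSingle (fun m q => bicomplex V K m q) (add_zero n) ∘ₗ diffEdge K n)) fun n => by
      rw [middleComplex_d, diffComplex_d]
      exact ModuleCat.hom_ext (LinearMap.ext fun f => diffEdge_comm K f)

/-- The canonical map `A^•(K \ Rˣ, V)^{Rˣ} → Tot A^0(E Rˣ, A^•(K \ Rˣ, V))^{Rˣ}`. -/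
def invariantToMiddle : invariantComplex V K ⟶ middleComplex V K :=
  CochainComplex.ofHom
    (fun n => ModuleCat.ofHom
      (totSingle (fun m q => bicomplex V K m q) (zero_add n) ∘ₗ invariantEdge K n)) fun n => by
      rw [middleComplex_d, invariantComplex_d]
      exact ModuleCat.hom_ext (LinearMap.ext fun f => invariantEdge_comm K f)

end Zigzag

/-! ### Holomorphic functions on polydiscs -/

section Polydisc

/-- The open unit polydisc in `ℂ^d`. -/
def unitPolydisc (d : ℕ) : TopologicalSpace.Opens (Fin d → ℂ) :=
  ⟨{z | ∀ i, ‖z i‖ < 1}, by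
    simp only [Set.ofPred_forall]
    exact isOpen_iInter_of_finite fun i => isOpen_lt (by fun_prop) continuous_const⟩

variable (d : ℕ) {X : Type*} [TopologicalSpace X] [ChartedSpace (Fin d → ℂ) X]

/-- `B` is biholomorphic to the open unit polydisc. -/
def IsPolydisc (B : TopologicalSpace.Opens X) : Prop :=
  ∃ φ : B ≃ₜ unitPolydisc d,
    MDifferentiable 𝓘(ℂ, Fin d → ℂ) 𝓘(ℂ, Fin d → ℂ) φ ∧
      MDifferentiable 𝓘(ℂ, Fin d → ℂ) 𝓘(ℂ, Fin d → ℂ) φ.symm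

/-- The algebra `O(B)` of holomorphic functions on `B`, with the topology of uniform convergence on
compact subsets. -/
def holomorphicFunctions (B : TopologicalSpace.Opens X) : Subalgebra ℂ C(B, ℂ) where
  carrier := {f | MDifferentiable 𝓘(ℂ, Fin d → ℂ) 𝓘(ℂ) f}
  mul_mem' {f g} hf hg := by
    simpa using! MDifferentiable.mul (p := (f : B → ℂ)) (q := (g : B → ℂ)) hf hg
  add_mem' {f g} hf hg := by
    simpa using! MDifferentiable.add (f := (f : B → ℂ)) (g := (g : B → ℂ)) hf hg
  algebraMap_mem' _ := mdifferentiable_const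

/-- The topological algebra `O(B)`, as a type. -/
def HolAlg (B : TopologicalSpace.Opens X) : Type _ := holomorphicFunctions d B

instance (B : TopologicalSpace.Opens X) : CommRing (HolAlg d B) :=
  inferInstanceAs (CommRing (holomorphicFunctions d B))

instance (B : TopologicalSpace.Opens X) : Algebra ℂ (HolAlg d B) :=
  inferInstanceAs (Algebra ℂ (holomorphicFunctions d B))

instance (B : TopologicalSpace.Opens X) : Algebra ℝ (HolAlg d B) :=
  Algebra.restrictScalars ℝ ℂ (HolAlg d B)

instance (B : TopologicalSpace.Opens X) : TopologicalSpace (HolAlg d B) :=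
  inferInstanceAs (TopologicalSpace (holomorphicFunctions d B))

instance (B : TopologicalSpace.Opens X) : IsTopologicalRing (HolAlg d B) :=
  have : LocallyCompactSpace B := ChartedSpace.locallyCompactSpace (Fin d → ℂ) B
  inferInstanceAs (IsTopologicalRing (holomorphicFunctions d B).toSubring)

instance (B : TopologicalSpace.Opens X) : ContinuousSMul ℝ (HolAlg d B) where
  continuous_smul := by
    refine Continuous.subtype_mk (f := fun p : ℝ × holomorphicFunctions d B => p.1 • (p.2 : C(B, ℂ)))
      ?_ _
    fun_prop

/-- The subgroup `U_n` of constant unitary matrices in `GL_n(O(B))`. -/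
def unitarySubgroup (B : TopologicalSpace.Opens X) (n : ℕ) :
    Subgroup (Matrix (Fin n) (Fin n) (HolAlg d B))ˣ :=
  ((Units.map (algebraMap ℂ (HolAlg d B)).mapMatrix.toMonoidHom).comp
    (Unitary.toUnits (R := Matrix (Fin n) (Fin n) ℂ))).range

end Polydisc

end FrechetLie

set_option linter.unusedSectionVars false

/-! Write `G = Rˣ`. Both maps are edge maps of the double complex of invariant families of basic
forms. By the staircase argument (`exists_totDiff_add_bottom`, `exists_totDiff_add_left`) two facts
suffice. The columns (de Rham direction) must be exact in positive degrees, with the bar cochains as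
kernel in degree 0. The rows (simplicial direction) must be exact in positive degrees, with the
constant families as kernel in degree 0.

Columns: this is a Poincaré lemma for `K \ G`, compatible with the right action. If `H` is the
deformation onto `K`, then `g ↦ H (g h₀⁻¹) t * h₀` deforms `G` onto `K h₀`. Left equivariance makes
it descend to `K \ G`, and taking the vertex `h₀` as base point makes it commute with simultaneous
right translation. Integrating over `t` the contraction with its velocity gives a primitive of a
closed form (`isExtDeriv_homotopyOperator`). In degree 0 a closed function is constant along `K \ G`
(`exists_diffEdge_eq`).

Rows: a contraction of `EG` adds a vertex. The point `g` at which the form is evaluated is an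
invariant choice, but it is determined only up to `K`. Since `K` is compact, one can average over
the vertices `k⁻¹ g` with respect to Haar measure (`exists_bicomplexδ_eq`).

Analysis: smoothness is only assumed along smooth curves. Boman's theorem (`CurveSmooth.contDiff`)
upgrades it to ordinary smoothness on finite-dimensional plots. A Fréchet algebra embeds in a
product of Banach algebras (`IsFrechetRep`), where curves and exponentials are handled
componentwise. The essential point is that the derivative of a function along a curve depends only
on the velocity of the curve (`SmoothOnUnits.deriv_eq_zero`). Let `w 0 = 1` and `w' 0 = 0`. The
curves `r ↦ w(r/N)^N` tend to `1` with all derivatives on bounded intervals, while the derivative of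
`f` along them at 0 does not depend on `N`. Gluing such curves at the points `2⁻ʲ` would produce an
unbounded derivative unless it is zero. Hence derivatives are linear in the tangent vector, and the
exterior derivative exists. By pulling back to `ℝ^k` it is natural, squares to zero and preserves
basic forms.

Polydisc: the dilations `f(z) ↦ f(az)` contract `GL_n(O(B))` to `GL_n(ℂ)`. They are smooth in `a` up
to `a = 1`, because on a smaller polydisc Cauchy's formula over a circle of radius `R > 1` recovers
`f(az)`. Simultaneously one multiplies on the right by `a + (1 - a) M⁻¹ Q`, where `M` is the value
at the centre and `Q` its Gram–Schmidt factor, so the deformation ends at `Q`. These matrices are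
invertible because `Q* M` is triangular with positive diagonal (`isUnit_segment`), and `M⁻¹ Q` does
not change when `M` is multiplied on the left by a unitary matrix. -/

namespace FrechetLie

/-! ### Gluing rapidly decreasing sequences of curves -/

section Glue

/-- The affine rescaling of the `j`-th dyadic interval around `2⁻ʲ`. -/
def dyadicScale (j : ℕ) (s : ℝ) : ℝ := 2 ^ (j + 2) * s - 4

open Classical in
/-- The curve that runs through `u j` near `2⁻ʲ`, and is equal to `y` elsewhere. -/
def glue {Y : Type*} (u : ℕ → ℝ → Y) (y : Y) (s : ℝ) : Y :=
  if h : ∃ j, |dyadicScale j s| < 1 then u h.choose (dyadicScale h.choose s) else y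

/-- The `j`-th window is `3 < 2^(j+2) s < 5`. Passing to a larger index at least doubles the middle
term, and `2 * 3 > 5`, so the windows are disjoint. -/
theorem dyadicScale_lt {i j : ℕ} {s : ℝ} (hi : |dyadicScale i s| < 1)
    (hj : |dyadicScale j s| < 1) : ¬ i < j := by
  intro hij
  rw [dyadicScale, abs_lt] at hi hj
  obtain ⟨k, rfl⟩ := Nat.exists_eq_add_of_lt hij
  have h1 : (1 : ℝ) ≤ 2 ^ k := one_le_pow₀ (by norm_num)
  have e : (2 : ℝ) ^ (i + k + 1 + 2) = 2 * (2 ^ (i + 2) * 2 ^ k) := by ring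
  rw [e] at hj
  have h3 : 3 < 2 ^ (i + 2) * s := by linarith [hi.1]
  have : 2 ^ (i + 2) * s ≤ 2 ^ (i + 2) * s * 2 ^ k := le_mul_of_one_le_right (by linarith) h1
  nlinarith [hj.2]

theorem dyadicScale_unique {i j : ℕ} {s : ℝ} (hi : |dyadicScale i s| < 1)
    (hj : |dyadicScale j s| < 1) : i = j := by
  have h1 := dyadicScale_lt hi hj
  have h2 := dyadicScale_lt hj hi
  omega

theorem glue_of_lt {Y : Type*} (u : ℕ → ℝ → Y) (y : Y) {j : ℕ} {s : ℝ}
    (h : |dyadicScale j s| < 1) : glue u y s = u j (dyadicScale j s) := by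
  have h' : ∃ j, |dyadicScale j s| < 1 := ⟨j, h⟩
  have e : h'.choose = j := dyadicScale_unique h'.choose_spec h
  rw [glue, dif_pos h', e]

theorem glue_of_forall_le {Y : Type*} (u : ℕ → ℝ → Y) (y : Y) {s : ℝ}
    (h : ∀ j, 1 ≤ |dyadicScale j s|) : glue u y s = y :=
  dif_neg fun ⟨j, hj⟩ => (h j).not_gt hj

@[simp] theorem glue_zero {Y : Type*} (u : ℕ → ℝ → Y) (y : Y) : glue u y 0 = y :=
  glue_of_forall_le u y fun j => by norm_num [dyadicScale]

@[simp] theorem dyadicScale_center (j : ℕ) : dyadicScale j ((2 ^ j)⁻¹) = 0 := by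
  rw [dyadicScale, pow_add, mul_right_comm, mul_inv_cancel₀ (by positivity)]
  norm_num

theorem glue_center {Y : Type*} (u : ℕ → ℝ → Y) (y : Y) (j : ℕ) :
    glue u y ((2 ^ j)⁻¹) = u j 0 := by
  rw [glue_of_lt u y (j := j) (by simp), dyadicScale_center]

theorem tendsto_center : Filter.Tendsto (fun j : ℕ => ((2 : ℝ) ^ j)⁻¹) Filter.atTop (𝓝 0) :=
  tendsto_inv_atTop_zero.comp (tendsto_pow_atTop_atTop_of_one_lt (by norm_num))

theorem comp_glue {Y Z : Type*} (f : Y → Z) (u : ℕ → ℝ → Y) (y : Y) :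
    (fun s => f (glue u y s)) = glue (fun j r => f (u j r)) (f y) := by
  funext s
  by_cases h : ∃ j, |dyadicScale j s| < 1
  · obtain ⟨j, hj⟩ := h
    rw [glue_of_lt _ _ hj, glue_of_lt _ _ hj]
  · push Not at h
    rw [glue_of_forall_le _ _ h, glue_of_forall_le _ _ h]

theorem iteratedDeriv_comp_dyadicScale {B : Type*} [NormedAddCommGroup B] [NormedSpace ℝ B]
    {k : ℕ} {f : ℝ → B} (hf : ContDiff ℝ k f) (j : ℕ) (s : ℝ) :
    iteratedDeriv k (fun s => f (dyadicScale j s)) s =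
      ((2 : ℝ) ^ (j + 2)) ^ k • iteratedDeriv k f (dyadicScale j s) := by
  have h1 : ContDiff ℝ k (fun s => f (s - 4)) := hf.comp (contDiff_id.sub contDiff_const)
  have := congrFun (iteratedDeriv_comp_const_smul h1 ((2 : ℝ) ^ (j + 2))) s
  refine this.trans ?_
  congr 1
  exact congrFun (iteratedDeriv_comp_sub_const k f 4) _

/-- The glued curve is `y` plus a series of rescaled pieces with disjoint supports. Rescaling
multiplies the `k`-th derivative of the `j`-th piece by `(2^(j+2))^k = 4^k (2^k)^j`. The factor `1 /
j!` beats this for every `k`, so all differentiated series converge uniformly. -/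
theorem contDiff_glue {B : Type*} [NormedAddCommGroup B] [NormedSpace ℝ B] [CompleteSpace B]
    {u : ℕ → ℝ → B} {y : B} (hu : ∀ j, ContDiff ℝ ∞ (u j)) (hy : ∀ j r, 1 ≤ |r| → u j r = y)
    (C : ℕ → ℝ) (hC : ∀ k, ∀ᶠ j : ℕ in Filter.atTop, ∀ r,
      ‖iteratedDeriv k (fun r => u j r - y) r‖ ≤ C k / j.factorial) :
    ContDiff ℝ ∞ (glue u y) := by
  let f : ℕ → ℝ → B := fun j s => u j (dyadicScale j s) - y
  have hf0 : ∀ j s, 1 ≤ |dyadicScale j s| → f j s = 0 := fun j s h => by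
    simp [f, hy j _ h]
  have e : glue u y = fun s => y + ∑' j, f j s := by
    funext s
    by_cases h : ∃ j, |dyadicScale j s| < 1
    · obtain ⟨j, hj⟩ := h
      rw [glue_of_lt _ _ hj, tsum_eq_single j]
      · simp [f]
      · intro i hi
        refine hf0 i s ?_
        by_contra h'
        exact hi (dyadicScale_unique (not_le.1 h') hj)
    · push Not at h
      rw [glue_of_forall_le _ _ h]
      simp [hf0 _ s (h _)]
  rw [e]
  refine contDiff_const.add ?_
  refine contDiff_tsum_of_eventually (v := fun k j => C k * (4 ^ k * ((2 ^ k) ^ j / j.factorial)))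
    (fun j => ?_) (fun k _ => ?_) fun k _ => ?_
  · exact ((hu j).comp ((contDiff_const.mul contDiff_id).sub contDiff_const)).sub contDiff_const
  · exact ((Real.summable_pow_div_factorial _).mul_left _).mul_left _
  · rw [Nat.cofinite_eq_atTop]
    filter_upwards [hC k] with j hj s
    rw [norm_iteratedFDeriv_eq_norm_iteratedDeriv]
    have h1 : ContDiff ℝ k (fun r => u j r - y) := ((hu j).sub contDiff_const).of_le (by
      exact_mod_cast le_top)
    rw [show f j = fun s => (fun r => u j r - y) (dyadicScale j s) from rfl,
      iteratedDeriv_comp_dyadicScale h1, norm_smul]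
    refine (mul_le_mul_of_nonneg_left (hj _) (norm_nonneg _)).trans (le_of_eq ?_)
    rw [Real.norm_of_nonneg (by positivity)]
    have : ((2 : ℝ) ^ (j + 2)) ^ k = 4 ^ k * (2 ^ k) ^ j := by
      rw [← pow_mul, ← pow_mul, show (4 : ℝ) = 2 ^ 2 by norm_num, ← pow_mul, ← pow_add]
      congr 1; ring
    rw [this]
    ring

/-- The gluing speeds the `j`-th piece up by `2^(j+2)`. This amplification is the source of the
contradictions below: the left side must stay bounded as `j` grows when `f` is smooth along curves.
-/
theorem iteratedDeriv_comp_glue_center {Y B : Type*} [NormedAddCommGroup B] [NormedSpace ℝ B]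
    (f : Y → B) (u : ℕ → ℝ → Y) (y : Y) {k : ℕ} (j : ℕ) (g : ℝ → B) (hg : ContDiff ℝ k g)
    (hgu : ∀ᶠ r in 𝓝 0, f (u j r) = g r) :
    iteratedDeriv k (fun s => f (glue u y s)) ((2 ^ j)⁻¹) =
      ((2 : ℝ) ^ (j + 2)) ^ k • iteratedDeriv k g 0 := by
  have hc : Filter.Tendsto (dyadicScale j) (𝓝 ((2 ^ j)⁻¹)) (𝓝 0) := by
    have : Continuous (dyadicScale j) := by unfold dyadicScale; fun_prop
    simpa using this.tendsto ((2 ^ j)⁻¹)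
  have : (fun s => f (glue u y s)) =ᶠ[𝓝 ((2 ^ j)⁻¹)] fun s => g (dyadicScale j s) := by
    have h1 : ∀ᶠ r in 𝓝 (0 : ℝ), |r| < 1 := by
      simpa using (continuous_abs.tendsto (0 : ℝ)).eventually (gt_mem_nhds (by simp))
    filter_upwards [hc.eventually hgu, hc.eventually h1] with s hs h1s
    rw [glue_of_lt _ _ h1s, hs]
  rw [this.iteratedDeriv_eq, iteratedDeriv_comp_dyadicScale hg, dyadicScale_center]

/-- A smooth function that is `1` near `0` and vanishes outside `(-1, 1)`. -/
def cutoff : ContDiffBump (0 : ℝ) := ⟨1 / 2, 1, by norm_num, by norm_num⟩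

theorem cutoff_eq_one : ∀ᶠ r in 𝓝 (0 : ℝ), cutoff r = 1 := cutoff.eventuallyEq_one

theorem cutoff_eq_zero {r : ℝ} (h : 1 ≤ |r|) : cutoff r = 0 :=
  cutoff.zero_of_le_dist (by simpa [Real.dist_eq, cutoff] using h)

theorem exists_iteratedDeriv_bound {B : Type*} [NormedAddCommGroup B] [NormedSpace ℝ B]
    {f : ℝ → B} (hf : ContDiff ℝ ∞ f) (hs : ∀ r, 1 ≤ |r| → f r = 0) (k : ℕ) :
    ∃ C, 0 ≤ C ∧ ∀ r, ‖iteratedDeriv k f r‖ ≤ C := by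
  have hc : HasCompactSupport f := by
    refine HasCompactSupport.intro (isCompact_Icc (a := (-1 : ℝ)) (b := 1)) fun r hr => hs r ?_
    by_contra h
    exact hr (abs_le.1 (not_le.1 h).le)
  have h1 : Continuous (iteratedDeriv k f) := hf.continuous_iteratedDeriv k (by
    exact_mod_cast le_top)
  have h2 : HasCompactSupport (iteratedDeriv k f) := by
    refine HasCompactSupport.intro (isCompact_Icc (a := (-1 : ℝ)) (b := 1)) fun r hr => ?_
    have : f =ᶠ[𝓝 r] fun _ => 0 := by
      filter_upwards [isClosed_Icc.isOpen_compl.mem_nhds hr] with r hr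
      refine hs r ?_
      by_contra h
      exact hr (abs_le.1 (not_le.1 h).le)
    rw [this.iteratedDeriv_eq]
    simp
  obtain ⟨C, hC⟩ := h2.exists_bound_of_continuous h1
  exact ⟨C, (norm_nonneg _).trans (hC 0), hC⟩

/-- A smooth curve in an arbitrary vector space through rapidly converging points. -/
theorem contDiff_glue_smul {Y B : Type*} [AddCommGroup Y] [Module ℝ Y] [NormedAddCommGroup B]
    [NormedSpace ℝ B] [CompleteSpace B] (L : Y →ₗ[ℝ] B) {y z : ℕ → Y} (y₀ : Y)
    (hy : ∀ᶠ j in Filter.atTop, ‖L (y j)‖ ≤ 1 / j.factorial)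
    (hz : ∀ᶠ j in Filter.atTop, ‖L (z j)‖ ≤ 1 / j.factorial) :
    ContDiff ℝ ∞ fun s => L (glue (fun j r => y₀ + cutoff r • (y j + r • z j)) y₀ s) := by
  have h1 : ContDiff ℝ ∞ cutoff := cutoff.contDiff
  have h2 : ContDiff ℝ ∞ fun r => cutoff r * r := h1.mul contDiff_id
  rw [comp_glue]
  simp only [map_add, map_smul]
  choose C₁ hC₁ hC₁' using
    exists_iteratedDeriv_bound h1 fun r hr => cutoff_eq_zero hr
  choose C₂ hC₂ hC₂' using
    exists_iteratedDeriv_bound h2 fun r hr => by rw [cutoff_eq_zero hr, zero_mul]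
  refine contDiff_glue (fun j => ?_) (fun j r hr => by simp [cutoff_eq_zero hr])
    (fun k => C₁ k + C₂ k) fun k => ?_
  · fun_prop
  · filter_upwards [hy, hz] with j hyj hzj r
    have e : (fun r => L y₀ + cutoff r • (L (y j) + r • L (z j)) - L y₀) =
        (fun r => cutoff r • L (y j)) + fun r => (cutoff r * r) • L (z j) := by
      funext r
      simp [smul_smul]
    have hk : (k : ℕ∞ω) ≤ ∞ := by exact_mod_cast le_top
    have a1 : ContDiff ℝ k fun r => cutoff r • L (y j) := (h1.smul contDiff_const).of_le hk
    have a2 : ContDiff ℝ k fun r => (cutoff r * r) • L (z j) := (h2.smul contDiff_const).of_le hk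
    rw [e, iteratedDeriv_add a1.contDiffAt a2.contDiffAt,
      iteratedDeriv_smul_const (h1.of_le hk).contDiffAt,
      iteratedDeriv_smul_const (h2.of_le hk).contDiffAt, add_div]
    refine (norm_add_le _ _).trans (add_le_add ?_ ?_)
    · rw [norm_smul, div_eq_mul_one_div]
      exact mul_le_mul (hC₁' k r) hyj (norm_nonneg _) (hC₁ k)
    · rw [norm_smul, div_eq_mul_one_div]
      exact mul_le_mul (hC₂' k r) hzj (norm_nonneg _) (hC₂ k)

end Glue

/-! ### Boman's theorem -/

section Boman

variable {E : Type*} [NormedAddCommGroup E] [NormedSpace ℝ E]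
variable {V : Type*} [NormedAddCommGroup V] [NormedSpace ℝ V]

/-- A map that sends smooth curves to smooth curves. -/
def CurveSmooth (F : E → V) : Prop :=
  ∀ c : ℝ → E, ContDiff ℝ ∞ c → ContDiff ℝ ∞ fun s => F (c s)

/-- The `k`-th derivative of `F` at `x` in the direction `v`. -/
def lineD (k : ℕ) (v : E) (F : E → V) (x : E) : V :=
  iteratedDeriv k (fun r : ℝ => F (x + r • v)) 0

theorem natCast_le_infty (k : ℕ) : (k : ℕ∞ω) ≤ ∞ := by exact_mod_cast le_top

theorem CurveSmooth.line {F : E → V} (hF : CurveSmooth F) (x v : E) :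
    ContDiff ℝ ∞ fun r : ℝ => F (x + r • v) :=
  hF _ (by fun_prop)

theorem lineD_add_smul (k : ℕ) (v : E) (F : E → V) (x : E) (r : ℝ) :
    lineD k v F (x + r • v) = iteratedDeriv k (fun r : ℝ => F (x + r • v)) r := by
  have := congrFun (iteratedDeriv_comp_const_add k (fun r : ℝ => F (x + r • v)) r) 0
  simp only [add_zero] at this
  rw [← this, lineD]
  congr 1
  funext t
  rw [add_smul, add_assoc]

theorem lineD_zero (v : E) (F : E → V) : lineD 0 v F = F := by
  funext x
  simp [lineD]

theorem lineD_smul {F : E → V} (hF : CurveSmooth F) (k : ℕ) (a : ℝ) (v x : E) :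
    lineD k (a • v) F x = a ^ k • lineD k v F x := by
  have := congrFun (iteratedDeriv_comp_const_smul
    ((hF.line x v).of_le (natCast_le_infty k)) a) 0
  simp only [mul_zero] at this
  rw [lineD, lineD, ← this]
  congr 1
  funext r
  simp [smul_smul, mul_comm]

theorem CurveSmooth.hasDerivAt_lineD {F : E → V} (hF : CurveSmooth F) (k : ℕ) (v x : E) (r : ℝ) :
    HasDerivAt (fun r : ℝ => lineD k v F (x + r • v)) (lineD (k + 1) v F (x + r • v)) r := by
  simp only [lineD_add_smul, iteratedDeriv_succ]
  exact (((hF.line x v).differentiable_iteratedDeriv k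
    (by exact_mod_cast ENat.natCast_lt_top k)) r).hasDerivAt

theorem exists_seq_of_frequently {x₀ : E} {Q : ℕ → E → Prop} (h : ∀ j, ∃ᶠ x in 𝓝 x₀, Q j x) :
    ∃ x : ℕ → E, ∀ j, ‖x j - x₀‖ ≤ 1 / j.factorial ∧ Q j (x j) := by
  have : ∀ j : ℕ, ∃ x, ‖x - x₀‖ ≤ 1 / j.factorial ∧ Q j x := by
    intro j
    by_contra hc
    push Not at hc
    refine h j ?_
    filter_upwards [Metric.closedBall_mem_nhds x₀ (show (0 : ℝ) < 1 / j.factorial by positivity)]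
      with x hx
    exact hc x (by simpa [dist_eq_norm] using hx)
  choose x hx using this
  exact ⟨x, hx⟩

/-- A failure of continuity is witnessed by points converging to `x₀` at rate `1 / j!`. Such points
lie on one smooth curve, along which `F` is continuous. -/
theorem CurveSmooth.continuous [CompleteSpace E] {F : E → V} (hF : CurveSmooth F) :
    Continuous F := by
  rw [continuous_iff_continuousAt]
  intro x₀
  by_contra hn
  rw [Metric.continuousAt_iff'] at hn
  push Not at hn
  obtain ⟨ε, hε, hn⟩ := hn
  obtain ⟨x, hx⟩ := exists_seq_of_frequently (x₀ := x₀)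
    (Q := fun _ x => ε ≤ dist (F x) (F x₀)) fun _ => hn
  have hc := contDiff_glue_smul (LinearMap.id : E →ₗ[ℝ] E) (y := fun j => x j - x₀)
    (z := fun _ => 0) x₀ (Filter.Eventually.of_forall fun j => (hx j).1)
    (Filter.Eventually.of_forall fun j => by simp)
  have h1 := ((hF _ hc).continuous.tendsto 0).comp tendsto_center
  simp only [LinearMap.id_apply, glue_zero, Function.comp_def, glue_center] at h1
  have h2 := (Metric.tendsto_nhds.1 h1 ε hε).exists
  obtain ⟨j, hj⟩ := h2
  rw [cutoff_eq_one.self_of_nhds] at hj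
  simp only [smul_zero, add_zero, one_smul, add_sub_cancel] at hj
  exact (hx j).2.not_gt hj

/-- If the bound failed, a single smooth curve would run through bad points `x j` with velocity a
small multiple of `v`. The `k`-th derivative of `F` along it would then be unbounded at the points
`2⁻ʲ`, although these converge. -/
theorem CurveSmooth.lineD_bounded [CompleteSpace E] {F : E → V} (hF : CurveSmooth F) (k : ℕ)
    (v x₀ : E) : ∃ C, ∀ᶠ x in 𝓝 x₀, ‖lineD k v F x‖ ≤ C := by
  by_contra hn
  push Not at hn
  obtain ⟨x, hx⟩ := exists_seq_of_frequently (x₀ := x₀)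
    (Q := fun j x => (j : ℝ) * (j.factorial * (‖v‖ + 1)) ^ k < ‖lineD k v F x‖)
    fun _ => hn _
  -- This factor makes `‖a j • v‖ ≤ 1 / j!`, as gluing requires. Homogeneity of degree `k` and the
  -- choice of `x j` still give `a j ^ k * ‖lineD k v F (x j)‖ > j`.
  let a : ℕ → ℝ := fun j => (j.factorial * (‖v‖ + 1))⁻¹
  have ha : ∀ j, 0 < a j := fun j => by positivity
  have hc := contDiff_glue_smul (LinearMap.id : E →ₗ[ℝ] E) (y := fun j => x j - x₀)
    (z := fun j => a j • v) x₀ (Filter.Eventually.of_forall fun j => (hx j).1)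
    (Filter.Eventually.of_forall fun j => by
      rw [LinearMap.id_apply, norm_smul, Real.norm_of_nonneg (ha j).le, one_div]
      simp only [a, mul_inv, mul_assoc]
      refine mul_le_of_le_one_right (by positivity) ?_
      rw [inv_mul_le_one₀ (by positivity)]
      linarith)
  have hk := (((hF _ hc).continuous_iteratedDeriv k (natCast_le_infty k)).tendsto 0).comp
    tendsto_center
  obtain ⟨C, hC⟩ := hk.norm.bddAbove_range
  obtain ⟨j, hj⟩ := exists_nat_gt C
  have hCj := hC ⟨j, rfl⟩
  simp only [Function.comp_apply, LinearMap.id_apply] at hCj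
  rw [iteratedDeriv_comp_glue_center F _ x₀ j (fun r => F (x j + r • a j • v))
    ((hF.line (x j) (a j • v)).of_le (natCast_le_infty k))] at hCj
  · have e : iteratedDeriv k (fun r : ℝ => F (x j + r • a j • v)) 0 =
        a j ^ k • lineD k v F (x j) := lineD_smul hF k (a j) v (x j)
    rw [e, norm_smul, norm_smul, Real.norm_of_nonneg (by positivity),
      Real.norm_of_nonneg (pow_nonneg (ha j).le k)] at hCj
    have h1 : (1 : ℝ) ≤ (2 ^ (j + 2)) ^ k := one_le_pow₀ (one_le_pow₀ (by norm_num))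
    have h2 : (j : ℝ) < a j ^ k * ‖lineD k v F (x j)‖ := by
      have := mul_lt_mul_of_pos_left (hx j).2 (pow_pos (ha j) k)
      refine lt_of_eq_of_lt ?_ this
      rw [mul_left_comm, ← mul_pow]
      simp only [a]
      rw [inv_mul_cancel₀ (by positivity)]
      simp
    have h3 : a j ^ k * ‖lineD k v F (x j)‖ ≤
        (2 ^ (j + 2)) ^ k * (a j ^ k * ‖lineD k v F (x j)‖) :=
      le_mul_of_one_le_left (by have := ha j; positivity) h1
    linarith
  · filter_upwards [cutoff_eq_one] with r hr
    rw [hr]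
    congr 1
    simp only [one_smul]
    abel

/-- Two applications of the mean value inequality. The constant is not optimal, but no integration
is needed. -/
theorem norm_taylor_two_le {g g' g'' : ℝ → V} {s h C : ℝ}
    (hg : ∀ x, HasDerivAt g (g' x) x) (hg' : ∀ x, HasDerivAt g' (g'' x) x)
    (hC : ∀ x, |x - s| ≤ |h| → ‖g'' x‖ ≤ C) : ‖g (s + h) - g s - h • g' s‖ ≤ C * |h| ^ 2 := by
  have hC0 : 0 ≤ C := (norm_nonneg _).trans (hC s (by simp))
  have hs : s ∈ Metric.closedBall s |h| := Metric.mem_closedBall_self (abs_nonneg h)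
  have h1 : ∀ x ∈ Metric.closedBall s |h|, ‖g' x - g' s‖ ≤ C * |h| := by
    intro x hx
    refine ((convex_closedBall s |h|).norm_image_sub_le_of_norm_hasDerivWithin_le
      (fun y _ => (hg' y).hasDerivWithinAt) (fun y hy => hC y (by simpa [Real.dist_eq] using hy))
      hs hx).trans ?_
    exact mul_le_mul_of_nonneg_left (by simpa [Real.dist_eq] using hx) hC0
  have h2 := (convex_closedBall s |h|).norm_image_sub_le_of_norm_hasDerivWithin_le
    (f := fun x => g x - (x - s) • g' s) (f' := fun x => g' x - g' s) (C := C * |h|)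
    (fun y _ => by
      have := (hg y).sub (((hasDerivAt_id y).sub_const s).smul_const (g' s))
      rw [one_smul] at this
      exact this.hasDerivWithinAt) h1 hs (y := s + h) (by simp)
  simp only [add_sub_cancel_left, sub_self, zero_smul, sub_zero, Real.norm_eq_abs] at h2
  rw [sub_right_comm, pow_two, ← mul_assoc]
  exact h2

/-- By induction, difference quotients of the `k`-th line derivative are continuous. Local
boundedness of the derivative of order `k + 2` makes them converge locally uniformly, with error at
most `C * h`, to the derivative of order `k + 1`. -/
theorem CurveSmooth.continuous_lineD [CompleteSpace E] {F : E → V} (hF : CurveSmooth F) (k : ℕ)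
    (v : E) : Continuous (lineD k v F) := by
  induction k with
  | zero => rw [lineD_zero]; exact hF.continuous
  | succ k ih =>
    rw [continuous_iff_continuousAt]
    intro x₀
    obtain ⟨C, hC⟩ := hF.lineD_bounded (k + 2) v x₀
    obtain ⟨δ, hδ, hC⟩ := Metric.eventually_nhds_iff.1 hC
    refine continuousAt_of_locally_uniform_approx_of_continuousAt fun U hU => ?_
    obtain ⟨ε, hε, hU⟩ := Metric.mem_uniformity_dist.1 hU
    have hC0 : 0 ≤ C := (norm_nonneg _).trans (hC (y := x₀) (by simpa using hδ))
    obtain ⟨h, h0, hh⟩ : ∃ h : ℝ, 0 < h ∧ h * (‖v‖ + 1) < δ / 2 ∧ C * h < ε := by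
      have : ∀ᶠ h in 𝓝[>] (0 : ℝ), h * (‖v‖ + 1) < δ / 2 ∧ C * h < ε := by
        refine nhdsWithin_le_nhds (Filter.Eventually.and ?_ ?_)
        · have : Continuous fun h : ℝ => h * (‖v‖ + 1) := by fun_prop
          exact (this.tendsto 0).eventually (gt_mem_nhds (by simpa using hδ))
        · have : Continuous fun h : ℝ => C * h := by fun_prop
          exact (this.tendsto 0).eventually (gt_mem_nhds (by simpa using hε))
      obtain ⟨h, h1, h2⟩ := (this.and self_mem_nhdsWithin).exists
      exact ⟨h, h2, h1⟩
    refine ⟨Metric.ball x₀ (δ / 2), Metric.ball_mem_nhds _ (by positivity),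
      fun x => h⁻¹ • (lineD k v F (x + h • v) - lineD k v F x), ?_, fun x hx => hU ?_⟩
    · have : Continuous fun x => lineD k v F (x + h • v) := ih.comp (by fun_prop)
      exact ((this.sub ih).const_smul _).continuousAt
    · have ht := norm_taylor_two_le (g := fun r : ℝ => lineD k v F (x + r • v)) (s := 0) (h := h)
        (C := C) (hF.hasDerivAt_lineD k v x) (hF.hasDerivAt_lineD (k + 1) v x) fun r hr => by
          refine hC ?_
          rw [sub_zero] at hr
          calc dist (x + r • v) x₀ ≤ dist (x + r • v) x + dist x x₀ := dist_triangle _ _ _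
            _ < δ / 2 + δ / 2 := by
              refine add_lt_add_of_le_of_lt ?_ hx
              rw [dist_eq_norm, add_sub_cancel_left, norm_smul, Real.norm_eq_abs]
              rw [abs_of_pos h0] at hr
              refine le_trans ?_ hh.1.le
              exact mul_le_mul hr (by linarith) (norm_nonneg _) h0.le
            _ = δ := by ring
      simp only [zero_add, zero_smul, add_zero] at ht
      rw [dist_comm, dist_eq_norm]
      have e : h⁻¹ • (lineD k v F (x + h • v) - lineD k v F x) - lineD (k + 1) v F x =
          h⁻¹ • (lineD k v F (x + h • v) - lineD k v F x - h • lineD (k + 1) v F x) := by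
        rw [smul_sub h⁻¹ (_ - _), smul_smul, inv_mul_cancel₀ h0.ne', one_smul]
      rw [e, norm_smul, norm_inv, Real.norm_of_nonneg h0.le]
      rw [abs_of_pos h0] at ht
      calc h⁻¹ * _ ≤ h⁻¹ * (C * h ^ 2) := mul_le_mul_of_nonneg_left ht (by positivity)
        _ = C * h := by field_simp
        _ < ε := hh.2

/-- A pointwise limit of functions with locally bounded derivatives of each order is smooth. -/
theorem contDiff_of_tendsto_of_iteratedDeriv_bounded [CompleteSpace V] {f : ℕ → ℝ → V} {g : ℝ → V}
    (hf : ∀ n, ContDiff ℝ ∞ (f n))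
    (hb : ∀ k s, ∃ C, ∀ n x, |x - s| ≤ 1 → ‖iteratedDeriv k (f n) x‖ ≤ C)
    (hg : ∀ s, Filter.Tendsto (fun n => f n s) Filter.atTop (𝓝 (g s))) : ContDiff ℝ ∞ g := by
  have hd : ∀ n k x, HasDerivAt (iteratedDeriv k (f n)) (iteratedDeriv (k + 1) (f n) x) x := by
    intro n k x
    rw [iteratedDeriv_succ]
    exact ((hf n).differentiable_iteratedDeriv k
      (by exact_mod_cast ENat.natCast_lt_top k) x).hasDerivAt
  have ht : ∀ s k, ∃ C, 0 ≤ C ∧ ∀ n h, |h| ≤ 1 → ‖iteratedDeriv k (f n) (s + h) -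
      iteratedDeriv k (f n) s - h • iteratedDeriv (k + 1) (f n) s‖ ≤ C * |h| ^ 2 := by
    intro s k
    obtain ⟨C, hC⟩ := hb (k + 2) s
    exact ⟨C, (norm_nonneg _).trans (hC 0 s (by simp)), fun n h hh =>
      norm_taylor_two_le (hd n k) (hd n (k + 1)) fun x hx => hC n x (hx.trans hh)⟩
  have hl : ∀ k, ∃ G : ℝ → V, ∀ s,
      Filter.Tendsto (fun n => iteratedDeriv k (f n) s) Filter.atTop (𝓝 (G s)) := by
    intro k
    induction k with
    | zero => exact ⟨g, by simpa using hg⟩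
    | succ k ih =>
      obtain ⟨G, hG⟩ := ih
      suffices h : ∀ s, CauchySeq fun n => iteratedDeriv (k + 1) (f n) s by
        choose G' hG' using fun s => cauchySeq_tendsto_of_complete (h s)
        exact ⟨G', hG'⟩
      intro s
      obtain ⟨C, hC0, hC⟩ := ht s k
      rw [Metric.cauchySeq_iff']
      intro ε hε
      obtain ⟨h, h0, h1, hh⟩ : ∃ h : ℝ, 0 < h ∧ h ≤ 1 ∧ C * h < ε / 3 := by
        refine ⟨min 1 (ε / 3 / (C + 1)), by positivity, min_le_left _ _, ?_⟩
        calc C * min 1 (ε / 3 / (C + 1)) ≤ C * (ε / 3 / (C + 1)) :=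
              mul_le_mul_of_nonneg_left (min_le_right _ _) hC0
          _ = (ε / 3) * (C / (C + 1)) := by ring
          _ < (ε / 3) * 1 := by
              refine mul_lt_mul_of_pos_left ?_ (by positivity)
              rw [div_lt_one (by positivity)]
              linarith
          _ = _ := mul_one _
      -- For the fixed step `h` the difference quotients of the `k`-th derivatives converge as `n →
      -- ∞`. They differ from the derivatives of order `k + 1` by less than `ε / 3`, uniformly in
      -- `n`.
      have hcs := (((hG (s + h)).sub (hG s)).const_smul h⁻¹).cauchySeq
      obtain ⟨N, hN⟩ := Metric.cauchySeq_iff'.1 hcs (ε / 3) (by positivity)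
      have hq : ∀ n, dist (iteratedDeriv (k + 1) (f n) s)
          (h⁻¹ • (iteratedDeriv k (f n) (s + h) - iteratedDeriv k (f n) s)) < ε / 3 := by
        intro n
        rw [dist_comm, dist_eq_norm]
        have e : h⁻¹ • (iteratedDeriv k (f n) (s + h) - iteratedDeriv k (f n) s) -
            iteratedDeriv (k + 1) (f n) s = h⁻¹ • (iteratedDeriv k (f n) (s + h) -
              iteratedDeriv k (f n) s - h • iteratedDeriv (k + 1) (f n) s) := by
          rw [smul_sub h⁻¹ (_ - _), smul_smul, inv_mul_cancel₀ h0.ne', one_smul]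
        rw [e, norm_smul, norm_inv, Real.norm_of_nonneg h0.le]
        have := hC n h (by rwa [abs_of_pos h0])
        rw [abs_of_pos h0] at this
        calc h⁻¹ * _ ≤ h⁻¹ * (C * h ^ 2) := mul_le_mul_of_nonneg_left this (by positivity)
          _ = C * h := by field_simp
          _ < ε / 3 := hh
      refine ⟨N, fun n hn => ?_⟩
      have a1 := hq n
      have a2 := hq N
      rw [dist_comm] at a2
      calc _ ≤ _ := dist_triangle4 _ _ _ _
        _ < ε / 3 + ε / 3 + ε / 3 := add_lt_add (add_lt_add a1 (hN n hn)) a2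
        _ = ε := by ring
  choose G hG using hl
  have hder : ∀ k s, HasDerivAt (G k) (G (k + 1) s) s := by
    intro k s
    obtain ⟨C, hC0, hC⟩ := ht s k
    rw [hasDerivAt_iff_isLittleO_nhds_zero]
    refine Asymptotics.IsBigO.trans_isLittleO (g := fun h : ℝ => h ^ 2) ?_ ?_
    · refine Asymptotics.IsBigO.of_bound C ?_
      filter_upwards [Metric.closedBall_mem_nhds (0 : ℝ) one_pos] with h hh
      have hh' : |h| ≤ 1 := by simpa [Real.dist_eq] using hh
      refine le_of_tendsto (((hG k (s + h)).sub (hG k s)).sub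
        ((hG (k + 1) s).const_smul h)).norm (Filter.Eventually.of_forall fun n => ?_)
      simpa using hC n h hh'
    · have := Asymptotics.isLittleO_pow_pow (𝕜 := ℝ) (show 1 < 2 by norm_num)
      simpa using this
  have h0 : G 0 = g := by
    funext s
    exact tendsto_nhds_unique (hG 0 s) (by simpa using hg s)
  rw [← h0]
  have hall : ∀ n : ℕ, ∀ k, ContDiff ℝ n (G k) := by
    intro n
    induction n with
    | zero =>
      intro k
      exact contDiff_zero.2 (continuous_iff_continuousAt.2 fun s => (hder k s).continuousAt)
    | succ n ih =>
      intro k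
      have : deriv (G k) = G (k + 1) := funext fun s => (hder k s).deriv
      push_cast
      rw [contDiff_succ_iff_deriv, this]
      exact ⟨fun s => (hder k s).differentiableAt, by simp, ih _⟩
  exact contDiff_infty.2 fun n => hall n 0

end Boman

/-! ### Polarization -/

section Polarization

/-- A mixed monomial is a linear combination of powers of linear forms. -/
theorem exists_polarization {S : Type*} [Ring S] [Algebra ℝ S] {x y : S} (h : Commute x y)
    (k : ℕ) : ∃ l : Fin (k + 2) → ℝ,
      x ^ k * y = ∑ a, l a • (x + ((a : ℕ) : ℝ) • y) ^ (k + 1) := by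
  -- The expansion of `(x + a y)^(k+1)` contains `x^(k+1-m) y^m` with coefficient `a^m` times a
  -- binomial coefficient. To isolate `m = 1` one needs weights at the nodes `0, …, k+1` whose first
  -- moment is `1 / (k + 1)` and whose other moments vanish. The Vandermonde matrix of these nodes
  -- is invertible.
  let M : Matrix (Fin (k + 2)) (Fin (k + 2)) ℝ := Matrix.vandermonde fun a => ((a : ℕ) : ℝ)
  have hM : IsUnit M.det := by
    rw [isUnit_iff_ne_zero]
    refine Matrix.det_vandermonde_ne_zero_iff.2 fun a b hab => ?_
    exact Fin.ext (by exact_mod_cast hab)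
  let e : Fin (k + 2) → ℝ := Pi.single 1 ((k + 1 : ℝ)⁻¹)
  let l := Matrix.vecMul e M⁻¹
  have hl : Matrix.vecMul l M = e := by
    simp [l, Matrix.vecMul_vecMul, Matrix.nonsing_inv_mul M hM]
  refine ⟨l, ?_⟩
  have hpow : ∀ a : ℝ, (x + a • y) ^ (k + 1) = ∑ m ∈ Finset.range (k + 2),
      a ^ m • (((k + 1).choose m : ℝ) • (x ^ (k + 1 - m) * y ^ m)) := by
    intro a
    rw [add_comm, ((h.smul_right a).symm).add_pow]
    refine Finset.sum_congr rfl fun m _ => ?_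
    rw [smul_pow, smul_mul_assoc, smul_mul_assoc, ((h.pow_pow _ _).symm).eq,
      ← Nat.cast_comm, ← nsmul_eq_mul, Nat.cast_smul_eq_nsmul]
  simp only [hpow, Finset.smul_sum, smul_smul]
  rw [Finset.sum_comm, Finset.sum_eq_single 1]
  · have h1 := congrFun hl 1
    simp only [Matrix.vecMul, dotProduct, M, Matrix.vandermonde_apply, e, Pi.single_eq_same] at h1
    simp only [← mul_assoc]
    rw [← Finset.sum_smul, ← Finset.sum_mul]
    simp only [Fin.val_one] at h1
    rw [h1]
    have : ((k : ℝ) + 1)⁻¹ * ((k + 1).choose 1 : ℝ) = 1 := by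
      rw [Nat.choose_one_right]
      push_cast
      exact inv_mul_cancel₀ (by positivity)
    rw [this]
    simp
  · intro m hm hm1
    have hm' : m < k + 2 := Finset.mem_range.1 hm
    have h1 := congrFun hl ⟨m, hm'⟩
    have h2 : e ⟨m, hm'⟩ = 0 := Pi.single_eq_of_ne (fun hc => hm1 (congrArg Fin.val hc)) _
    rw [h2] at h1
    simp only [Matrix.vecMul, dotProduct, M, Matrix.vandermonde_apply] at h1
    simp only [← mul_assoc]
    rw [← Finset.sum_smul, ← Finset.sum_mul, h1]
    simp
  · intro h
    simp at h

end Polarization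

/-! ### Boman's theorem: mollification and mixed derivatives -/

section Boman

variable {E : Type*} [NormedAddCommGroup E] [NormedSpace ℝ E]
variable {V : Type*} [NormedAddCommGroup V] [NormedSpace ℝ V]

variable (E V) in
/-- The space of smooth functions. -/
def smoothFun : Submodule ℝ (E → V) where
  carrier := {f | ContDiff ℝ ∞ f}
  zero_mem' := (contDiff_const : ContDiff ℝ ∞ fun _ : E => (0 : V))
  add_mem' {f g} (h : ContDiff ℝ ∞ f) (h' : ContDiff ℝ ∞ g) := (h.add h' : ContDiff ℝ ∞ (f + g))
  smul_mem' r f (h : ContDiff ℝ ∞ f) := (h.const_smul r : ContDiff ℝ ∞ (r • f))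

theorem contDiff_smoothFun (f : smoothFun E V) : ContDiff ℝ ∞ f.1 := f.2

theorem contDiff_fderiv_apply {f : E → V} (hf : ContDiff ℝ ∞ f) (v : E) :
    ContDiff ℝ ∞ fun x => fderiv ℝ f x v :=
  (hf.fderiv_right (m := ∞) (by simp)).clm_apply contDiff_const

/-- The directional derivative, as an operator on smooth functions. -/
def dirD (v : E) : Module.End ℝ (smoothFun E V) where
  toFun f := ⟨fun x => fderiv ℝ f.1 x v, contDiff_fderiv_apply (contDiff_smoothFun f) v⟩
  map_add' f g := by
    apply Subtype.ext
    funext x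
    have hf : DifferentiableAt ℝ f.1 x := (contDiff_smoothFun f).differentiable (by simp) x
    have hg : DifferentiableAt ℝ g.1 x := (contDiff_smoothFun g).differentiable (by simp) x
    change fderiv ℝ (f.1 + g.1) x v = _
    rw [fderiv_add hf hg]
    rfl
  map_smul' r f := by
    apply Subtype.ext
    funext x
    have hf : DifferentiableAt ℝ f.1 x := (contDiff_smoothFun f).differentiable (by simp) x
    change fderiv ℝ (r • f.1) x v = _
    rw [fderiv_const_smul hf]
    rfl

theorem dirD_apply (v : E) (f : smoothFun E V) (x : E) : (dirD v f).1 x = fderiv ℝ f.1 x v := rfl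

theorem dirD_commute (v w : E) : Commute (dirD v : Module.End ℝ (smoothFun E V)) (dirD w) := by
  refine LinearMap.ext fun f => Subtype.ext (funext fun x => ?_)
  have h2 : DifferentiableAt ℝ (fderiv ℝ f.1) x :=
    ((contDiff_smoothFun f).fderiv_right (m := ∞) (by simp)).differentiable (by simp) x
  have key : ∀ v w : E, (dirD v (dirD w f)).1 x = fderiv ℝ (fderiv ℝ f.1) x v w := by
    intro v w
    change fderiv ℝ (fun x => fderiv ℝ f.1 x w) x v = _
    rw [fderiv_clm_apply h2 (differentiableAt_const w)]
    simp
  change (dirD v (dirD w f)).1 x = (dirD w (dirD v f)).1 x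
  rw [key, key]
  have : ContDiffAt ℝ ∞ f.1 x := (contDiff_smoothFun f).contDiffAt
  exact (this.isSymmSndFDerivAt (by simpa using natCast_le_infty 2)) v w

theorem dirD_add_smul (v w : E) (a : ℝ) :
    (dirD (v + a • w) : Module.End ℝ (smoothFun E V)) = dirD v + a • dirD w := by
  refine LinearMap.ext fun f => Subtype.ext (funext fun x => ?_)
  change fderiv ℝ f.1 x (v + a • w) = fderiv ℝ f.1 x v + a • fderiv ℝ f.1 x w
  rw [map_add, map_smul]

open MeasureTheory
open scoped Convolution

variable [FiniteDimensional ℝ E] [MeasurableSpace E] [BorelSpace E]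

variable (μ : Measure E) [μ.IsAddHaarMeasure]

/-- The derivative is moved onto `g`, of which only continuous derivatives along lines in direction
`v` are known. Thus directional derivatives of a mollification are mollifications of line
derivatives, with bounds independent of the mollifier. -/
theorem hasLineDeriv_convolution {ρ : E → ℝ} (hρ : Continuous ρ) (hc : HasCompactSupport ρ)
    {g g' : E → V} (hg : Continuous g) (hg' : Continuous g') (v : E)
    (h : ∀ x (r : ℝ), HasDerivAt (fun r : ℝ => g (x + r • v)) (g' (x + r • v)) r) (x : E) :
    HasDerivAt (fun r : ℝ => (ρ ⋆[ContinuousLinearMap.lsmul ℝ ℝ, μ] g) (x + r • v))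
      ((ρ ⋆[ContinuousLinearMap.lsmul ℝ ℝ, μ] g') x) 0 := by
  simp only [convolution, ContinuousLinearMap.lsmul_apply]
  have hK : IsCompact (tsupport ρ ×ˢ Metric.closedBall (0 : ℝ) 1) := hc.isCompact.prod
    (isCompact_closedBall _ _)
  obtain ⟨C, hC⟩ := hK.exists_bound_of_continuousOn
    (f := fun p : E × ℝ => ρ p.1 • g' (x - p.1 + p.2 • v)) (by fun_prop)
  have hint : ∀ {f : E → V}, Continuous f → Integrable (fun t => ρ t • f t) μ := by
    intro f hf
    exact (hρ.smul hf).integrable_of_hasCompactSupport hc.smul_right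
  have hF' : ∀ᵐ t ∂μ, ∀ r ∈ Metric.ball (0 : ℝ) 1, ‖ρ t • g' (x - t + r • v)‖ ≤
      (tsupport ρ).indicator (fun _ => C) t := by
    refine Filter.Eventually.of_forall fun t r hr => ?_
    by_cases ht : t ∈ tsupport ρ
    · rw [Set.indicator_of_mem ht]
      exact hC (t, r) ⟨ht, Metric.ball_subset_closedBall hr⟩
    · rw [Set.indicator_of_notMem ht, image_eq_zero_of_notMem_tsupport ht]
      simp
  have key := (hasDerivAt_integral_of_dominated_loc_of_deriv_le (μ := μ)
    (F := fun r t => ρ t • g (x - t + r • v)) (F' := fun r t => ρ t • g' (x - t + r • v)) (x₀ := 0)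
    (bound := (tsupport ρ).indicator (fun _ => C)) (Metric.ball_mem_nhds 0 one_pos)
    (Filter.Eventually.of_forall fun r => (hint (by fun_prop)).aestronglyMeasurable)
    (hint (by fun_prop)) (hint (by fun_prop)).aestronglyMeasurable hF'
    ((integrable_indicator_iff (isClosed_tsupport ρ).measurableSet).2
      (integrableOn_const hc.isCompact.measure_lt_top.ne))
    (Filter.Eventually.of_forall fun t r _ => (h (x - t) r).const_smul (ρ t))).2
  simp only [zero_smul, add_zero] at key
  refine key.congr_deriv rfl |>.congr_of_eventuallyEq (Filter.Eventually.of_forall fun r => ?_)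
  refine integral_congr_ae (Filter.Eventually.of_forall fun t => ?_)
  simp only
  congr 2
  abel

theorem CurveSmooth.contDiff_convolution {F : E → V} (hF : CurveSmooth F)
    (φ : ContDiffBump (0 : E)) :
    ContDiff ℝ ∞ (φ.normed μ ⋆[ContinuousLinearMap.lsmul ℝ ℝ, μ] F) :=
  have := FiniteDimensional.complete ℝ E
  φ.hasCompactSupport_normed.contDiff_convolution_left _ φ.contDiff_normed
    hF.continuous.locallyIntegrable

theorem CurveSmooth.dirD_pow_convolution {F : E → V} (hF : CurveSmooth F)
    (φ : ContDiffBump (0 : E)) (v : E) (k : ℕ) (x : E) :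
    ((dirD v ^ k) ⟨_, hF.contDiff_convolution μ φ⟩).1 x =
      (φ.normed μ ⋆[ContinuousLinearMap.lsmul ℝ ℝ, μ] (lineD k v F)) x := by
  have := FiniteDimensional.complete ℝ E
  induction k generalizing x with
  | zero => simp [lineD_zero]
  | succ k ih =>
    rw [pow_succ', Module.End.mul_apply, dirD_apply]
    have h1 := (((contDiff_smoothFun ((dirD v ^ k) ⟨_, hF.contDiff_convolution μ φ⟩)).differentiable
      (by simp)) x).hasFDerivAt.hasLineDerivAt v
    rw [funext ih] at h1 ⊢
    exact HasDerivAt.unique h1 (hasLineDeriv_convolution μ φ.continuous_normed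
      φ.hasCompactSupport_normed (hF.continuous_lineD k v) (hF.continuous_lineD (k + 1) v) v
      (hF.hasDerivAt_lineD k v) x)

/-- The average differs from `g x` by at most `2 * C`, and `g x` itself is bounded by `C`. Any
constant independent of `φ` would do. -/
theorem norm_convolution_le [CompleteSpace V] (φ : ContDiffBump (0 : E)) {g : E → V}
    (hg : Continuous g) {C : ℝ}
    {x : E} (hC : ∀ y ∈ Metric.closedBall x φ.rOut, ‖g y‖ ≤ C) :
    ‖(φ.normed μ ⋆[ContinuousLinearMap.lsmul ℝ ℝ, μ] g) x‖ ≤ 3 * C := by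
  have hx := hC x (Metric.mem_closedBall_self φ.rOut_pos.le)
  have h1 : ∀ y ∈ Metric.ball x φ.rOut, dist (g y) (g x) ≤ 2 * C := fun y hy => by
    rw [dist_eq_norm]
    refine (norm_sub_le _ _).trans ?_
    linarith [hC y (Metric.ball_subset_closedBall hy)]
  have := φ.dist_normed_convolution_le (μ := μ) hg.aestronglyMeasurable h1
  rw [dist_eq_norm] at this
  have := norm_le_norm_add_norm_sub' ((φ.normed μ ⋆[ContinuousLinearMap.lsmul ℝ ℝ, μ] g) x) (g x)
  linarith

theorem iteratedDeriv_line (f : smoothFun E V) (x v : E) (k : ℕ) (s : ℝ) :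
    iteratedDeriv k (fun s : ℝ => f.1 (x + s • v)) s = ((dirD v ^ k) f).1 (x + s • v) := by
  induction k generalizing s with
  | zero => simp
  | succ k ih =>
    rw [iteratedDeriv_succ, funext ih, pow_succ', Module.End.mul_apply, dirD_apply]
    have h1 : HasFDerivAt ((dirD v ^ k) f).1 _ (x + s • v) :=
      (((contDiff_smoothFun ((dirD v ^ k) f)).differentiable (by simp)) _).hasFDerivAt
    have h2 : HasDerivAt (fun s : ℝ => x + s • v) v s := by
      simpa using ((hasDerivAt_id s).smul_const v).const_add x
    exact (h1.comp_hasDerivAt s h2).deriv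

/-- The function is the pointwise limit of `D_w (φ_n * F)` on the line. The `k`-th derivative of the
approximant is the mixed derivative `D_v^k D_w (φ_n * F)`. Polarization writes it as a combination
of pure derivatives `D_(v + a w)^(k+1)`, which are mollified line derivatives of `F`. These are
continuous, so they are bounded on compact sets uniformly in `n`. -/
theorem CurveSmooth.contDiff_lineD_one [CompleteSpace V] {F : E → V} (hF : CurveSmooth F)
    (x v w : E) : ContDiff ℝ ∞ fun s : ℝ => lineD 1 w F (x + s • v) := by
  have := FiniteDimensional.complete ℝ E
  let μ : Measure E := MeasureTheory.Measure.addHaar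
  let φ : ℕ → ContDiffBump (0 : E) := fun n =>
    ⟨1 / (2 * (n + 1)), 1 / (n + 1), by positivity, by
      rw [div_lt_div_iff₀ (by positivity) (by positivity)]
      have : (0 : ℝ) ≤ n := n.cast_nonneg
      linarith⟩
  let f : ℕ → smoothFun E V := fun n => dirD w ⟨_, hF.contDiff_convolution μ (φ n)⟩
  have hφ1 : ∀ n, (φ n).rOut ≤ 1 := fun n => by
    change (1 : ℝ) / (n + 1) ≤ 1
    rw [div_le_one (by positivity)]
    have : (0 : ℝ) ≤ n := n.cast_nonneg
    linarith
  have hφ : Filter.Tendsto (fun n => (φ n).rOut) Filter.atTop (𝓝 0) :=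
    tendsto_one_div_add_atTop_nhds_zero_nat
  refine contDiff_of_tendsto_of_iteratedDeriv_bounded (f := fun n s => (f n).1 (x + s • v))
    (fun n => (contDiff_smoothFun (f n)).comp (by fun_prop)) (fun k s₀ => ?_) fun s => ?_
  · obtain ⟨l, hl⟩ := exists_polarization
      (S := Module.End ℝ (smoothFun E V)) (x := dirD v) (y := dirD w) (dirD_commute v w) k
    let K : Set E := Metric.closedBall (x + s₀ • v) (‖v‖ + 1)
    have hK : IsCompact K := isCompact_closedBall _ _
    choose C hC using fun a : Fin (k + 2) => hK.exists_bound_of_continuousOn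
      (hF.continuous_lineD (k + 1) (v + ((a : ℕ) : ℝ) • w)).continuousOn
    refine ⟨∑ a, |l a| * (3 * C a), fun n s hs => ?_⟩
    rw [iteratedDeriv_line, ← Module.End.mul_apply, hl]
    simp only [← dirD_add_smul, LinearMap.sum_apply, LinearMap.smul_apply, Submodule.coe_sum,
      Submodule.coe_smul, Finset.sum_apply, Pi.smul_apply]
    refine (norm_sum_le _ _).trans (Finset.sum_le_sum fun a _ => ?_)
    rw [norm_smul, Real.norm_eq_abs, hF.dirD_pow_convolution μ]
    refine mul_le_mul_of_nonneg_left (norm_convolution_le μ _ (hF.continuous_lineD _ _)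
      fun y hy => hC a y ?_) (abs_nonneg _)
    rw [Metric.mem_closedBall] at hy ⊢
    calc dist y (x + s₀ • v) ≤ dist y (x + s • v) + dist (x + s • v) (x + s₀ • v) :=
          dist_triangle _ _ _
      _ ≤ 1 + ‖v‖ := by
          refine add_le_add (hy.trans (hφ1 n)) ?_
          rw [dist_add_left, dist_eq_norm, ← sub_smul, norm_smul]
          exact mul_le_of_le_one_left (norm_nonneg _) hs
      _ = ‖v‖ + 1 := add_comm _ _
  · have h1 : ∀ n, (f n).1 (x + s • v) =
        ((φ n).normed μ ⋆[ContinuousLinearMap.lsmul ℝ ℝ, μ] (lineD 1 w F)) (x + s • v) := by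
      intro n
      have := hF.dirD_pow_convolution μ (φ n) w 1 (x + s • v)
      rwa [pow_one] at this
    simp only [h1]
    exact ContDiffBump.convolution_tendsto_right_of_continuous hφ (hF.continuous_lineD 1 w) _

end Boman

/-! ### Boman's theorem: conclusion -/

section Boman

variable {E : Type*} [NormedAddCommGroup E] [NormedSpace ℝ E]
variable {V : Type*} [NormedAddCommGroup V] [NormedSpace ℝ V]

theorem CurveSmooth.comp {E' : Type*} [NormedAddCommGroup E'] [NormedSpace ℝ E'] {F : E → V}
    (hF : CurveSmooth F) {g : E' → E} (hg : ContDiff ℝ ∞ g) : CurveSmooth fun x => F (g x) :=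
  fun _ hc => hF _ (hg.comp hc)

/-- Along a curve `c`, the function `(s, r) ↦ F (c s + r w)` on the plane is again smooth along
curves. The previous lemma applies to it with the directions of the two axes. -/
theorem CurveSmooth.lineD_one [CompleteSpace V] {F : E → V} (hF : CurveSmooth F) (w : E) :
    CurveSmooth (lineD 1 w F) := by
  intro c hc
  have h1 : CurveSmooth fun p : ℝ × ℝ => F (c p.1 + p.2 • w) := hF.comp (by fun_prop)
  have := h1.contDiff_lineD_one 0 ((1 : ℝ), (0 : ℝ)) ((0 : ℝ), (1 : ℝ))
  convert! this using 2 with s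
  simp [lineD]

/-- Continuous partial derivatives along a basis imply differentiability. -/
theorem hasFDerivAt_of_continuous_line {ι : Type*} [Fintype ι] [DecidableEq ι] {F : (ι → ℝ) → V}
    {D : ι → (ι → ℝ) → V}
    (hD : ∀ i x (r : ℝ), HasDerivAt (fun r : ℝ => F (x + r • Pi.single i 1))
      (D i (x + r • Pi.single i 1)) r)
    (hc : ∀ i, Continuous (D i)) (x : ι → ℝ) :
    HasFDerivAt F (∑ i, (ContinuousLinearMap.proj (R := ℝ) (φ := fun _ : ι => ℝ) i).smulRight
      (D i x)) x := by
  -- The coordinates are changed one at a time. The base point `y` varies near `x` so that the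
  -- induction hypothesis can be applied after the first increment. Halving the radii keeps the
  -- moved base point in range.
  have key : ∀ S : Finset ι, ∀ ε > 0, ∃ δ > 0, ∀ y u : ι → ℝ, ‖y - x‖ < δ → ‖u‖ < δ →
      ‖F (y + ∑ i ∈ S, u i • Pi.single i 1) - F y - ∑ i ∈ S, u i • D i x‖ ≤
        ε * ∑ i ∈ S, |u i| := by
    intro S
    induction S using Finset.induction_on with
    | empty => exact fun ε hε => ⟨1, one_pos, fun y u _ _ => by simp⟩
    | insert a S ha ih =>
      intro ε hε
      obtain ⟨δ₁, hδ₁, h1⟩ := ih ε hε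
      obtain ⟨δ₂, hδ₂, h2⟩ := Metric.continuousAt_iff.1 ((hc a).continuousAt (x := x)) ε hε
      refine ⟨min (δ₁ / 2) (δ₂ / 2), by positivity, fun y u hy hu => ?_⟩
      rw [lt_min_iff] at hy hu
      have hua : |u a| ≤ ‖u‖ := norm_le_pi_norm u a
      have hy' : ∀ r : ℝ, |r| ≤ |u a| → ‖y + r • Pi.single a 1 - x‖ < min δ₁ δ₂ := by
        intro r hr
        have : ‖r • (Pi.single a 1 : ι → ℝ)‖ ≤ ‖u‖ := by
          rw [norm_smul, Pi.norm_single, norm_one, mul_one]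
          exact hr.trans hua
        rw [add_sub_right_comm]
        refine (norm_add_le _ _).trans_lt (lt_min ?_ ?_) <;> linarith
      have h3 : ‖F (y + u a • Pi.single a 1) - F y - u a • D a x‖ ≤ ε * |u a| := by
        have := (convex_closedBall (0 : ℝ) |u a|).norm_image_sub_le_of_norm_hasDerivWithin_le
          (f := fun r : ℝ => F (y + r • Pi.single a 1) - r • D a x)
          (f' := fun r => D a (y + r • Pi.single a 1) - D a x) (C := ε)
          (fun r _ => by
            have := (hD a y r).sub ((hasDerivAt_id r).smul_const (D a x))
            rw [one_smul] at this
            exact this.hasDerivWithinAt)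
          (fun r hr => by
            rw [← dist_eq_norm]
            refine (h2 ?_).le
            rw [dist_eq_norm]
            exact (hy' r (by simpa [Real.dist_eq] using hr)).trans_le (min_le_right _ _))
          (Metric.mem_closedBall_self (abs_nonneg _)) (y := u a) (by simp)
        simp only [zero_smul, add_zero, sub_zero, Real.norm_eq_abs] at this
        rwa [sub_right_comm] at this
      have h4 := h1 (y + u a • Pi.single a 1) u ((hy' _ le_rfl).trans_le (min_le_left _ _))
        (by linarith)
      rw [Finset.sum_insert ha, Finset.sum_insert ha, Finset.sum_insert ha, ← add_assoc, mul_add]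
      refine le_trans (le_of_eq ?_) ((norm_add_le _ _).trans (add_le_add h3 h4))
      congr 1
      abel
  have hsum : ∀ u : ι → ℝ, ∑ i, u i • (Pi.single i 1 : ι → ℝ) = u := fun u => by
    ext j
    simp [Finset.sum_apply, Pi.single_apply]
  rw [hasFDerivAt_iff_isLittleO_nhds_zero, Asymptotics.isLittleO_iff]
  intro ε hε
  obtain ⟨δ, hδ, h⟩ := key Finset.univ (ε / (Fintype.card ι + 1)) (by positivity)
  filter_upwards [Metric.ball_mem_nhds (0 : ι → ℝ) hδ] with u hu
  have := h x u (by simpa using hδ) (by simpa using hu)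
  rw [hsum] at this
  simp only [_root_.sum_apply, ContinuousLinearMap.smulRight_apply,
    ContinuousLinearMap.proj_apply]
  refine this.trans ?_
  have h5 : ∑ i, |u i| ≤ Fintype.card ι * ‖u‖ := by
    refine (Finset.sum_le_card_nsmul _ _ ‖u‖ fun i _ => norm_le_pi_norm u i).trans (le_of_eq ?_)
    simp
  calc _ ≤ ε / (Fintype.card ι + 1) * (Fintype.card ι * ‖u‖) :=
        mul_le_mul_of_nonneg_left h5 (by positivity)
    _ = ε * ‖u‖ * (Fintype.card ι / (Fintype.card ι + 1)) := by ring
    _ ≤ ε * ‖u‖ * 1 := by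
        refine mul_le_mul_of_nonneg_left ?_ (by positivity)
        rw [div_le_one (by positivity)]
        linarith
    _ = ε * ‖u‖ := mul_one _

/-- Induction on the order of differentiability, for all `F` at once: the partial derivatives are
again smooth along curves, hence `C^n`, and continuous partial derivatives give the total
derivative. -/
theorem CurveSmooth.contDiff_pi [CompleteSpace V] {ι : Type*} [Fintype ι] {F : (ι → ℝ) → V}
    (hF : CurveSmooth F) : ContDiff ℝ ∞ F := by
  classical
  refine contDiff_infty.2 fun n => ?_
  induction n generalizing F with
  | zero => exact contDiff_zero.2 hF.continuous
  | succ n ih =>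
    have h1 := hasFDerivAt_of_continuous_line (F := F)
      (D := fun i => lineD 1 (Pi.single i 1) F)
      (fun i x r => by
        have := hF.hasDerivAt_lineD 0 (Pi.single i 1) x r
        rwa [lineD_zero] at this) fun i => hF.continuous_lineD 1 _
    push_cast
    rw [contDiff_succ_iff_hasFDerivAt]
    refine ⟨_, ?_, h1⟩
    refine ContDiff.sum fun i _ => ?_
    exact contDiff_const.smulRight (ih (hF.lineD_one _))

/-- **Boman's theorem**: a map on a finite-dimensional space that is smooth along smooth curves is
smooth. -/
theorem CurveSmooth.contDiff [CompleteSpace V] [FiniteDimensional ℝ E] {F : E → V}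
    (hF : CurveSmooth F) : ContDiff ℝ ∞ F := by
  let e : E ≃L[ℝ] (Fin (Module.finrank ℝ E) → ℝ) := ContinuousLinearEquiv.ofFinrankEq (by simp)
  have h : ContDiff ℝ ∞ fun x => F (e.symm x) :=
    (hF.comp (g := e.symm) e.symm.contDiff).contDiff_pi
  have := h.comp e.contDiff
  simpa [Function.comp_def] using this

end Boman

/-! ### Quasi-isomorphisms into a total complex -/

section QuasiIso

/-- An elementwise criterion for quasi-isomorphisms of complexes of vector spaces. -/
theorem quasiIso_of_elements {K L : CochainComplex (ModuleCat.{w} ℝ) ℕ} (φ : K ⟶ L)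
    (h0 : ∀ x : K.X 0, φ.f 0 x = 0 → x = 0)
    (h0' : ∀ y : L.X 0, L.d 0 1 y = 0 → ∃ x : K.X 0, K.d 0 1 x = 0 ∧ y = φ.f 0 x)
    (h1 : ∀ n, ∀ x : K.X (n + 1), K.d (n + 1) (n + 2) x = 0 → ∀ y : L.X n,
      φ.f (n + 1) x = L.d n (n + 1) y → ∃ x' : K.X n, x = K.d n (n + 1) x')
    (h1' : ∀ n, ∀ y : L.X (n + 1), L.d (n + 1) (n + 2) y = 0 → ∃ x : K.X (n + 1),
      K.d (n + 1) (n + 2) x = 0 ∧ ∃ y' : L.X n, y = φ.f (n + 1) x + L.d n (n + 1) y') :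
    QuasiIso φ := by
  have hm : ∀ i j k, (ComplexShape.up ℕ).prev j = i → (ComplexShape.up ℕ).next j = k →
      ∀ x : K.X j, K.d j k x = 0 → ∀ y : L.X i, φ.f j x = L.d i j y →
        ∃ x' : K.X i, x = K.d i j x' := by
    rintro i (_ | n) k hi hk x hx y hy
    · have e : L.d i 0 = 0 := L.shape _ _ (by simp)
      rw [e] at hy
      exact ⟨0, by rw [map_zero]; exact h0 x hy⟩
    · obtain rfl : n = i := by rw [← hi]; simp
      obtain rfl : n + 2 = k := by rw [← hk]; simp
      exact h1 n x hx y hy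
  have he : ∀ i j k, (ComplexShape.up ℕ).prev j = i → (ComplexShape.up ℕ).next j = k →
      ∀ y : L.X j, L.d j k y = 0 → ∃ x : K.X j, K.d j k x = 0 ∧
        ∃ y' : L.X i, y = φ.f j x + L.d i j y' := by
    rintro i (_ | n) k hi hk y hy
    · obtain rfl : 1 = k := by rw [← hk]; simp
      obtain ⟨x, hx, e⟩ := h0' y hy
      exact ⟨x, hx, 0, by rw [map_zero, add_zero, e]⟩
    · obtain rfl : n = i := by rw [← hi]; simp
      obtain rfl : n + 2 = k := by rw [← hk]; simp
      exact h1' n y hy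
  rw [quasiIso_iff]
  intro j
  rw [quasiIsoAt_iff_isIso_homologyMap]
  have hmono : Mono (HomologicalComplex.homologyMap φ j) := by
    rw [HomologicalComplex.mono_homologyMap_iff_up_to_refinements φ _ j _ rfl rfl]
    intro A x₂ hx₂ y₁ e
    -- Preimages under the differential cannot be read off as a linear map on `A`. The fibre product
    -- carries a tautological linear choice of preimage, and elementwise solvability says that it
    -- surjects onto `A`.
    let P : Submodule ℝ (A × K.X ((ComplexShape.up ℕ).prev j)) :=
      LinearMap.ker (x₂.hom ∘ₗ LinearMap.fst ℝ _ _ - (K.d _ j).hom ∘ₗ LinearMap.snd ℝ _ _)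
    refine ⟨ModuleCat.of ℝ P, ModuleCat.ofHom (LinearMap.fst ℝ _ _ ∘ₗ P.subtype), ?_,
      ModuleCat.ofHom (LinearMap.snd ℝ _ _ ∘ₗ P.subtype), ?_⟩
    · rw [ModuleCat.epi_iff_surjective]
      intro a
      obtain ⟨x', hx'⟩ := hm _ j _ rfl rfl (x₂ a) (ConcreteCategory.congr_hom hx₂ a) (y₁ a)
        (ConcreteCategory.congr_hom e a)
      exact ⟨⟨(a, x'), by rw [LinearMap.mem_ker]; exact sub_eq_zero.2 hx'⟩, rfl⟩
    · ext p
      exact sub_eq_zero.1 (LinearMap.mem_ker.1 p.2)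
  have hepi : Epi (HomologicalComplex.homologyMap φ j) := by
    rw [HomologicalComplex.epi_homologyMap_iff_up_to_refinements φ _ j _ rfl rfl]
    intro A y₂ hy₂
    let P : Submodule ℝ (A × K.X j × L.X ((ComplexShape.up ℕ).prev j)) :=
      LinearMap.ker (y₂.hom ∘ₗ LinearMap.fst ℝ _ _ - ((φ.f j).hom ∘ₗ LinearMap.fst ℝ _ _ ∘ₗ
        LinearMap.snd ℝ _ _ + (L.d _ j).hom ∘ₗ LinearMap.snd ℝ _ _ ∘ₗ LinearMap.snd ℝ _ _)) ⊓
      LinearMap.ker ((K.d j ((ComplexShape.up ℕ).next j)).hom ∘ₗ LinearMap.fst ℝ _ _ ∘ₗ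
        LinearMap.snd ℝ _ _)
    refine ⟨ModuleCat.of ℝ P, ModuleCat.ofHom (LinearMap.fst ℝ _ _ ∘ₗ P.subtype), ?_,
      ModuleCat.ofHom (LinearMap.fst ℝ _ _ ∘ₗ LinearMap.snd ℝ _ _ ∘ₗ P.subtype), ?_,
      ModuleCat.ofHom (LinearMap.snd ℝ _ _ ∘ₗ LinearMap.snd ℝ _ _ ∘ₗ P.subtype), ?_⟩
    · rw [ModuleCat.epi_iff_surjective]
      intro a
      obtain ⟨x, hx, y', e⟩ := he _ j _ rfl rfl (y₂ a) (ConcreteCategory.congr_hom hy₂ a)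
      exact ⟨⟨(a, x, y'), ⟨LinearMap.mem_ker.2 (sub_eq_zero.2 e), LinearMap.mem_ker.2 hx⟩⟩, rfl⟩
    · ext p
      exact LinearMap.mem_ker.1 p.2.2
    · ext p
      exact sub_eq_zero.1 (LinearMap.mem_ker.1 p.2.1)
  exact isIso_of_mono_of_epi _

end QuasiIso

/-! ### Staircase arguments in a first quadrant double complex -/

section Total

variable {X : ℕ → ℕ → Type w} [∀ m q, AddCommGroup (X m q)] [∀ m q, Module ℝ (X m q)]
variable (δ : ∀ m q, X m q →ₗ[ℝ] X (m + 1) q) (d : ∀ m q, X m q →ₗ[ℝ] X m (q + 1))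

theorem totDiff_apply (n : ℕ) (z : totSpace X n) : (totDiff δ d n z).1 = totD δ d z.1 := rfl

theorem eq_totSingle {m q n : ℕ} (h : m + q = n) (z : totSpace X n)
    (hz : ∀ m' q', ¬ (m' = m ∧ q' = q) → m' + q' = n → z.1 m' q' = 0) :
    z = totSingle X h (z.1 m q) := by
  apply Subtype.ext
  funext m' q'
  by_cases hm : m' = m ∧ q' = q
  · obtain ⟨rfl, rfl⟩ := hm
    rw [totSingle_same]
  · rw [totSingle_ne _ _ hm]
    by_cases hn : m' + q' = n
    · exact hz m' q' hm hn
    · exact z.2 m' q' hn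

/-- If the columns are exact in positive degrees, a cochain whose differential lies in the bottom
row is cohomologous to one in the bottom row. -/
theorem exists_totDiff_add_bottom (hD : ∀ n z, totDiff δ d (n + 1) (totDiff δ d n z) = 0)
    (hd : ∀ m q (x : X m (q + 1)), d m (q + 1) x = 0 → ∃ w, d m q w = x) (n : ℕ)
    (z : totSpace X (n + 1)) (hz : ∀ m q, (totDiff δ d (n + 1) z).1 m (q + 1) = 0) :
    ∃ (w : totSpace X n) (x : X (n + 1) 0), d (n + 1) 0 x = 0 ∧
      z = totSingle X (add_zero (n + 1)) x + totDiff δ d n w := by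
  -- The columns are cleared one at a time, starting with `m = 0`. Once all columns before `j`
  -- vanish, the entry in column `j` is `d`-closed, hence `d`-exact. Subtracting the total
  -- differential of a primitive removes it and otherwise affects only column `j + 1`.
  have key : ∀ j ≤ n + 1, ∃ w : totSpace X n, ∀ m < j, ∀ q, (z - totDiff δ d n w).1 m q = 0 := by
    intro j
    induction j with
    | zero => exact fun _ => ⟨0, fun m hm => absurd hm (Nat.not_lt_zero m)⟩
    | succ j ih =>
      intro hj
      obtain ⟨w, hw⟩ := ih (by omega)
      obtain ⟨q', hq'⟩ : ∃ q', j + (q' + 1) = n + 1 := ⟨n - j, by omega⟩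
      set z' := z - totDiff δ d n w with hz'
      have hzz : ∀ m q, (totDiff δ d (n + 1) z').1 m (q + 1) = 0 := by
        intro m q
        rw [hz', map_sub, hD, sub_zero]
        exact hz m q
      have hdz : d j (q' + 1) (z'.1 j (q' + 1)) = 0 := by
        have := hzz j (q' + 1)
        rw [totDiff_apply] at this
        rcases j with _ | j
        · exact this
        · simp only [totD] at this
          rw [hw j (by omega), map_zero, zero_add] at this
          exact (smul_eq_zero.1 this).resolve_left (pow_ne_zero _ (by norm_num))
      obtain ⟨w₀, hw₀⟩ := hd j q' _ hdz
      -- The sign cancels the factor `(-1)^j` that accompanies `d` in the total differential.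
      refine ⟨w + (-1 : ℝ) ^ j • totSingle X (show j + q' = n by omega) w₀, fun m hm q => ?_⟩
      rw [map_add, map_smul, totDiff_totSingle, ← sub_sub, ← hz', smul_add, smul_smul,
        ← mul_pow, neg_one_mul, neg_neg, one_pow, one_smul]
      change z'.1 m q - ((-1 : ℝ) ^ j • (totSingle X _ (δ j q' w₀)).1 m q +
        (totSingle X _ (d j q' w₀)).1 m q) = 0
      rw [totSingle_ne _ (δ j q' w₀) (by omega), smul_zero, zero_add, hw₀]
      by_cases hmj : m = j
      · subst hmj
        by_cases hq : q = q' + 1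
        · subst hq
          rw [totSingle_same, sub_self]
        · rw [totSingle_ne _ _ (by omega), sub_zero]
          exact z'.2 _ _ (by omega)
      · rw [totSingle_ne _ _ (by omega), sub_zero]
        exact hw m (by omega) q
  obtain ⟨w, hw⟩ := key (n + 1) le_rfl
  set z' := z - totDiff δ d n w with hz'
  have e := eq_totSingle (add_zero (n + 1)) z' fun m q h1 h2 => hw m (by omega) q
  refine ⟨w, z'.1 (n + 1) 0, ?_, ?_⟩
  · have h1 : (totDiff δ d (n + 1) z').1 (n + 1) 1 = 0 := by
      rw [hz', map_sub, hD, sub_zero]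
      exact hz _ _
    rw [totDiff_apply] at h1
    simp only [totD] at h1
    rw [hw n (by omega), map_zero, zero_add] at h1
    exact (smul_eq_zero.1 h1).resolve_left (pow_ne_zero _ (by norm_num))
  · rw [← e, hz', sub_add_cancel]

/-- If the rows are exact in positive degrees, a cochain whose differential lies in the first
column is cohomologous to one in the first column. -/
theorem exists_totDiff_add_left (hD : ∀ n z, totDiff δ d (n + 1) (totDiff δ d n z) = 0)
    (hδ : ∀ m q (x : X (m + 1) q), δ (m + 1) q x = 0 → ∃ w, δ m q w = x) (n : ℕ)
    (z : totSpace X (n + 1)) (hz : ∀ m q, (totDiff δ d (n + 1) z).1 (m + 1) q = 0) :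
    ∃ (w : totSpace X n) (x : X 0 (n + 1)), δ 0 (n + 1) x = 0 ∧
      z = totSingle X (zero_add (n + 1)) x + totDiff δ d n w := by
  -- The rows are cleared from `q = 0` upwards. The horizontal differential carries no sign, so no
  -- correction is needed.
  have key : ∀ j ≤ n + 1, ∃ w : totSpace X n, ∀ q < j, ∀ m, (z - totDiff δ d n w).1 m q = 0 := by
    intro j
    induction j with
    | zero => exact fun _ => ⟨0, fun m hm => absurd hm (Nat.not_lt_zero m)⟩
    | succ j ih =>
      intro hj
      obtain ⟨w, hw⟩ := ih (by omega)
      obtain ⟨m', hm'⟩ : ∃ m', (m' + 1) + j = n + 1 := ⟨n - j, by omega⟩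
      set z' := z - totDiff δ d n w with hz'
      have hzz : ∀ m q, (totDiff δ d (n + 1) z').1 (m + 1) q = 0 := by
        intro m q
        rw [hz', map_sub, hD, sub_zero]
        exact hz m q
      have hdz : δ (m' + 1) j (z'.1 (m' + 1) j) = 0 := by
        have := hzz (m' + 1) j
        rw [totDiff_apply] at this
        rcases j with _ | j
        · exact this
        · simp only [totD] at this
          rwa [hw j (by omega), map_zero, smul_zero, add_zero] at this
      obtain ⟨w₀, hw₀⟩ := hδ m' j _ hdz
      refine ⟨w + totSingle X (show m' + j = n by omega) w₀, fun q hq m => ?_⟩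
      rw [map_add, totDiff_totSingle, ← sub_sub, ← hz']
      change z'.1 m q - ((totSingle X _ (δ m' j w₀)).1 m q +
        (-1 : ℝ) ^ m' • (totSingle X _ (d m' j w₀)).1 m q) = 0
      rw [totSingle_ne _ (d m' j w₀) (by omega), smul_zero, add_zero, hw₀]
      by_cases hqj : q = j
      · subst hqj
        by_cases hm : m = m' + 1
        · subst hm
          rw [totSingle_same, sub_self]
        · rw [totSingle_ne _ _ (by omega), sub_zero]
          exact z'.2 _ _ (by omega)
      · rw [totSingle_ne _ _ (by omega), sub_zero]
        exact hw q (by omega) m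
  obtain ⟨w, hw⟩ := key (n + 1) le_rfl
  set z' := z - totDiff δ d n w with hz'
  have e := eq_totSingle (zero_add (n + 1)) z' fun m q h1 h2 => hw q (by omega) m
  refine ⟨w, z'.1 0 (n + 1), ?_, ?_⟩
  · have h1 : (totDiff δ d (n + 1) z').1 1 (n + 1) = 0 := by
      rw [hz', map_sub, hD, sub_zero]
      exact hz _ _
    rw [totDiff_apply] at h1
    simp only [totD] at h1
    rwa [hw n (by omega), map_zero, smul_zero, add_zero] at h1
  · rw [← e, hz', sub_add_cancel]

theorem totSingle_injective {m q n : ℕ} (h : m + q = n) :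
    Function.Injective (totSingle X h) := by
  intro x y e
  have := congrArg (fun z : totSpace X n => z.1 m q) e
  simpa only [totSingle_same] using this

end Total

/-! ### The two edge maps are quasi-isomorphisms if columns and rows are exact -/

section Zigzag

variable {R : Type u} [Ring R] [Algebra ℝ R] [TopologicalSpace R] [IsTopologicalRing R]
  [ContinuousSMul ℝ R]
variable {V : Type v} [NormedAddCommGroup V] [NormedSpace ℝ V] {K : Subgroup Rˣ}

theorem bicomplex_totDiff_totDiff (n : ℕ)
    (z : totSpace (fun m q => bicomplex V K m q) n) :
    totDiff (X := fun m q => bicomplex V K m q) (bicomplexδ K) (bicomplexD K) (n + 1)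
      (totDiff (bicomplexδ K) (bicomplexD K) n z) = 0 :=
  totDiff_totDiff _ _ (fun _ _ => bicomplexδ_bicomplexδ) (fun _ _ => bicomplexD_bicomplexD)
    (fun _ _ => bicomplexD_bicomplexδ) n z

theorem diffEdge_injective (m : ℕ) :
    Function.Injective (diffEdge K m : diffCochains R V m →ₗ[ℝ] bicomplex V K m 0) := by
  intro f f' e
  apply Subtype.ext
  funext g
  obtain ⟨h, rfl⟩ := toBar_surjective g
  have := DFunLike.congr_fun (congrFun (congrFun (congrArg Subtype.val e) h) 1) Fin.elim0
  exact this

theorem invariantEdge_injective (q : ℕ) :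
    Function.Injective (invariantEdge K q : invariantForms V K q →ₗ[ℝ] bicomplex V K 0 q) := by
  intro f f' e
  apply Subtype.ext
  funext h g
  rw [Subsingleton.elim h Fin.elim0]
  exact congrFun (congrFun (congrArg Subtype.val e) 1) g

/-- Every cocycle is cohomologous to one concentrated in the row `q = 0`, whose entry is `d`-closed
and hence comes from a bar cochain. For injectivity on cohomology, the same reduction is applied to
a cochain whose differential lies in that row. -/
theorem quasiIso_diffToMiddle
    (hd : ∀ m q (x : bicomplex V K m (q + 1)), bicomplexD K m (q + 1) x = 0 →
      ∃ w, bicomplexD K m q w = x)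
    (h0 : ∀ m (x : bicomplex V K m 0), bicomplexD K m 0 x = 0 → ∃ f, diffEdge K m f = x) :
    QuasiIso (diffToMiddle (V := V) K) := by
  have hinj : ∀ n, Function.Injective fun f : diffCochains R V n =>
      totSingle (fun m q => bicomplex V K m q) (add_zero n) (diffEdge K n f) := fun n =>
    (totSingle_injective _).comp (diffEdge_injective n)
  have hcocycle : ∀ n (f : diffCochains R V n), totDiff (X := fun m q => bicomplex V K m q)
      (bicomplexδ K) (bicomplexD K) n (totSingle _ (add_zero n) (diffEdge K n f)) = 0 →
      diffD n f = 0 := by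
    intro n f hf
    rw [diffEdge_comm] at hf
    exact hinj (n + 1) (hf.trans (by simp))
  have hb := exists_totDiff_add_bottom (X := fun m q => bicomplex V K m q) (bicomplexδ K)
    (bicomplexD K) bicomplex_totDiff_totDiff hd
  refine quasiIso_of_elements _ (fun x hx => ?_) (fun y hy => ?_) (fun n x hx y hy => ?_)
    fun n y hy => ?_
  · have e0 : totSingle (fun m q => bicomplex V K m q) (add_zero 0) (diffEdge K 0 0) = 0 := by
      rw [map_zero, map_zero]
    exact hinj 0 (hx.trans e0.symm)
  · rw [middleComplex_d] at hy
    have hy' : totDiff (X := fun m q => bicomplex V K m q) (bicomplexδ K) (bicomplexD K) 0 y = 0 :=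
      hy
    have e := eq_totSingle (X := fun m q => bicomplex V K m q) (add_zero 0) y
      fun m q h1 h2 => by omega
    have h1 : bicomplexD K 0 0 (y.1 0 0) = 0 :=
      congrFun (congrFun (congrArg Subtype.val hy') 0) 1
    obtain ⟨f, hf⟩ := h0 0 _ h1
    refine ⟨f, ?_, ?_⟩
    · rw [diffComplex_d]
      refine hcocycle 0 f ?_
      rw [hf, ← e, hy']
    · change y = totSingle _ (add_zero 0) (diffEdge K 0 f)
      rw [hf]
      exact e
  · rw [middleComplex_d] at hy
    rw [diffComplex_d]
    change totSingle (fun m q => bicomplex V K m q) (add_zero (n + 1)) (diffEdge K (n + 1) x)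
      = totDiff _ _ n y at hy
    suffices h : ∃ (y' : bicomplex V K n 0), bicomplexD K n 0 y' = 0 ∧
        totDiff (X := fun m q => bicomplex V K m q) (bicomplexδ K) (bicomplexD K) n y =
        totDiff (bicomplexδ K) (bicomplexD K) n (totSingle _ (add_zero n) y') by
      obtain ⟨y', h1, h2⟩ := h
      obtain ⟨f, rfl⟩ := h0 n y' h1
      refine ⟨f, hinj (n + 1) ?_⟩
      change totSingle (fun m q => bicomplex V K m q) (add_zero (n + 1)) (diffEdge K (n + 1) x) =
        totSingle (fun m q => bicomplex V K m q) (add_zero (n + 1))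
          (diffEdge K (n + 1) (diffD n f))
      rw [hy, h2, diffEdge_comm]
    have hz : ∀ m q, (totDiff (X := fun m q => bicomplex V K m q) (bicomplexδ K) (bicomplexD K)
        n y).1 m (q + 1) = 0 := fun m q => by
      rw [← hy, totSingle_ne _ _ (by omega)]
    -- In total degree 0 the only entry is `(0, 0)`, so the cochain already lies in the bottom row.
    -- There are no lower cochains to subtract.
    rcases n with _ | n
    · refine ⟨y.1 0 0, hz 0 0, ?_⟩
      rw [← eq_totSingle (X := fun m q => bicomplex V K m q) (add_zero 0) y
        fun m q h1 h2 => by omega]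
    · obtain ⟨w, x', hx', e⟩ := hb n y hz
      refine ⟨x', hx', ?_⟩
      rw [e, map_add, bicomplex_totDiff_totDiff, add_zero]
  · rw [middleComplex_d] at hy
    have hy' : totDiff (X := fun m q => bicomplex V K m q) (bicomplexδ K) (bicomplexD K) (n + 1) y
      = 0 := hy
    obtain ⟨w, x', hx', e⟩ := hb n y fun m q => by rw [hy']; rfl
    obtain ⟨f, rfl⟩ := h0 (n + 1) x' hx'
    refine ⟨f, ?_, w, ?_⟩
    · rw [diffComplex_d]
      refine hcocycle (n + 1) f ?_
      rw [e, map_add, bicomplex_totDiff_totDiff, add_zero] at hy'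
      exact hy'
    · rw [middleComplex_d]
      exact e

/-- The argument for the other edge, with rows and columns exchanged. -/
theorem quasiIso_invariantToMiddle
    (hδ : ∀ m q (x : bicomplex V K (m + 1) q), bicomplexδ K (m + 1) q x = 0 →
      ∃ w, bicomplexδ K m q w = x)
    (h0 : ∀ q (x : bicomplex V K 0 q), bicomplexδ K 0 q x = 0 → ∃ f, invariantEdge K q f = x) :
    QuasiIso (invariantToMiddle (V := V) K) := by
  have hinj : ∀ n, Function.Injective fun f : invariantForms V K n =>
      totSingle (fun m q => bicomplex V K m q) (zero_add n) (invariantEdge K n f) := fun n =>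
    (totSingle_injective _).comp (invariantEdge_injective n)
  have hcocycle : ∀ n (f : invariantForms V K n), totDiff (X := fun m q => bicomplex V K m q)
      (bicomplexδ K) (bicomplexD K) n (totSingle _ (zero_add n) (invariantEdge K n f)) = 0 →
      invariantD K n f = 0 := by
    intro n f hf
    rw [invariantEdge_comm] at hf
    exact hinj (n + 1) (hf.trans (by simp))
  have hb := exists_totDiff_add_left (X := fun m q => bicomplex V K m q) (bicomplexδ K)
    (bicomplexD K) bicomplex_totDiff_totDiff hδ
  refine quasiIso_of_elements _ (fun x hx => ?_) (fun y hy => ?_) (fun n x hx y hy => ?_)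
    fun n y hy => ?_
  · have e0 : totSingle (fun m q => bicomplex V K m q) (zero_add 0) (invariantEdge K 0 0) = 0 := by
      rw [map_zero, map_zero]
    exact hinj 0 (hx.trans e0.symm)
  · rw [middleComplex_d] at hy
    have hy' : totDiff (X := fun m q => bicomplex V K m q) (bicomplexδ K) (bicomplexD K) 0 y = 0 :=
      hy
    have e := eq_totSingle (X := fun m q => bicomplex V K m q) (zero_add 0) y
      fun m q h1 h2 => by omega
    have h1 : bicomplexδ K 0 0 (y.1 0 0) = 0 :=
      congrFun (congrFun (congrArg Subtype.val hy') 1) 0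
    obtain ⟨f, hf⟩ := h0 0 _ h1
    refine ⟨f, ?_, ?_⟩
    · rw [invariantComplex_d]
      refine hcocycle 0 f ?_
      rw [hf, ← e, hy']
    · change y = totSingle _ (zero_add 0) (invariantEdge K 0 f)
      rw [hf]
      exact e
  · rw [middleComplex_d] at hy
    rw [invariantComplex_d]
    change totSingle (fun m q => bicomplex V K m q) (zero_add (n + 1))
      (invariantEdge K (n + 1) x) = totDiff _ _ n y at hy
    suffices h : ∃ (y' : bicomplex V K 0 n), bicomplexδ K 0 n y' = 0 ∧
        totDiff (X := fun m q => bicomplex V K m q) (bicomplexδ K) (bicomplexD K) n y =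
        totDiff (bicomplexδ K) (bicomplexD K) n (totSingle _ (zero_add n) y') by
      obtain ⟨y', h1, h2⟩ := h
      obtain ⟨f, rfl⟩ := h0 n y' h1
      refine ⟨f, hinj (n + 1) ?_⟩
      change totSingle (fun m q => bicomplex V K m q) (zero_add (n + 1))
          (invariantEdge K (n + 1) x) =
        totSingle (fun m q => bicomplex V K m q) (zero_add (n + 1))
          (invariantEdge K (n + 1) (invariantD K n f))
      rw [hy, h2, invariantEdge_comm]
    have hz : ∀ m q, (totDiff (X := fun m q => bicomplex V K m q) (bicomplexδ K) (bicomplexD K)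
        n y).1 (m + 1) q = 0 := fun m q => by
      rw [← hy, totSingle_ne _ _ (by omega)]
    rcases n with _ | n
    · refine ⟨y.1 0 0, hz 0 0, ?_⟩
      rw [← eq_totSingle (X := fun m q => bicomplex V K m q) (zero_add 0) y
        fun m q h1 h2 => by omega]
    · obtain ⟨w, x', hx', e⟩ := hb n y hz
      refine ⟨x', hx', ?_⟩
      rw [e, map_add, bicomplex_totDiff_totDiff, add_zero]
  · rw [middleComplex_d] at hy
    have hy' : totDiff (X := fun m q => bicomplex V K m q) (bicomplexδ K) (bicomplexD K) (n + 1) y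
      = 0 := hy
    obtain ⟨w, x', hx', e⟩ := hb n y fun m q => by rw [hy']; rfl
    obtain ⟨f, rfl⟩ := h0 (n + 1) x' hx'
    refine ⟨f, ?_, w, ?_⟩
    · rw [invariantComplex_d]
      refine hcocycle (n + 1) f ?_
      rw [e, map_add, bicomplex_totDiff_totDiff, add_zero] at hy'
      exact hy'
    · rw [middleComplex_d]
      exact e

end Zigzag

/-! ### Smooth functions of parameters -/

section Parameters

open MeasureTheory

variable {V : Type*} [NormedAddCommGroup V] [NormedSpace ℝ V]
variable {E : Type*} [NormedAddCommGroup E] [NormedSpace ℝ E]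

theorem contDiff_of_hasDerivAt_seq {c : ℕ → ℝ → V} (hc : ∀ k t, HasDerivAt (c k) (c (k + 1) t) t) :
    ContDiff ℝ ∞ (c 0) := by
  have h : ∀ (n k : ℕ), ContDiff ℝ n (c k) := by
    intro n
    induction n with
    | zero => exact fun k => contDiff_zero.2 <| continuous_iff_continuousAt.2 fun t =>
        (hc k t).continuousAt
    | succ n ih =>
      intro k
      push_cast
      refine contDiff_succ_iff_deriv.2 ⟨fun t => (hc k t).differentiableAt, by simp, ?_⟩
      rw [deriv_eq (hc k)]
      exact ih (k + 1)
  exact contDiff_infty.2 fun n => h n 0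

theorem contDiff_deriv_right {F : E → ℝ → V} (hF : ContDiff ℝ ∞ fun p : E × ℝ => F p.1 p.2) :
    ContDiff ℝ ∞ fun p : E × ℝ => deriv (F p.1) p.2 := by
  have h : ∀ p : E × ℝ, deriv (F p.1) p.2 =
      fderiv ℝ (fun p : E × ℝ => F p.1 p.2) p ((0, 1) : E × ℝ) := by
    rintro ⟨x, t⟩
    have h1 := ((hF.differentiable (by simp)) (x, t)).hasFDerivAt
    have h2 : HasDerivAt (fun s : ℝ => (x, s)) ((0, 1) : E × ℝ) t :=
      (hasDerivAt_const t x).prodMk (hasDerivAt_id t)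
    exact (h1.comp_hasDerivAt t h2).deriv
  simp only [h]
  exact (hF.fderiv_right (m := ∞) (by simp)).clm_apply contDiff_const

theorem contDiff_iteratedDeriv_right {F : E → ℝ → V}
    (hF : ContDiff ℝ ∞ fun p : E × ℝ => F p.1 p.2) (k : ℕ) :
    ContDiff ℝ ∞ fun p : E × ℝ => iteratedDeriv k (F p.1) p.2 := by
  induction k with
  | zero => simpa using! hF
  | succ k ih =>
    simp only [iteratedDeriv_succ]
    exact contDiff_deriv_right (F := fun x => iteratedDeriv k (F x)) ih

theorem hasDerivAt_iteratedDeriv {f : ℝ → V} (hf : ContDiff ℝ ∞ f) (k : ℕ) (t : ℝ) :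
    HasDerivAt (iteratedDeriv k f) (iteratedDeriv (k + 1) f t) t := by
  rw [iteratedDeriv_succ]
  exact ((hf.differentiable_iteratedDeriv k (by exact_mod_cast ENat.natCast_lt_top k)) t).hasDerivAt

theorem hasDerivAt_setIntegral {X : Type*} [TopologicalSpace X] [SecondCountableTopology X]
    [MeasurableSpace X] [OpensMeasurableSpace X] (μ : Measure X) [IsFiniteMeasureOnCompacts μ]
    {C : Set X} (hC : IsCompact C) (hCm : MeasurableSet C) {F F' : X → ℝ → V}
    (hF : Continuous fun p : X × ℝ => F p.1 p.2) (hF' : Continuous fun p : X × ℝ => F' p.1 p.2)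
    (h : ∀ x t, HasDerivAt (F x) (F' x t) t) (t : ℝ) :
    HasDerivAt (fun t => ∫ x in C, F x t ∂μ) (∫ x in C, F' x t ∂μ) t := by
  obtain ⟨b, hb⟩ := (hC.prod (isCompact_closedBall t (1 : ℝ))).exists_bound_of_continuousOn
    hF'.continuousOn
  have hfin : IsFiniteMeasure (μ.restrict C) := ⟨by simpa using hC.measure_lt_top⟩
  have hc : ∀ t : ℝ, Continuous fun x : X => (x, t) := fun t => by fun_prop
  have hm : ∀ t, AEStronglyMeasurable (fun x => F x t) (μ.restrict C) :=
    fun t => (hF.comp (hc t)).aestronglyMeasurable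
  have h := hasDerivAt_integral_of_dominated_loc_of_deriv_le (μ := μ.restrict C)
    (F := fun t x => F x t) (F' := fun t x => F' x t)
    (x₀ := t) (s := Metric.ball t 1) (bound := fun _ => b) (Metric.ball_mem_nhds t one_pos)
    (Filter.Eventually.of_forall hm) ?_ (hF'.comp (hc t)).aestronglyMeasurable ?_
    (integrable_const b) ?_
  · exact h.2
  · obtain ⟨b', hb'⟩ := hC.exists_bound_of_continuousOn (hF.comp (hc t)).continuousOn
    exact Integrable.of_bound (hm t) b' ((ae_restrict_iff' hCm).2
      (Filter.Eventually.of_forall hb'))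
  · exact (ae_restrict_iff' hCm).2 (Filter.Eventually.of_forall fun x hx s hs =>
      hb (x, s) ⟨hx, Metric.ball_subset_closedBall hs⟩)
  · exact Filter.Eventually.of_forall fun x s _ => h x s

/-- A function smooth in a real variable and, together with its derivatives, continuous in a
parameter is smooth after integration over a compact set of parameters. -/
theorem contDiff_setIntegral {X : Type*} [TopologicalSpace X] [SecondCountableTopology X]
    [MeasurableSpace X] [OpensMeasurableSpace X] (μ : Measure X) [IsFiniteMeasureOnCompacts μ]
    {C : Set X} (hC : IsCompact C) (hCm : MeasurableSet C) {F : X → ℝ → V}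
    (hF : ∀ x, ContDiff ℝ ∞ (F x))
    (hcont : ∀ k, Continuous fun p : X × ℝ => iteratedDeriv k (F p.1) p.2) :
    ContDiff ℝ ∞ fun t => ∫ x in C, F x t ∂μ := by
  have key : ∀ k t, HasDerivAt (fun t => ∫ x in C, iteratedDeriv k (F x) t ∂μ)
      (∫ x in C, iteratedDeriv (k + 1) (F x) t ∂μ) t := fun k =>
    hasDerivAt_setIntegral μ hC hCm (hcont k) (hcont (k + 1))
      fun x => hasDerivAt_iteratedDeriv (hF x) k
  simpa using contDiff_of_hasDerivAt_seq key

theorem contDiff_integral_unit {F : ℝ → ℝ → V} (hF : ContDiff ℝ ∞ fun p : ℝ × ℝ => F p.1 p.2) :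
    ContDiff ℝ ∞ fun t => ∫ r in Set.Icc (0 : ℝ) 1, F r t :=
  contDiff_setIntegral volume isCompact_Icc measurableSet_Icc
    (fun _ => hF.comp (contDiff_const.prodMk contDiff_id))
    fun k => (contDiff_iteratedDeriv_right hF k).continuous

/-- Hadamard's lemma. -/
theorem exists_contDiff_slope [CompleteSpace V] {f : ℝ → V} (hf : ContDiff ℝ ∞ f) :
    ∃ g : ℝ → V, ContDiff ℝ ∞ g ∧ g 0 = deriv f 0 ∧ ∀ t, f t = f 0 + t • g t := by
  refine ⟨fun t => ∫ r in Set.Icc (0 : ℝ) 1, deriv f (r * t), ?_, by simp, fun t => ?_⟩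
  · have h1 : ContDiff ℝ ∞ (deriv f) := (contDiff_infty_iff_deriv.1 hf).2
    exact contDiff_integral_unit (h1.comp (contDiff_fst.mul contDiff_snd))
  · have h1 : Continuous (deriv f) := ((contDiff_infty_iff_deriv.1 hf).2).continuous
    have h2 : ∀ r ∈ Set.uIcc (0 : ℝ) 1,
        HasDerivAt (fun r => f (r * t)) (t • deriv f (r * t)) r := by
      intro r _
      have h3 := (hf.differentiable (by simp) (r * t)).hasDerivAt
      exact h3.scomp r (by simpa using (hasDerivAt_id r).mul_const t)
    have h4 := intervalIntegral.integral_eq_sub_of_hasDerivAt h2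
      (Continuous.intervalIntegrable (by fun_prop) _ _)
    rw [intervalIntegral.integral_smul, intervalIntegral.integral_of_le zero_le_one,
      ← integral_Icc_eq_integral_Ioc] at h4
    rw [h4]
    simp

end Parameters

/-! ### Fréchet algebras as limits of Banach algebras -/

section FrechetRep

variable {R : Type*} [Ring R] [Algebra ℝ R] [TopologicalSpace R] [IsTopologicalRing R]
  [ContinuousSMul ℝ R]
variable {B : ℕ → Type*} [∀ i, NormedRing (B i)] [∀ i, NormedAlgebra ℝ (B i)]
  [∀ i, CompleteSpace (B i)]

/-- The topology of `R` is the initial one for the homomorphisms `π i` to Banach algebras, and is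
Hausdorff and sequentially complete. -/
structure IsFrechetRep (π : ∀ i, R →ₐ[ℝ] B i) : Prop where
  isEmbedding : Topology.IsEmbedding fun x i => π i x
  exists_limit : ∀ f : ℕ → R, (∀ i, CauchySeq fun n => π i (f n)) →
    ∃ x, ∀ i, Filter.Tendsto (fun n => π i (f n)) Filter.atTop (𝓝 (π i x))

variable {π : ∀ i, R →ₐ[ℝ] B i}

theorem IsFrechetRep.ext (hπ : IsFrechetRep π) {x y : R} (h : ∀ i, π i x = π i y) : x = y :=
  hπ.isEmbedding.injective (funext h)

theorem IsFrechetRep.t2Space (hπ : IsFrechetRep π) : T2Space R := hπ.isEmbedding.t2Space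

theorem IsFrechetRep.tendsto_iff (hπ : IsFrechetRep π) {α : Type*} {l : Filter α} {f : α → R}
    {x : R} :
    Filter.Tendsto f l (𝓝 x) ↔ ∀ i, Filter.Tendsto (fun a => π i (f a)) l (𝓝 (π i x)) := by
  rw [hπ.isEmbedding.tendsto_nhds_iff, tendsto_pi_nhds]
  rfl

theorem IsFrechetRep.exists_eq_of_tendsto (hπ : IsFrechetRep π) {f : ℕ → R} {y : ∀ i, B i}
    (h : ∀ i, Filter.Tendsto (fun n => π i (f n)) Filter.atTop (𝓝 (y i))) :
    ∃ x, ∀ i, π i x = y i := by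
  obtain ⟨x, hx⟩ := hπ.exists_limit f fun i => (h i).cauchySeq
  exact ⟨x, fun i => tendsto_nhds_unique (hx i) (h i)⟩

theorem IsFrechetRep.hasDerivAt_iff (hπ : IsFrechetRep π) {γ : ℝ → R} {x : R} {t : ℝ} :
    HasDerivAt γ x t ↔ ∀ i, HasDerivAt (fun s => π i (γ s)) (π i x) t := by
  simp only [hasDerivAt_iff_tendsto_quotient, hπ.tendsto_iff, map_smul, map_sub]

/-- The componentwise derivatives at `t` come from an element of `R`: they are limits of difference
quotients along `t + 1/(n+1)`, which lie in `R`, and `R` is sequentially complete. The family of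
componentwise smooth curves is therefore closed under differentiation. -/
theorem IsFrechetRep.isSmoothCurve_iff (hπ : IsFrechetRep π) {γ : ℝ → R} :
    IsSmoothCurve γ ↔ ∀ i, ContDiff ℝ ∞ fun t => π i (γ t) := by
  constructor
  · rintro ⟨c, rfl, hc⟩ i
    exact contDiff_of_hasDerivAt_seq (c := fun k t => π i (c k t))
      fun k t => (hπ.hasDerivAt_iff.1 (hc k t)) i
  · intro h
    refine IsSmoothCurve.of_closed {γ | ∀ i, ContDiff ℝ ∞ fun t => π i (γ t)} ?_ h
    intro γ (hγ : ∀ i, ContDiff ℝ ∞ fun t => π i (γ t))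
    have hd : ∀ i t, HasDerivAt (fun t => π i (γ t)) (deriv (fun t => π i (γ t)) t) t := fun i t =>
      ((hγ i).differentiable (by simp) t).hasDerivAt
    have hlim : ∀ t, ∃ x, ∀ i, π i x = deriv (fun t => π i (γ t)) t := by
      intro t
      refine hπ.exists_eq_of_tendsto
        (f := fun n => ((t + 1 / ((n : ℝ) + 1)) - t)⁻¹ • (γ (t + 1 / ((n : ℝ) + 1)) - γ t))
        fun i => ?_
      have h1 := hasDerivAt_iff_tendsto_quotient.1 (hd i t)
      have h2 : Filter.Tendsto (fun n : ℕ => t + 1 / ((n : ℝ) + 1)) Filter.atTop (𝓝[≠] t) := by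
        refine tendsto_nhdsWithin_iff.2 ⟨?_, Filter.Eventually.of_forall fun n => ?_⟩
        · simpa using (tendsto_const_nhds (x := t)).add
            (tendsto_one_div_add_atTop_nhds_zero_nat (𝕜 := ℝ))
        · have : (0 : ℝ) < 1 / ((n : ℝ) + 1) := by positivity
          simpa using this.ne'
      simp only [map_smul, map_sub]
      exact h1.comp h2
    choose γ' hγ' using hlim
    refine ⟨γ', fun i => ?_, fun t => hπ.hasDerivAt_iff.2 fun i => ?_⟩
    · simp only [hγ']
      exact (contDiff_infty_iff_deriv.1 (hγ i)).2
    · rw [hγ']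
      exact hd i t

/-- Inversion is smooth on the units of each Banach algebra, so smoothness of the inverse curve is
automatic. -/
theorem IsFrechetRep.isSmoothUnitCurve_iff (hπ : IsFrechetRep π) {c : ℝ → Rˣ} :
    IsSmoothUnitCurve c ↔ IsSmoothCurve fun t => (c t : R) := by
  refine ⟨fun h => h.val, fun h => ⟨h, hπ.isSmoothCurve_iff.2 fun i => ?_⟩⟩
  have h1 := hπ.isSmoothCurve_iff.1 h i
  have h2 : ∀ t, π i ((c t)⁻¹ : Rˣ).val = Ring.inverse (π i (c t)) := by
    intro t
    have : π i (c t) = (Units.map (π i : R →* B i) (c t) : B i) := rfl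
    rw [this, Ring.inverse_unit]
    rfl
  simp only [h2]
  refine contDiff_iff_contDiffAt.2 fun t => ?_
  exact ContDiffAt.comp t (contDiffAt_ringInverse ℝ (Units.map (π i : R →* B i) (c t)))
    h1.contDiffAt

/-- `R` has no norm, so the exponential series is summed in each Banach algebra. Completeness
provides an element of `R` with these components, and it is the sum because the topology of `R` is
initial and Hausdorff. -/
theorem IsFrechetRep.map_exp (hπ : IsFrechetRep π) (i : ℕ) (x : R) :
    π i (NormedSpace.exp x) = NormedSpace.exp (π i x) := by
  have h1 : ∀ i, HasSum (fun n : ℕ => π i ((n.factorial⁻¹ : ℝ) • x ^ n))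
      (NormedSpace.exp (π i x)) := by
    intro i
    simpa using NormedSpace.exp_series_hasSum_exp' (𝕂 := ℝ) (π i x)
  obtain ⟨y, hy⟩ := hπ.exists_eq_of_tendsto
    (f := fun N => ∑ n ∈ Finset.range N, (n.factorial⁻¹ : ℝ) • x ^ n) fun i => by
      simpa only [map_sum] using (h1 i).tendsto_sum_nat
  have h2 : HasSum (fun n : ℕ => (n.factorial⁻¹ : ℝ) • x ^ n) y := by
    refine hπ.tendsto_iff.2 fun i => ?_
    simp only [map_sum, hy]
    exact h1 i
  have := hπ.t2Space
  rw [NormedSpace.exp_eq_tsum ℝ]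
  dsimp only
  rw [h2.tsum_eq, hy]

theorem IsFrechetRep.isUnit_exp (hπ : IsFrechetRep π) (x : R) : IsUnit (NormedSpace.exp x) := by
  have h : ∀ x : R, NormedSpace.exp x * NormedSpace.exp (-x) = 1 := fun x => hπ.ext fun i => by
    let : NormedAlgebra ℚ (B i) := NormedAlgebra.restrictScalars ℚ ℝ (B i)
    rw [map_mul, hπ.map_exp, hπ.map_exp, map_neg, map_one,
      ← NormedSpace.exp_add_of_commute (Commute.neg_right (Commute.refl _)), add_neg_cancel,
      NormedSpace.exp_zero]
  exact ⟨⟨_, _, h x, by simpa using h (-x)⟩, rfl⟩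

theorem IsFrechetRep.coe_expUnit (hπ : IsFrechetRep π) (x : R) :
    (expUnit x : R) = NormedSpace.exp x := by
  rw [expUnit, dif_pos (hπ.isUnit_exp x)]
  rfl

theorem IsFrechetRep.map_expUnit (hπ : IsFrechetRep π) (i : ℕ) (x : R) :
    π i (expUnit x : R) = NormedSpace.exp (π i x) := by
  rw [hπ.coe_expUnit, hπ.map_exp]

theorem IsFrechetRep.expUnit_zero (hπ : IsFrechetRep π) : expUnit (0 : R) = 1 :=
  Units.ext <| hπ.ext fun i => by rw [hπ.map_expUnit]; simp

end FrechetRep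

/-! ### Powers of curves that agree with `1` to second order -/

section Powers

variable {B : Type*} [NormedRing B] [NormedAlgebra ℝ B]

/-- The derivatives of order at most `k` of `u` at `r` are bounded by `c / 2 ^ k`; this is
submultiplicative. -/
def JetBound (k : ℕ) (c : ℝ) (u : ℝ → B) (r : ℝ) : Prop :=
  ∀ j ≤ k, 2 ^ k * ‖iteratedDeriv j u r‖ ≤ c

theorem JetBound.add {k : ℕ} {c c' r : ℝ} {u u' : ℝ → B} (hu : ContDiff ℝ ∞ u)
    (hu' : ContDiff ℝ ∞ u') (h : JetBound k c u r) (h' : JetBound k c' u' r) :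
    JetBound k (c + c') (fun s => u s + u' s) r := by
  intro j hj
  have e : iteratedDeriv j (fun s => u s + u' s) r = iteratedDeriv j u r + iteratedDeriv j u' r :=
    iteratedDeriv_add (hu.contDiffAt.of_le (natCast_le_infty j))
      (hu'.contDiffAt.of_le (natCast_le_infty j))
  rw [e]
  have := mul_le_mul_of_nonneg_left (norm_add_le (iteratedDeriv j u r) (iteratedDeriv j u' r))
    (by positivity : (0 : ℝ) ≤ 2 ^ k)
  linarith [h j hj, h' j hj]

/-- In Leibniz's formula the binomial coefficients add up to `2^j ≤ 2^k`. This is the reason for the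
normalising factor `2^k`. -/
theorem JetBound.mul {k : ℕ} {c c' r : ℝ} {u u' : ℝ → B} (hu : ContDiff ℝ ∞ u)
    (hu' : ContDiff ℝ ∞ u') (h : JetBound k c u r) (h' : JetBound k c' u' r) :
    JetBound k (c * c') (fun s => u s * u' s) r := by
  intro j hj
  have h1 := norm_iteratedFDeriv_mul_le (n := j) hu hu' r (natCast_le_infty j)
  simp only [norm_iteratedFDeriv_eq_norm_iteratedDeriv] at h1
  have hc : ∀ i ≤ k, ‖iteratedDeriv i u r‖ ≤ c / 2 ^ k := fun i hi => by
    rw [le_div_iff₀' (by positivity)]; exact h i hi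
  have hc' : ∀ i ≤ k, ‖iteratedDeriv i u' r‖ ≤ c' / 2 ^ k := fun i hi => by
    rw [le_div_iff₀' (by positivity)]; exact h' i hi
  have h0 : 0 ≤ c / 2 ^ k := (norm_nonneg _).trans (hc 0 (Nat.zero_le k))
  have h0' : 0 ≤ c' / 2 ^ k := (norm_nonneg _).trans (hc' 0 (Nat.zero_le k))
  have h2 : ‖iteratedDeriv j (fun s => u s * u' s) r‖ ≤
      ∑ i ∈ Finset.range (j + 1), (j.choose i : ℝ) * (c / 2 ^ k * (c' / 2 ^ k)) := by
    refine h1.trans (Finset.sum_le_sum fun i hi => ?_)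
    have hi' : i ≤ j := by simpa [Nat.lt_succ_iff] using hi
    rw [mul_assoc]
    exact mul_le_mul_of_nonneg_left (mul_le_mul (hc i (hi'.trans hj)) (hc' _ (by omega))
      (norm_nonneg _) h0) (by positivity)
  rw [← Finset.sum_mul, ← Nat.cast_sum, Nat.sum_range_choose] at h2
  push_cast at h2
  have h3 : (2 : ℝ) ^ j ≤ 2 ^ k := pow_le_pow_right₀ (by norm_num) hj
  calc 2 ^ k * ‖iteratedDeriv j (fun s => u s * u' s) r‖
      ≤ 2 ^ k * (2 ^ k * (c / 2 ^ k * (c' / 2 ^ k))) := by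
        refine mul_le_mul_of_nonneg_left (h2.trans ?_) (by positivity)
        exact mul_le_mul_of_nonneg_right h3 (mul_nonneg h0 h0')
    _ = c * c' := by field_simp

theorem JetBound.one_add_pow_sub_one {k : ℕ} {x r : ℝ} {a : ℝ → B} (ha : ContDiff ℝ ∞ a)
    (h : JetBound k x a r) (N : ℕ) :
    JetBound k ((1 + x) ^ N - 1) (fun s => (1 + a s) ^ N - 1) r := by
  induction N with
  | zero =>
    intro j _
    have : (fun s => (1 + a s) ^ 0 - 1) = fun _ => (0 : B) := by simp
    rw [this]
    simp
  | succ N ih =>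
    have hp : ContDiff ℝ ∞ fun s => (1 + a s) ^ N - 1 :=
      ((contDiff_const.add ha).pow N).sub contDiff_const
    -- With `p = (1 + a)^N - 1` one has `(1 + a)^(N+1) - 1 = p + a p + a`, and the bounds satisfy
    -- the same recursion.
    have h1 := JetBound.add (hp.add (ha.mul hp)) ha (ih.add hp (ha.mul hp) (h.mul ha hp ih)) h
    convert h1 using 1
    · ring
    · funext s
      rw [pow_succ']
      noncomm_ring

theorem exists_jetBound_comp_cutoff [CompleteSpace B] {w : ℝ → B} (hw : ContDiff ℝ ∞ w)
    (h1 : w 0 = 1) (hd : deriv w 0 = 0) (k : ℕ) :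
    ∃ C, 0 ≤ C ∧ ∀ N : ℕ, 0 < N → ∀ r,
      JetBound k (C / N ^ 2) (fun r => w (cutoff r * r / N) - 1) r := by
  -- Hadamard's lemma is applied twice. As `w` agrees with `1` to first order, `w t = 1 + t² b(t)`.
  -- Hence `w (χ/N) - 1 = N⁻² Γ (1/N)` with `χ r = cutoff r * r`, where `Γ` is jointly smooth down
  -- to `ε = 0` and supported in `|r| ≤ 1`.
  obtain ⟨g, hg, hg0, e⟩ := exists_contDiff_slope hw
  obtain ⟨b, hb, -, e'⟩ := exists_contDiff_slope hg
  have e2 : ∀ t, w t = 1 + (t ^ 2) • b t := fun t => by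
    rw [e, e', hg0, hd, h1, zero_add, smul_smul, sq]
  let Γ : ℝ → ℝ → B := fun ε r => (cutoff r * r) ^ 2 • b (ε * (cutoff r * r))
  have hχ : ContDiff ℝ ∞ fun r : ℝ => cutoff r * r := cutoff.contDiff.mul contDiff_id
  have hΓ : ContDiff ℝ ∞ fun p : ℝ × ℝ => Γ p.1 p.2 :=
    ((hχ.comp contDiff_snd).pow 2).smul (hb.comp (contDiff_fst.mul (hχ.comp contDiff_snd)))
  have hbd : ∀ j, ∃ C, 0 ≤ C ∧ ∀ ε ∈ Set.Icc (0 : ℝ) 1, ∀ r, ‖iteratedDeriv j (Γ ε) r‖ ≤ C := by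
    intro j
    obtain ⟨C, hC⟩ := ((isCompact_Icc (a := (0 : ℝ)) (b := 1)).prod
      (isCompact_Icc (a := (-1 : ℝ)) (b := 1))).exists_bound_of_continuousOn
      (contDiff_iteratedDeriv_right hΓ j).continuous.continuousOn
    have hC0 : 0 ≤ C := (norm_nonneg _).trans (hC (0, 0) (by simp))
    refine ⟨C, hC0, fun ε hε r => ?_⟩
    by_cases hr : r ∈ Set.Icc (-1 : ℝ) 1
    · exact hC (ε, r) ⟨hε, hr⟩
    · have h2 : 1 < |r| := by
        rw [← not_le, abs_le]
        exact hr
      have h3 : Γ ε =ᶠ[𝓝 r] fun _ => 0 := by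
        filter_upwards [(continuous_abs.tendsto r).eventually (lt_mem_nhds h2)] with s hs
        simp [Γ, cutoff_eq_zero hs.le]
      rw [h3.iteratedDeriv_eq]
      simpa using hC0
  choose C hC0 hC using hbd
  refine ⟨2 ^ k * ∑ j ∈ Finset.range (k + 1), C j,
    mul_nonneg (by positivity) (Finset.sum_nonneg fun j _ => hC0 j), fun N hN r j hj => ?_⟩
  have hN' : (1 : ℝ) ≤ N := by exact_mod_cast hN
  have e3 : (fun r => w (cutoff r * r / N) - 1) = fun r => ((N : ℝ) ^ 2)⁻¹ • Γ (N : ℝ)⁻¹ r := by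
    funext r
    simp only [e2, Γ, smul_smul, add_sub_cancel_left]
    congr 1
    · field_simp
    · rw [div_eq_inv_mul]
  have e4 : iteratedDeriv j (fun r => ((N : ℝ) ^ 2)⁻¹ • Γ (N : ℝ)⁻¹ r) r =
      ((N : ℝ) ^ 2)⁻¹ • iteratedDeriv j (Γ (N : ℝ)⁻¹) r := by
    have hs : ContDiff ℝ ∞ (Γ (N : ℝ)⁻¹) := hΓ.comp (contDiff_const.prodMk contDiff_id)
    exact iteratedDeriv_fun_const_smul (hs.contDiffAt.of_le (natCast_le_infty j)) _
  rw [e3, e4, norm_smul, Real.norm_of_nonneg (by positivity)]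
  have h5 : ‖iteratedDeriv j (Γ (N : ℝ)⁻¹) r‖ ≤ ∑ j ∈ Finset.range (k + 1), C j :=
    (hC j _ ⟨by positivity, inv_le_one_of_one_le₀ hN'⟩ r).trans
      (Finset.single_le_sum (f := C) (fun j _ => hC0 j) (by simpa [Nat.lt_succ_iff] using hj))
  calc _ = 2 ^ k * ‖iteratedDeriv j (Γ (N : ℝ)⁻¹) r‖ / N ^ 2 := by ring
    _ ≤ _ := by gcongr

/-- Each factor differs from `1` by `O(1/N²)` with its derivatives up to order `k`. So the `N`-th
power differs from `1` by at most `(1 + C/N²)^N - 1 ≤ exp(C/N) - 1`, which tends to 0. -/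
theorem eventually_iteratedDeriv_pow_le [CompleteSpace B] {w : ℝ → B} (hw : ContDiff ℝ ∞ w)
    (h1 : w 0 = 1) (hd : deriv w 0 = 0) (k : ℕ) {ε : ℝ} (hε : 0 < ε) :
    ∀ᶠ N : ℕ in Filter.atTop, ∀ r,
      ‖iteratedDeriv k (fun r => w (cutoff r * r / N) ^ N - 1) r‖ ≤ ε := by
  obtain ⟨C, hC0, hC⟩ := exists_jetBound_comp_cutoff hw h1 hd k
  have hlim : Filter.Tendsto (fun N : ℕ => Real.exp (C / N) - 1) Filter.atTop (𝓝 0) := by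
    have := (Real.continuous_exp.tendsto 0).comp (tendsto_const_div_atTop_nhds_zero_nat C)
    simpa using this.sub_const 1
  filter_upwards [hlim.eventually (gt_mem_nhds hε), Filter.eventually_gt_atTop 0] with N hN hN0 r
  have ha : ContDiff ℝ ∞ fun r => w (cutoff r * r / N) - 1 :=
    (hw.comp ((cutoff.contDiff.mul contDiff_id).div_const _)).sub contDiff_const
  have h2 := (hC N hN0 r).one_add_pow_sub_one ha N k le_rfl
  have h3 : (1 + C / (N : ℝ) ^ 2) ^ N ≤ Real.exp (C / N) := by
    have hN1 : (0 : ℝ) < N := by exact_mod_cast hN0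
    calc (1 + C / (N : ℝ) ^ 2) ^ N ≤ Real.exp (C / (N : ℝ) ^ 2) ^ N := by
          refine pow_le_pow_left₀ (by positivity) ?_ N
          rw [add_comm]
          exact Real.add_one_le_exp _
      _ = Real.exp (C / N) := by
          rw [← Real.exp_nat_mul]
          congr 1
          field_simp
  have h4 : (1 : ℝ) ≤ 2 ^ k := one_le_pow₀ (by norm_num)
  have e : (fun r => (1 + (w (cutoff r * r / N) - 1)) ^ N - 1) =
      fun r => w (cutoff r * r / N) ^ N - 1 := by simp
  rw [e] at h2
  nlinarith [norm_nonneg (iteratedDeriv k (fun r => w (cutoff r * r / N) ^ N - 1) r)]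

end Powers

/-! ### Smooth functions on the group of units -/

section SmoothFun

variable {R : Type*} [Ring R] [Algebra ℝ R] [TopologicalSpace R] [IsTopologicalRing R]
  [ContinuousSMul ℝ R]
variable {B : ℕ → Type*} [∀ i, NormedRing (B i)] [∀ i, NormedAlgebra ℝ (B i)]
  [∀ i, CompleteSpace (B i)]
variable {π : ∀ i, R →ₐ[ℝ] B i}
variable {V : Type*} [NormedAddCommGroup V] [NormedSpace ℝ V]
variable {E : Type*} [NormedAddCommGroup E] [NormedSpace ℝ E]

/-- A function on `Rˣ` that is smooth along smooth curves. -/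
def SmoothOnUnits (f : Rˣ → V) : Prop :=
  ∀ c : ℝ → Rˣ, IsSmoothUnitCurve c → ContDiff ℝ ∞ fun t => f (c t)

/-- A map to `R` that sends smooth curves to smooth curves. -/
def IsPlot (Ψ : E → R) : Prop :=
  ∀ c : ℝ → E, ContDiff ℝ ∞ c → IsSmoothCurve fun t => Ψ (c t)

/-- A map to `Rˣ` that sends smooth curves to smooth curves. -/
def IsUnitPlot (Ψ : E → Rˣ) : Prop :=
  ∀ c : ℝ → E, ContDiff ℝ ∞ c → IsSmoothUnitCurve fun t => Ψ (c t)

theorem IsFrechetRep.isPlot_iff (hπ : IsFrechetRep π) [FiniteDimensional ℝ E] {Ψ : E → R} :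
    IsPlot Ψ ↔ ∀ i, ContDiff ℝ ∞ fun u => π i (Ψ u) := by
  constructor
  · intro h i
    exact CurveSmooth.contDiff fun c hc => hπ.isSmoothCurve_iff.1 (h c hc) i
  · intro h c hc
    exact hπ.isSmoothCurve_iff.2 fun i => (h i).comp hc

theorem IsFrechetRep.isUnitPlot_iff (hπ : IsFrechetRep π) {Ψ : E → Rˣ} :
    IsUnitPlot Ψ ↔ IsPlot fun u => (Ψ u : R) :=
  forall₂_congr fun _ _ => hπ.isSmoothUnitCurve_iff

theorem SmoothOnUnits.contDiff [CompleteSpace V] [FiniteDimensional ℝ E] {f : Rˣ → V}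
    (hf : SmoothOnUnits f) {Ψ : E → Rˣ} (hΨ : IsUnitPlot Ψ) : ContDiff ℝ ∞ fun u => f (Ψ u) :=
  CurveSmooth.contDiff fun c hc => hf _ (hΨ c hc)

theorem IsUnitPlot.mul {Ψ Ψ' : E → Rˣ} (h : IsUnitPlot Ψ) (h' : IsUnitPlot Ψ') :
    IsUnitPlot fun u => Ψ u * Ψ' u := fun c hc => (h c hc).mul' (h' c hc)

theorem IsSmoothCurve.const (x : R) : IsSmoothCurve fun _ : ℝ => x :=
  ⟨fun k _ => if k = 0 then x else 0, by simp, fun k t => by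
    rw [hasDerivAt_iff_tendsto_quotient]; simpa using! tendsto_const_nhds⟩

theorem IsSmoothUnitCurve.const (g : Rˣ) : IsSmoothUnitCurve fun _ : ℝ => g :=
  ⟨.const _, .const _⟩

theorem IsUnitPlot.const (g : Rˣ) : IsUnitPlot fun _ : E => g := fun _ _ => .const g

theorem IsPlot.const (x : R) : IsPlot fun _ : E => x := fun _ _ => .const x

theorem IsFrechetRep.isUnitPlot_of_curve (hπ : IsFrechetRep π) [FiniteDimensional ℝ E]
    {c : ℝ → Rˣ} (hc : IsSmoothUnitCurve c) {s : E → ℝ} (hs : ContDiff ℝ ∞ s) :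
    IsUnitPlot fun u => c (s u) := by
  rw [hπ.isUnitPlot_iff, hπ.isPlot_iff]
  exact fun i => (hπ.isSmoothCurve_iff.1 hc.val i).comp hs

theorem IsUnitPlot.pow {Ψ : E → Rˣ} (h : IsUnitPlot Ψ) (N : ℕ) : IsUnitPlot fun u => Ψ u ^ N := by
  induction N with
  | zero => simpa using IsUnitPlot.const (E := E) (1 : Rˣ)
  | succ N ih => simpa only [pow_succ] using ih.mul h

theorem contDiff_exp {B : Type*} [NormedRing B] [NormedAlgebra ℝ B] [CompleteSpace B] :
    ContDiff ℝ ∞ (NormedSpace.exp : B → B) :=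
  contDiff_iff_contDiffAt.2 fun x => (NormedSpace.exp_analytic (𝕂 := ℝ) x).contDiffAt

theorem IsFrechetRep.isUnitPlot_expUnit (hπ : IsFrechetRep π) [FiniteDimensional ℝ E] {X : E → R}
    (hX : IsPlot X) : IsUnitPlot fun u => expUnit (X u) := by
  rw [hπ.isUnitPlot_iff, hπ.isPlot_iff]
  simp only [hπ.map_expUnit]
  exact fun i => contDiff_exp.comp (hπ.isPlot_iff.1 hX i)

/-- The derivative along the diagonal is the sum of the partial derivatives. -/
theorem hasDerivAt_diagonal {F : ℝ × ℝ → V} (hF : ContDiff ℝ ∞ F) {t : ℝ} {a b : V}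
    (ha : HasDerivAt (fun s => F (s, t)) a t) (hb : HasDerivAt (fun s => F (t, s)) b t) :
    HasDerivAt (fun s => F (s, s)) (a + b) t := by
  have h := (hF.differentiable (by simp) (t, t)).hasFDerivAt
  have h1 := h.comp_hasDerivAt (f := fun s => (s, t)) t
    ((hasDerivAt_id' t).prodMk (hasDerivAt_const t t))
  have h2 := h.comp_hasDerivAt (f := fun s => (t, s)) t
    ((hasDerivAt_const t t).prodMk (hasDerivAt_id' t))
  have h3 := h.comp_hasDerivAt (f := fun s => (s, s)) t
    ((hasDerivAt_id' t).prodMk (hasDerivAt_id' t))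
  rw [ha.unique h1, hb.unique h2, ← map_add]
  simpa using! h3

/-- Only two-variable calculus is available here, since dependence on the velocity alone is not yet
known. The last factor of `w` is given its own time variable, and the derivative along the diagonal
adds one copy of `D`. -/
theorem SmoothOnUnits.hasDerivAt_pow (hπ : IsFrechetRep π) [CompleteSpace V] {f : Rˣ → V}
    (hf : SmoothOnUnits f) {w : ℝ → Rˣ} (hw : IsSmoothUnitCurve w) (h1 : w 0 = 1) {D : V} {g : Rˣ}
    (hD : HasDerivAt (fun t => f (w t * g)) D 0) (N : ℕ) :
    HasDerivAt (fun t => f (w t ^ N * g)) (N • D) 0 := by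
  induction N with
  | zero => simpa using hasDerivAt_const _ _
  | succ N ih =>
    have h := hasDerivAt_diagonal (F := fun p : ℝ × ℝ => f (w p.1 ^ N * (w p.2 * g))) (t := 0)
      (hf.contDiff (((hπ.isUnitPlot_of_curve hw contDiff_fst).pow N).mul
        ((hπ.isUnitPlot_of_curve hw contDiff_snd).mul (.const g))))
      (a := N • D) (b := D) (by simpa [h1] using ih) (by simpa [h1] using hD)
    simpa only [pow_succ, mul_assoc, succ_nsmul] using h

/-- Near `r = 0` the curve `U N` is `w (r/N)^N`. The factors `N` and `1/N` cancel, so `f` has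
derivative `D` along it for every `N`. On the other hand `U N` becomes arbitrarily close to `1` with
its derivatives. Gluing a suitable sequence gives a smooth curve on which `f` has derivative
`2^(j+2) D` at `2⁻ʲ`, so `D = 0`. -/
theorem SmoothOnUnits.deriv_eq_zero (hπ : IsFrechetRep π) [CompleteSpace V] {f : Rˣ → V}
    (hf : SmoothOnUnits f) {w : ℝ → Rˣ} (hw : IsSmoothUnitCurve w) (h1 : w 0 = 1)
    (hd : HasDerivAt (fun t => (w t : R)) 0 0) (g : Rˣ) :
    HasDerivAt (fun t => f (w t * g)) 0 0 := by
  have hφ : ContDiff ℝ ∞ fun t => f (w t * g) := hf _ (hw.mul' (.const g))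
  have hD := (hφ.differentiable (by simp) 0).hasDerivAt
  set D := deriv (fun t => f (w t * g)) 0 with hDdef
  suffices D = 0 by rwa [this] at hD
  let U : ℕ → ℝ → Rˣ := fun N r => w (cutoff r * r / N) ^ N
  -- At stage `j` only the first components `i ≤ j` and the orders `k ≤ j` are controlled. This is a
  -- finite set of conditions, and each fixed pair `(i, k)` is eventually included.
  have hex : ∀ j : ℕ, ∃ N : ℕ, 0 < N ∧ ∀ i ≤ j, ∀ k ≤ j, ∀ r,
      ‖iteratedDeriv k (fun r => π i (U N r : R) - 1) r‖ ≤ 1 / j.factorial := by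
    intro j
    have : ∀ᶠ N : ℕ in Filter.atTop, ∀ p ∈ Finset.range (j + 1) ×ˢ Finset.range (j + 1), ∀ r,
        ‖iteratedDeriv p.2 (fun r => π p.1 (U N r : R) - 1) r‖ ≤ 1 / j.factorial := by
      refine (Filter.eventually_all_finset _).2 fun p _ => ?_
      have h2 := eventually_iteratedDeriv_pow_le (hπ.isSmoothCurve_iff.1 hw.val p.1)
        (by simp [h1]) (by simpa using (hπ.hasDerivAt_iff.1 hd p.1).deriv) p.2
        (ε := 1 / j.factorial) (by positivity)
      simpa [U] using h2
    obtain ⟨N, hN, hN0⟩ := (this.and (Filter.eventually_gt_atTop 0)).exists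
    exact ⟨N, hN0, fun i hi k hk r => hN (i, k) (by simp; omega) r⟩
  choose N hN0 hN using hex
  let u : ℕ → ℝ → Rˣ := fun j => U (N j)
  have hu : ∀ j, IsSmoothUnitCurve (u j) := fun j =>
    (((hπ.isUnitPlot_of_curve hw (E := ℝ)
      ((cutoff.contDiff.mul contDiff_id).div_const (N j : ℝ))).pow (N j)) _ contDiff_id :)
  have hc : IsSmoothUnitCurve (glue u 1) := by
    rw [hπ.isSmoothUnitCurve_iff, hπ.isSmoothCurve_iff]
    intro i
    have := comp_glue (fun g : Rˣ => π i (g : R)) u 1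
    rw [this]
    refine contDiff_glue (fun j => hπ.isSmoothCurve_iff.1 (hu j).val i) (fun j r hr => ?_)
      (fun _ => 1) fun k => ?_
    · simp [u, U, cutoff_eq_zero hr, h1]
    · filter_upwards [Filter.eventually_ge_atTop (max i k)] with j hj r
      simpa [u] using hN j i (le_trans (le_max_left _ _) hj) k (le_trans (le_max_right _ _) hj) r
  have hs : ContDiff ℝ ∞ fun t => f (glue u 1 t * g) := hf _ (hc.mul' (.const g))
  have hcenter : ∀ j, deriv (fun t => f (glue u 1 t * g)) ((2 ^ j)⁻¹) = (2 : ℝ) ^ (j + 2) • D := by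
    intro j
    have hsm : ContDiff ℝ ∞ fun r => f (w (r / N j) ^ N j * g) := by
      refine hf _ (IsSmoothUnitCurve.mul' ?_ (.const g))
      exact (((hπ.isUnitPlot_of_curve hw (E := ℝ)
        (contDiff_id.div_const (N j : ℝ))).pow (N j)) _ contDiff_id :)
    have := iteratedDeriv_comp_glue_center (fun x : Rˣ => f (x * g)) u 1 (k := 1) j
      (fun r => f (w (r / N j) ^ N j * g)) (hsm.of_le (by simp)) (by
        filter_upwards [cutoff_eq_one] with r hr
        simp [u, U, hr])
    rw [iteratedDeriv_one, iteratedDeriv_one, pow_one] at this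
    rw [this]
    congr 1
    have hN1 : (N j : ℝ) ≠ 0 := by exact_mod_cast (hN0 j).ne'
    have h3 := hf.hasDerivAt_pow hπ hw h1 hD (N j)
    have h4 : HasDerivAt (fun r : ℝ => r / N j) (1 / N j) 0 := (hasDerivAt_id 0).div_const _
    have h5 := HasDerivAt.scomp (h := fun r : ℝ => r / N j)
      (g₁ := fun t => f (w t ^ N j * g)) (0 : ℝ) (by simpa using h3) h4
    refine h5.deriv.trans ?_
    rw [← Nat.cast_smul_eq_nsmul ℝ, smul_smul, one_div_mul_cancel hN1, one_smul]
  have hlim : Filter.Tendsto (fun j : ℕ => deriv (fun t => f (glue u 1 t * g)) ((2 ^ j)⁻¹))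
      Filter.atTop (𝓝 (deriv (fun t => f (glue u 1 t * g)) 0)) :=
    ((contDiff_infty_iff_deriv.1 hs).2.continuous.tendsto 0).comp tendsto_center
  simp only [hcenter] at hlim
  have hlim2 : Filter.Tendsto (fun j : ℕ => ((2 : ℝ) ^ (j + 2))⁻¹ • (2 : ℝ) ^ (j + 2) • D)
      Filter.atTop (𝓝 ((0 : ℝ) • deriv (fun t => f (glue u 1 t * g)) 0)) := by
    refine Filter.Tendsto.smul ?_ hlim
    exact tendsto_center.comp (Filter.tendsto_add_atTop_nat 2)
  rw [zero_smul] at hlim2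
  refine tendsto_nhds_unique (tendsto_const_nhds.congr fun j => ?_) hlim2
  rw [smul_smul, inv_mul_cancel₀ (by positivity), one_smul]

end SmoothFun

/-! ### Calculus on the group of units -/

section Calculus

variable {R : Type*} [Ring R] [Algebra ℝ R] [TopologicalSpace R] [IsTopologicalRing R]
  [ContinuousSMul ℝ R]
variable {B : ℕ → Type*} [∀ i, NormedRing (B i)] [∀ i, NormedAlgebra ℝ (B i)]
  [∀ i, CompleteSpace (B i)]
variable {π : ∀ i, R →ₐ[ℝ] B i}
variable {V : Type*} [NormedAddCommGroup V] [NormedSpace ℝ V]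
variable {E : Type*} [NormedAddCommGroup E] [NormedSpace ℝ E]

/-! ### Plots -/

theorem IsPlot.mul {Ψ Ψ' : E → R} (h : IsPlot Ψ) (h' : IsPlot Ψ') :
    IsPlot fun u => Ψ u * Ψ' u := fun c hc => (h c hc).mul (h' c hc)

theorem IsFrechetRep.isPlot_smul (hπ : IsFrechetRep π) [FiniteDimensional ℝ E] {s : E → ℝ}
    {Ψ : E → R} (hs : ContDiff ℝ ∞ s) (h : IsPlot Ψ) : IsPlot fun u => s u • Ψ u := by
  rw [hπ.isPlot_iff] at *
  intro i
  simpa only [map_smul] using! hs.smul (h i)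

theorem IsPlot.comp {E' : Type*} [NormedAddCommGroup E'] [NormedSpace ℝ E'] {Ψ : E → R}
    (h : IsPlot Ψ) {g : E' → E} (hg : ContDiff ℝ ∞ g) : IsPlot fun u => Ψ (g u) :=
  fun _ hc => h _ (hg.comp hc)

theorem IsUnitPlot.comp {E' : Type*} [NormedAddCommGroup E'] [NormedSpace ℝ E'] {Ψ : E → Rˣ}
    (h : IsUnitPlot Ψ) {g : E' → E} (hg : ContDiff ℝ ∞ g) : IsUnitPlot fun u => Ψ (g u) :=
  fun _ hc => h _ (hg.comp hc)

theorem IsUnitPlot.val {Ψ : E → Rˣ} (h : IsUnitPlot Ψ) : IsPlot fun u => (Ψ u : R) :=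
  fun c hc => (h c hc).val

theorem IsUnitPlot.inv {Ψ : E → Rˣ} (h : IsUnitPlot Ψ) : IsUnitPlot fun u => (Ψ u)⁻¹ :=
  fun c hc => (h c hc).inv'

theorem IsUnitPlot.curve {c : ℝ → Rˣ} (h : IsUnitPlot c) : IsSmoothUnitCurve c := h _ contDiff_id

theorem IsFrechetRep.isUnitPlot_curve (hπ : IsFrechetRep π) {c : ℝ → Rˣ}
    (h : IsSmoothUnitCurve c) : IsUnitPlot c :=
  hπ.isUnitPlot_of_curve h contDiff_id

theorem IsFrechetRep.isPlot_curve (hπ : IsFrechetRep π) {c : ℝ → R}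
    (h : IsSmoothCurve c) : IsPlot c := by
  rw [hπ.isPlot_iff]
  exact hπ.isSmoothCurve_iff.1 h

theorem IsFrechetRep.isUnitPlot_flow (hπ : IsFrechetRep π) [FiniteDimensional ℝ E] {c : E → Rˣ}
    {x : E → R} {s : E → ℝ} (hc : IsUnitPlot c) (hx : IsPlot x) (hs : ContDiff ℝ ∞ s) :
    IsUnitPlot fun u => flow (c u) (x u) (s u) :=
  (hπ.isUnitPlot_expUnit (hπ.isPlot_smul hs (hx.mul hc.inv.val))).mul hc

/-- The derivative of a smooth curve. -/
def velocity (γ : ℝ → R) (t : ℝ) : R := Classical.epsilon fun y => HasDerivAt γ y t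

theorem IsSmoothCurve.hasDerivAt {γ : ℝ → R} (h : IsSmoothCurve γ) (t : ℝ) :
    HasDerivAt γ (velocity γ t) t := by
  obtain ⟨c, rfl, hc⟩ := h
  exact Classical.epsilon_spec (p := fun y => HasDerivAt (c 0) y t) ⟨_, hc 0 t⟩

/-- The derivative of `Ψ` in the direction `v`. -/
def pd (Ψ : E → R) (v : E) (u : E) : R := velocity (fun t : ℝ => Ψ (u + t • v)) 0

theorem contDiff_line (u v : E) : ContDiff ℝ ∞ fun t : ℝ => u + t • v := by fun_prop

theorem IsPlot.hasDerivAt_pd {Ψ : E → R} (h : IsPlot Ψ) (v u : E) :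
    HasDerivAt (fun t : ℝ => Ψ (u + t • v)) (pd Ψ v u) 0 :=
  IsSmoothCurve.hasDerivAt (h _ (contDiff_line u v)) 0

theorem hasDerivAt_line (u v : E) (t : ℝ) : HasDerivAt (fun t : ℝ => u + t • v) v t := by
  simpa using ((hasDerivAt_id t).smul_const v).const_add u

theorem hasDerivAt_fderiv_line {F : E → V} (hF : ContDiff ℝ ∞ F) (u v : E) :
    HasDerivAt (fun t : ℝ => F (u + t • v)) (fderiv ℝ F u v) 0 := by
  have h := (hF.differentiable (by simp) (u + (0 : ℝ) • v)).hasFDerivAt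
  simpa using! h.comp_hasDerivAt 0 (hasDerivAt_line u v 0)

theorem IsFrechetRep.map_pd (hπ : IsFrechetRep π) [FiniteDimensional ℝ E] {Ψ : E → R}
    (h : IsPlot Ψ) (v u : E) (i : ℕ) : π i (pd Ψ v u) = fderiv ℝ (fun u => π i (Ψ u)) u v :=
  (hπ.hasDerivAt_iff.1 (h.hasDerivAt_pd v u) i).unique
    (hasDerivAt_fderiv_line (hπ.isPlot_iff.1 h i) u v)

theorem IsFrechetRep.isPlot_pd (hπ : IsFrechetRep π) [FiniteDimensional ℝ E] {Ψ : E → R}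
    (h : IsPlot Ψ) (v : E) : IsPlot (pd Ψ v) := by
  rw [hπ.isPlot_iff]
  intro i
  simp only [hπ.map_pd h]
  exact contDiff_fderiv_apply (hπ.isPlot_iff.1 h i) v

theorem fderiv_fderiv_comm {F : E → V} (hF : ContDiff ℝ ∞ F) (v w u : E) :
    fderiv ℝ (fun u => fderiv ℝ F u w) u v = fderiv ℝ (fun u => fderiv ℝ F u v) u w := by
  have := congrArg (fun T : Module.End ℝ (smoothFun E V) => (T ⟨F, hF⟩).1 u)
    (dirD_commute (V := V) v w).eq
  exact this

theorem IsFrechetRep.pd_comm (hπ : IsFrechetRep π) [FiniteDimensional ℝ E] {Ψ : E → R}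
    (h : IsPlot Ψ) (v w u : E) : pd (pd Ψ w) v u = pd (pd Ψ v) w u := by
  refine hπ.ext fun i => ?_
  rw [hπ.map_pd (hπ.isPlot_pd h w), hπ.map_pd (hπ.isPlot_pd h v)]
  simp only [hπ.map_pd h]
  exact fderiv_fderiv_comm (hπ.isPlot_iff.1 h i) v w u

/-! ### Derivatives of smooth functions on the group of units -/

theorem IsFrechetRep.flow_zero (hπ : IsFrechetRep π) (g : Rˣ) (x : R) : flow g x 0 = g := by
  rw [flow, zero_smul, hπ.expUnit_zero, one_mul]

theorem IsFrechetRep.hasDerivAt_expUnit (hπ : IsFrechetRep π) (X : R) :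
    HasDerivAt (fun t : ℝ => (expUnit (t • X) : R)) X 0 := by
  rw [hπ.hasDerivAt_iff]
  intro i
  simp only [hπ.map_expUnit, map_smul]
  have := hasDerivAt_exp_smul_const (𝕂 := ℝ) (π i X) (0 : ℝ)
  simpa using this

theorem hasDerivAt_const_curve (b : R) (t : ℝ) : HasDerivAt (fun _ => b) 0 t := by
  rw [hasDerivAt_iff_tendsto_quotient]
  simpa using! tendsto_const_nhds

theorem hasDerivAt_mul_const_curve {a : ℝ → R} {a' : R} {t : ℝ} (ha : HasDerivAt a a' t) (b : R) :
    HasDerivAt (fun s => a s * b) (a' * b) t := by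
  simpa using hasDerivAt_mul_curve ha (hasDerivAt_const_curve b t)

theorem hasDerivAt_const_mul_curve {a : ℝ → R} {a' : R} {t : ℝ} (ha : HasDerivAt a a' t) (b : R) :
    HasDerivAt (fun s => b * a s) (b * a') t := by
  simpa using hasDerivAt_mul_curve (hasDerivAt_const_curve b t) ha

theorem IsFrechetRep.hasDerivAt_flow (hπ : IsFrechetRep π) (g : Rˣ) (x : R) :
    HasDerivAt (fun t : ℝ => (flow g x t : R)) x 0 := by
  have := hasDerivAt_mul_const_curve (hπ.hasDerivAt_expUnit (x * (g⁻¹ : Rˣ).val)) (g : R)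
  simpa [flow, mul_assoc] using this

theorem IsFrechetRep.isSmoothUnitCurve_flow (hπ : IsFrechetRep π) (g : Rˣ) (x : R) :
    IsSmoothUnitCurve (flow g x) :=
  (hπ.isUnitPlot_flow (E := ℝ) (.const g) (.const x) contDiff_id).curve

/-- The derivative of `f` at `g` along the tangent vector `y`. -/
def fd (f : Rˣ → V) (g : Rˣ) (y : R) : V := deriv (fun t => f (flow g y t)) 0

theorem SmoothOnUnits.hasDerivAt_fd (hπ : IsFrechetRep π) {f : Rˣ → V} (hf : SmoothOnUnits f)
    (g : Rˣ) (y : R) : HasDerivAt (fun t => f (flow g y t)) (fd f g y) 0 :=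
  ((hf _ (hπ.isSmoothUnitCurve_flow g y)).differentiable (by simp) 0).hasDerivAt

theorem IsFrechetRep.isUnitPlot_exp_smul (hπ : IsFrechetRep π) [FiniteDimensional ℝ E] {s : E → ℝ}
    (hs : ContDiff ℝ ∞ s) (X : R) : IsUnitPlot fun u => expUnit (s u • X) :=
  hπ.isUnitPlot_expUnit (hπ.isPlot_smul hs (.const X))

theorem IsFrechetRep.expUnit_neg (hπ : IsFrechetRep π) (X : R) :
    expUnit X * expUnit (-X) = 1 := by
  refine Units.ext (hπ.ext fun i => ?_)
  let : NormedAlgebra ℚ (B i) := NormedAlgebra.restrictScalars ℚ ℝ (B i)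
  rw [Units.val_mul, map_mul, hπ.map_expUnit, hπ.map_expUnit, map_neg, Units.val_one, map_one,
    ← NormedSpace.exp_add_of_commute (Commute.neg_right (Commute.refl _)), add_neg_cancel,
    NormedSpace.exp_zero]

/-- The derivative of `f` along a smooth curve only depends on the velocity. -/
theorem SmoothOnUnits.hasDerivAt_comp (hπ : IsFrechetRep π) [CompleteSpace V] {f : Rˣ → V}
    (hf : SmoothOnUnits f) {c : ℝ → Rˣ} (hc : IsSmoothUnitCurve c) {y : R} {t : ℝ}
    (hy : HasDerivAt (fun s => (c s : R)) y t) :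
    HasDerivAt (fun s => f (c s)) (fd f (c t) y) t := by
  set X : R := y * ((c t)⁻¹ : Rˣ).val with hX
  have hcs : IsUnitPlot fun s => c (t + s) :=
    hπ.isUnitPlot_of_curve hc (by fun_prop : ContDiff ℝ ∞ fun s : ℝ => t + s)
  -- Since `c (t + s) = exp(s X) * w s * c t`, the curve is compared with the exponential of the
  -- same velocity. The quotient `w` satisfies `w 0 = 1` and has zero velocity, so it contributes
  -- nothing.
  let w : ℝ → Rˣ := fun s => expUnit (s • -X) * (c (t + s) * (c t)⁻¹)
  have hw : IsUnitPlot w := (hπ.isUnitPlot_exp_smul contDiff_id _).mul (hcs.mul (.const _))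
  have hw1 : w 0 = 1 := by simp [w, hπ.expUnit_zero]
  have hy0 : HasDerivAt (fun s => (c (t + s) : R)) y 0 := by
    rw [hπ.hasDerivAt_iff] at hy ⊢
    intro i
    have h := hy i
    rw [show t = t + 0 by simp] at h
    exact h.comp_const_add t 0
  have hwd : HasDerivAt (fun s => (w s : R)) 0 0 := by
    have h1 := hasDerivAt_mul_curve (hπ.hasDerivAt_expUnit (-X))
      (hasDerivAt_mul_const_curve hy0 ((c t)⁻¹ : Rˣ).val)
    simpa [w, hπ.expUnit_zero, ← hX] using h1
  have h0 := hf.deriv_eq_zero hπ hw.curve hw1 hwd (c t)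
  have h := hasDerivAt_diagonal
    (F := fun p : ℝ × ℝ => f (expUnit (p.1 • X) * (w p.2 * c t))) (t := 0)
    (hf.contDiff ((hπ.isUnitPlot_exp_smul contDiff_fst X).mul
      ((hw.comp contDiff_snd).mul (.const _))))
    (a := fd f (c t) y) (b := 0) (by simpa [hw1, flow] using hf.hasDerivAt_fd hπ (c t) y)
    (by simpa [hπ.expUnit_zero] using h0)
  have e : (fun s : ℝ => f (expUnit (s • X) * (w s * c t))) = fun s => f (c (t + s)) := by
    funext s
    congr 1
    rw [show w s * c t = expUnit (s • -X) * c (t + s) by simp [w, mul_assoc], ← mul_assoc, smul_neg,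
      hπ.expUnit_neg, one_mul]
  simp only [e, add_zero] at h
  have h2 := h.scomp_of_eq (h := fun s => s - t) t ((hasDerivAt_id t).sub_const t) (by simp)
  simpa [Function.comp_def] using h2

/-- The curve `exp(s X) exp(s Y) g` has velocity `x + y` at 0. Giving the two exponentials separate
times splits the derivative into the two summands. -/
theorem SmoothOnUnits.fd_add (hπ : IsFrechetRep π) [CompleteSpace V] {f : Rˣ → V}
    (hf : SmoothOnUnits f) (g : Rˣ) (x y : R) : fd f g (x + y) = fd f g x + fd f g y := by
  set X : R := x * (g⁻¹ : Rˣ).val with hX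
  set Y : R := y * (g⁻¹ : Rˣ).val with hY
  have h := hasDerivAt_diagonal
    (F := fun p : ℝ × ℝ => f (expUnit (p.1 • X) * (expUnit (p.2 • Y) * g))) (t := 0)
    (hf.contDiff ((hπ.isUnitPlot_exp_smul contDiff_fst X).mul
      ((hπ.isUnitPlot_exp_smul contDiff_snd Y).mul (.const _))))
    (a := fd f g x) (b := fd f g y)
    (by simpa [hπ.expUnit_zero, flow] using hf.hasDerivAt_fd hπ g x)
    (by simpa [hπ.expUnit_zero, flow] using hf.hasDerivAt_fd hπ g y)
  have hc : IsUnitPlot fun s : ℝ => expUnit (s • X) * (expUnit (s • Y) * g) :=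
    (hπ.isUnitPlot_exp_smul contDiff_id X).mul
      ((hπ.isUnitPlot_exp_smul contDiff_id Y).mul (.const _))
  have hd := hasDerivAt_mul_curve (hπ.hasDerivAt_expUnit X)
    (hasDerivAt_mul_const_curve (hπ.hasDerivAt_expUnit Y) (g : R))
  have h2 := hf.hasDerivAt_comp hπ hc.curve (t := 0) (y := x + y) (by
    simpa [hπ.expUnit_zero, hX, hY, mul_assoc] using hd)
  have e : expUnit ((0 : ℝ) • X) * (expUnit ((0 : ℝ) • Y) * g) = g := by simp [hπ.expUnit_zero]
  rw [e] at h2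
  exact h2.unique h

theorem SmoothOnUnits.fd_smul (hπ : IsFrechetRep π) {f : Rˣ → V}
    (hf : SmoothOnUnits f) (g : Rˣ) (r : ℝ) (x : R) : fd f g (r • x) = r • fd f g x := by
  have h := (hf.hasDerivAt_fd hπ g x).scomp_of_eq (h := fun s : ℝ => s * r) 0
    ((hasDerivAt_id 0).mul_const r) (by simp)
  have e : (fun s => f (flow g (r • x) s)) = (fun t => f (flow g x t)) ∘ fun s : ℝ => s * r := by
    funext s
    simp [flow, smul_smul]
  rw [fd, e]
  simpa using h.deriv

/-- A linear map that is smooth along smooth curves commutes with derivatives of curves. -/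
theorem IsFrechetRep.hasDerivAt_linear (hπ : IsFrechetRep π) (l : R →ₗ[ℝ] V)
    (hl : ∀ x : ℝ → R, IsSmoothCurve x → ContDiff ℝ ∞ fun t => l (x t)) {x : ℝ → R} {y : R} {t : ℝ}
    (hx : IsSmoothCurve x) (hy : HasDerivAt x y t) : HasDerivAt (fun s => l (x s)) (l y) t := by
  have hxi := hπ.isSmoothCurve_iff.1 hx
  have hsh : ∀ i, ContDiff ℝ ∞ fun s => π i (x (t + s)) := fun i =>
    (hxi i).comp (contDiff_const.add contDiff_id)
  -- Hadamard's lemma in each component gives slopes that lift to a smooth curve `a` in `R` with `x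
  -- (t + s) = x t + s • a s` and `a 0 = y`. Linearity turns this into `l (x t) + s • l (a s)`,
  -- whose derivative at 0 needs only continuity of `l ∘ a`.
  choose z hz hz0 hzt using fun i => exists_contDiff_slope (hsh i)
  have hex : ∀ s, ∃ a, ∀ i, π i a = z i s := by
    intro s
    by_cases hs : s = 0
    · subst hs
      refine ⟨y, fun i => ?_⟩
      rw [hz0]
      have h := hπ.hasDerivAt_iff.1 hy i
      rw [show t = t + 0 by simp] at h
      exact (h.comp_const_add t 0).deriv.symm
    · refine ⟨s⁻¹ • (x (t + s) - x t), fun i => ?_⟩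
      rw [map_smul, map_sub, hzt i s]
      simp [smul_smul, inv_mul_cancel₀ hs]
  choose a ha using hex
  have hac : IsSmoothCurve a := hπ.isSmoothCurve_iff.2 fun i => by
    simpa only [ha] using hz i
  have hxa : ∀ s, x (t + s) = x t + s • a s := fun s => hπ.ext fun i => by
    rw [hzt i s, map_add, map_smul, ha]
    simp
  have ha0 : a 0 = y := hπ.ext fun i => by
    rw [ha, hz0]
    have h := hπ.hasDerivAt_iff.1 hy i
    rw [show t = t + 0 by simp] at h
    exact (h.comp_const_add t 0).deriv
  have h1 : HasDerivAt (fun s => l (x t) + s • l (a s)) (l y) 0 := by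
    have := ((hasDerivAt_id' (0 : ℝ)).fun_smul
      ((hl a hac).differentiable (by simp) 0).hasDerivAt).const_add (l (x t))
    simpa [ha0] using this
  have h2 := h1.scomp_of_eq (h := fun s => s - t) t ((hasDerivAt_id t).sub_const t) (by simp)
  rw [one_smul] at h2
  convert h2 using 1
  funext s
  have := hxa (s - t)
  rw [show t + (s - t) = s by ring] at this
  simp [this]

end Calculus

/-! ### The exterior derivative -/

section Alternating

theorem neg_one_pow_zsmul {N : Type*} [AddCommGroup N] [Module ℝ N] (k : ℕ) (v : N) :
    (-1 : ℤ) ^ k • v = (-1 : ℝ) ^ k • v := by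
  rcases Nat.even_or_odd k with h | h <;> simp [h.neg_one_pow]

/-- Moving the inserted vector to the front shows that each term depends on an ordered pair of
removed indices. Reversing the order keeps the remaining arguments and the vector `H a b`, and
changes the sign, so the terms cancel in pairs. -/
theorem sum_neg_one_pow_update_symmetric {M N : Type*} [AddCommGroup M] [Module ℝ M]
    [AddCommGroup N] [Module ℝ N] {q : ℕ} (β : M [⋀^Fin q]→ₗ[ℝ] N) (x : Fin (q + 1) → M)
    (H : Fin (q + 1) → Fin (q + 1) → M) (hH : ∀ a b, H a b = H b a) :
    ∑ i : Fin (q + 1), (-1 : ℝ) ^ (i : ℕ) •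
      ∑ j : Fin q, β (Function.update (i.removeNth x) j (H i (i.succAbove j))) = 0 := by
  rcases q with _ | q
  · simp
  have e : ∀ (i : Fin (q + 2)) (j : Fin (q + 1)),
      β (Function.update (i.removeNth x) j (H i (i.succAbove j))) = (-1 : ℝ) ^ (j : ℕ) •
        β (Matrix.vecCons (H i (i.succAbove j)) (j.removeNth (i.removeNth x))) := by
    intro i j
    rw [← Fin.insertNth_removeNth, AlternatingMap.map_insertNth, neg_one_pow_zsmul]
  simp only [e, Finset.smul_sum, smul_smul, ← pow_add]
  rw [← Finset.sum_product' (f := fun (i : Fin (q + 2)) (j : Fin (q + 1)) =>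
    (-1 : ℝ) ^ ((i : ℕ) + j) •
      β (Matrix.vecCons (H i (i.succAbove j)) (j.removeNth (i.removeNth x))))]
  refine Finset.sum_involution (fun p _ => (p.1.succAbove p.2, p.2.predAbove p.1)) ?_ ?_ ?_ ?_
  · rintro ⟨i, j⟩ _
    dsimp only
    rw [Fin.neg_one_pow_succAbove_add_predAbove, Fin.succAbove_succAbove_predAbove, hH _ i,
      Fin.removeNth_removeNth_eq_swap x j i]
    simp
  · rintro ⟨i, j⟩ _ _ e
    exact Fin.succAbove_ne i j (congrArg Prod.fst e)
  · simp
  · rintro ⟨i, j⟩ _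
    simp [Fin.succAbove_succAbove_predAbove, Fin.predAbove_predAbove_succAbove]

end Alternating

/-! ### Existence and naturality of the exterior derivative -/

section Forms

variable {R : Type u} [Ring R] [Algebra ℝ R] [TopologicalSpace R] [IsTopologicalRing R]
  [ContinuousSMul ℝ R]
variable {B : ℕ → Type*} [∀ i, NormedRing (B i)] [∀ i, NormedAlgebra ℝ (B i)]
  [∀ i, CompleteSpace (B i)]
variable {π : ∀ i, R →ₐ[ℝ] B i}
variable {V : Type v} [NormedAddCommGroup V] [NormedSpace ℝ V]
variable {E : Type*} [NormedAddCommGroup E] [NormedSpace ℝ E]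
variable {p q : ℕ} {α : RawForm R V p q}

theorem IsFrechetRep.unique (hπ : IsFrechetRep π) {γ : ℝ → R} {x y : R} {t : ℝ}
    (hx : HasDerivAt γ x t) (hy : HasDerivAt γ y t) : x = y :=
  hπ.ext fun i => (hπ.hasDerivAt_iff.1 hx i).unique (hπ.hasDerivAt_iff.1 hy i)

theorem IsSmoothForm.contDiff (hα : IsSmoothForm α) [CompleteSpace V] [FiniteDimensional ℝ E]
    {h : Fin p → E → Rˣ} {c : E → Rˣ} {x : Fin q → E → R} (hh : ∀ j, IsUnitPlot (h j))
    (hc : IsUnitPlot c) (hx : ∀ i, IsPlot (x i)) :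
    ContDiff ℝ ∞ fun u => α (fun j => h j u) (c u) (fun i => x i u) :=
  CurveSmooth.contDiff fun s hs => hα _ _ _ (fun j => hh j s hs) (hc s hs) fun i => hx i s hs

theorem IsSmoothForm.smoothOnUnits (hα : IsSmoothForm α) (h : Fin p → Rˣ) (x : Fin q → R) :
    SmoothOnUnits fun g => α h g x := fun c hc =>
  hα (fun j _ => h j) c (fun i _ => x i) (fun _ => .const _) hc fun _ => .const _

/-- The derivative of `α` along a tangent vector. -/
def formDeriv (α : RawForm R V p q) (h : Fin p → Rˣ) (g : Rˣ) (x : Fin q → R) (y : R) : V :=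
  fd (fun g => α h g x) g y

theorem IsSmoothForm.contDiff_formDeriv (hα : IsSmoothForm α) (hπ : IsFrechetRep π)
    [CompleteSpace V] [FiniteDimensional ℝ E]
    {h : Fin p → E → Rˣ} {c : E → Rˣ} {x : Fin q → E → R} {y : E → R} (hh : ∀ j, IsUnitPlot (h j))
    (hc : IsUnitPlot c) (hx : ∀ i, IsPlot (x i)) (hy : IsPlot y) :
    ContDiff ℝ ∞ fun u => formDeriv α (fun j => h j u) (c u) (fun i => x i u) (y u) := by
  have h1 := hα.contDiff (E := E × ℝ) (fun j => (hh j).comp contDiff_fst)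
    (hπ.isUnitPlot_flow (hc.comp contDiff_fst) (hy.comp contDiff_fst) contDiff_snd)
    fun i => (hx i).comp contDiff_fst
  exact (contDiff_deriv_right (F := fun u t => α (fun j => h j u) (flow (c u) (y u) t)
    (fun i => x i u)) h1).comp (contDiff_id.prodMk contDiff_const)

/-- The base point and each of the `q` arguments receive their own time variable. By Boman's theorem
the resulting function on `ℝ × ℝ^q` is smooth, so the derivative along the diagonal is the sum of
the partial ones. `hasDerivAt_linear` identifies those in the arguments. -/
theorem IsSmoothForm.hasDerivAt (hα : IsSmoothForm α) (hπ : IsFrechetRep π) [CompleteSpace V]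
    (h : Fin p → Rˣ) {c : ℝ → Rˣ} {x : Fin q → ℝ → R} (hc : IsSmoothUnitCurve c)
    (hx : ∀ i, IsSmoothCurve (x i)) {t : ℝ} {y : R} {x' : Fin q → R}
    (hy : HasDerivAt (fun s => (c s : R)) y t) (hx' : ∀ i, HasDerivAt (x i) (x' i) t) :
    HasDerivAt (fun s => α h (c s) (fun i => x i s))
      (formDeriv α h (c t) (fun i => x i t) y +
        ∑ j, α h (c t) (Function.update (fun i => x i t) j (x' j))) t := by
  let F : ℝ × (Fin q → ℝ) → V := fun p => α h (c p.1) (fun i => x i (p.2 i))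
  have hF : ContDiff ℝ ∞ F := hα.contDiff (h := fun j _ => h j) (fun j => .const _)
    (hπ.isUnitPlot_of_curve hc contDiff_fst) fun i => (hπ.isPlot_curve (hx i)).comp (by fun_prop)
  have hd := (hF.differentiable (by simp) (t, fun _ => t)).hasFDerivAt
  have h0 := hd.comp_hasDerivAt (f := fun s => (s, fun _ => s)) t
    ((hasDerivAt_id' t).prodMk (hasDerivAt_pi.2 fun _ => hasDerivAt_id' t))
  have h1 := hd.comp_hasDerivAt (f := fun s => (s, fun _ => t)) t
    ((hasDerivAt_id' t).prodMk (hasDerivAt_const t _))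
  have h2 : ∀ j, HasDerivAt (fun s => F (t, Function.update (fun _ => t) j s))
      (fderiv ℝ F (t, fun _ => t) (0, Pi.single j 1)) t := by
    intro j
    have h3 := (hasDerivAt_const t t).prodMk (hasDerivAt_update (fun _ : Fin q => t) j t)
    exact hd.comp_hasDerivAt_of_eq (f := fun s => (t, Function.update (fun _ => t) j s)) t h3
      (by simp)
  have e1 := ((hα.smoothOnUnits h fun i => x i t).hasDerivAt_comp hπ hc hy).unique h1
  have e2 : ∀ j, α h (c t) (Function.update (fun i => x i t) j (x' j)) =
      fderiv ℝ F (t, fun _ => t) (0, Pi.single j 1) := by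
    intro j
    let l : R →ₗ[ℝ] V := (α h (c t)).toMultilinearMap.toLinearMap (fun i => x i t) j
    have hl : ∀ z : ℝ → R, IsSmoothCurve z → ContDiff ℝ ∞ fun s => l (z s) := by
      intro z hz
      refine hα (fun j _ => h j) (fun _ => c t)
        (fun k s => Function.update (fun i => x i t) j (z s) k) (fun _ => .const _) (.const _)
        fun k => ?_
      by_cases hk : k = j
      · subst hk
        simpa using hz
      · simpa [hk] using IsSmoothCurve.const _
    have h4 := hπ.hasDerivAt_linear l hl (hx j) (hx' j)
    refine h4.unique ?_
    convert h2 j using 1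
    funext s
    change α h (c t) (Function.update (fun i => x i t) j (x j s)) = α h (c t) _
    congr 1
    funext k
    by_cases hk : k = j
    · subst hk
      simp
    · simp [hk]
  have e3 : ((1 : ℝ), fun _ : Fin q => (1 : ℝ)) =
      (1, 0) + ∑ j, ((0 : ℝ), (Pi.single j 1 : Fin q → ℝ)) := by
    ext
    · simp [Prod.fst_sum]
    · simp [Prod.snd_sum, Finset.sum_apply, Pi.single_apply]
  have e4 : formDeriv α h (c t) (fun i => x i t) y = fderiv ℝ F (t, fun _ => t) (1, 0) := e1
  rw [e4]
  simp only [e2]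
  rw [← map_sum, ← map_add, ← e3]
  exact h0

/-- Naturality of the exterior derivative with respect to plots. -/
theorem IsSmoothForm.extDeriv_apply (hα : IsSmoothForm α) (hπ : IsFrechetRep π) [CompleteSpace V]
    [FiniteDimensional ℝ E] {η : RawForm R V p (q + 1)} (hη : IsExtDeriv α η)
    (h : Fin p → Rˣ) {Ψ : E → Rˣ} (hΨ : IsUnitPlot Ψ) (v : Fin (q + 1) → E) (u : E) :
    η h (Ψ u) (fun i => pd (fun u => (Ψ u : R)) (v i) u) =
      ∑ i : Fin (q + 1), (-1 : ℝ) ^ (i : ℕ) • fderiv ℝ (fun u => α h (Ψ u)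
        (i.removeNth fun j => pd (fun u => (Ψ u : R)) (v j) u)) u (v i) := by
  obtain ⟨y, hy, e⟩ := hη h (Ψ u) (fun i => pd (fun u => (Ψ u : R)) (v i) u)
  have hpd : ∀ w, IsPlot (pd (fun u => (Ψ u : R)) w) := hπ.isPlot_pd hΨ.val
  -- Differentiating the pullback also differentiates the tangent vectors of the plot. The extra
  -- terms contain mixed second derivatives, which are symmetric, and cancel in the alternating sum.
  have key : ∀ i : Fin (q + 1), fderiv ℝ (fun u => α h (Ψ u)
      (i.removeNth fun j => pd (fun u => (Ψ u : R)) (v j) u)) u (v i) = y i +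
      ∑ j, α h (Ψ u) (Function.update (i.removeNth fun j => pd (fun u => (Ψ u : R)) (v j) u) j
        (pd (pd (fun u => (Ψ u : R)) (v (i.succAbove j))) (v i) u)) := by
    intro i
    have hc : ContDiff ℝ ∞ fun u => α h (Ψ u)
        (i.removeNth fun j => pd (fun u => (Ψ u : R)) (v j) u) :=
      hα.contDiff (h := fun j _ => h j) (fun j => .const _) hΨ fun j => hpd _
    have h1 := hα.hasDerivAt hπ h (hΨ _ (contDiff_line u (v i)))
      (x := fun j t => pd (fun u => (Ψ u : R)) (v (i.succAbove j)) (u + t • v i))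
      (fun j => hpd _ _ (contDiff_line u (v i))) (t := 0)
      (hΨ.val.hasDerivAt_pd (v i) u) (fun j => (hpd (v (i.succAbove j))).hasDerivAt_pd (v i) u)
    have h2 := (hasDerivAt_fderiv_line hc u (v i)).unique h1
    rw [h2]
    simp only [zero_smul, add_zero]
    congr 1
    exact (((hα.smoothOnUnits h _).hasDerivAt_fd hπ _ _).unique (hy i))
  simp only [key, smul_add, Finset.sum_add_distrib]
  rw [e, sum_neg_one_pow_update_symmetric (α h (Ψ u)) _
    (fun a b => pd (pd (fun u => (Ψ u : R)) (v b)) (v a) u)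
    (fun a b => hπ.pd_comm hΨ.val _ _ _), add_zero]

/-- The curve `exp(∑ uᵢ xᵢ g⁻¹) g`, a plot through `g` with tangent vectors `xᵢ`. -/
def coordPlot {q : ℕ} (g : Rˣ) (x : Fin q → R) (u : Fin q → ℝ) : Rˣ :=
  expUnit (∑ i, u i • (x i * (g⁻¹ : Rˣ).val)) * g

theorem IsFrechetRep.isPlot_sum (hπ : IsFrechetRep π) [FiniteDimensional ℝ E] {ι : Type*}
    (s : Finset ι) {Ψ : ι → E → R} (h : ∀ i, IsPlot (Ψ i)) : IsPlot fun u => ∑ i ∈ s, Ψ i u := by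
  rw [hπ.isPlot_iff]
  intro i
  simp only [map_sum]
  exact ContDiff.sum fun j _ => hπ.isPlot_iff.1 (h j) i

theorem IsFrechetRep.isUnitPlot_coordPlot (hπ : IsFrechetRep π) (g : Rˣ) (x : Fin q → R) :
    IsUnitPlot (coordPlot g x) := by
  refine (hπ.isUnitPlot_expUnit (hπ.isPlot_sum _ fun i => hπ.isPlot_smul ?_ (.const _))).mul
    (.const g)
  fun_prop

theorem IsFrechetRep.coordPlot_zero (hπ : IsFrechetRep π) (g : Rˣ) (x : Fin q → R) :
    coordPlot g x 0 = g := by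
  simp [coordPlot, hπ.expUnit_zero]

theorem IsFrechetRep.pd_coordPlot (hπ : IsFrechetRep π) (g : Rˣ) (x : Fin q → R) (i : Fin q) :
    pd (fun u => (coordPlot g x u : R)) (Pi.single i 1) 0 = x i := by
  refine hπ.unique ((hπ.isUnitPlot_coordPlot g x).val.hasDerivAt_pd _ _) ?_
  have h := hasDerivAt_mul_const_curve (hπ.hasDerivAt_expUnit (x i * (g⁻¹ : Rˣ).val)) (g : R)
  have e : (fun t : ℝ => (coordPlot g x (0 + t • Pi.single i 1) : R)) =
      fun t : ℝ => (expUnit (t • (x i * (g⁻¹ : Rˣ).val)) : R) * g := by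
    funext t
    simp [coordPlot, Pi.single_apply, ite_smul]
  rw [e]
  simpa [mul_assoc] using h

/-- The given vectors are realised as coordinate vectors of a plot. By naturality the claim becomes
`d² = 0` on `ℝ^(q+2)`, where symmetry of second derivatives cancels the terms in pairs. -/
theorem IsSmoothForm.extDeriv_extDeriv (hα : IsSmoothForm α) (hπ : IsFrechetRep π) [CompleteSpace V]
    {η : RawForm R V p (q + 1)} (hη : IsExtDeriv α η) (hηs : IsSmoothForm η)
    {θ : RawForm R V p (q + 2)} (hθ : IsExtDeriv η θ) : θ = 0 := by
  funext h g
  ext x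
  let Ψ := coordPlot g x
  have hΨ : IsUnitPlot Ψ := hπ.isUnitPlot_coordPlot g x
  have hpd : ∀ w, IsPlot (pd (fun u => (Ψ u : R)) w) := hπ.isPlot_pd hΨ.val
  have h1 := hηs.extDeriv_apply hπ hθ h hΨ (fun i => Pi.single i 1) 0
  have e0 : (fun i => pd (fun u => (Ψ u : R)) (Pi.single i 1) 0) = x :=
    funext fun i => hπ.pd_coordPlot g x i
  rw [e0, show Ψ 0 = g from hπ.coordPlot_zero g x] at h1
  rw [h1]
  let A : Fin (q + 2) → Fin (q + 1) → (Fin (q + 2) → ℝ) → V := fun i j u => α h (Ψ u)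
    (j.removeNth (i.removeNth fun k => pd (fun u => (Ψ u : R)) (Pi.single k 1) u))
  have hA : ∀ i j, ContDiff ℝ ∞ (A i j) := fun i j =>
    hα.contDiff (h := fun j _ => h j) (fun j => .const _) hΨ fun k => hpd _
  have h2 : ∀ (i : Fin (q + 2)), (fun u => η h (Ψ u)
      (i.removeNth fun k => pd (fun u => (Ψ u : R)) (Pi.single k 1) u)) = fun u =>
      ∑ j : Fin (q + 1), (-1 : ℝ) ^ (j : ℕ) •
        fderiv ℝ (A i j) u (Pi.single (i.succAbove j) 1) := by
    intro i
    funext u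
    exact hα.extDeriv_apply hπ hη h hΨ (fun j => Pi.single (i.succAbove j) 1) u
  have hA1 : ∀ i j w, ContDiff ℝ ∞ fun u => fderiv ℝ (A i j) u w := fun i j w =>
    contDiff_fderiv_apply (hA i j) w
  have h3 : ∀ i : Fin (q + 2), fderiv ℝ (fun u => η h (Ψ u)
      (i.removeNth fun k => pd (fun u => (Ψ u : R)) (Pi.single k 1) u)) 0 (Pi.single i 1) =
      ∑ j : Fin (q + 1), (-1 : ℝ) ^ (j : ℕ) •
        fderiv ℝ (fun u => fderiv ℝ (A i j) u (Pi.single (i.succAbove j) 1)) 0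
          (Pi.single i 1) := by
    intro i
    rw [h2]
    rw [fderiv_fun_sum (A := fun (j : Fin (q + 1)) u => (-1 : ℝ) ^ (j : ℕ) •
      fderiv ℝ (A i j) u (Pi.single (i.succAbove j) 1)) fun j _ =>
      ((hA1 i j _).differentiable (by simp) 0).const_smul _]
    simp only [_root_.sum_apply]
    refine Finset.sum_congr rfl fun j _ => ?_
    rw [fderiv_fun_const_smul ((hA1 i j _).differentiable (by simp) 0)]
    rfl
  simp only [h3, Finset.smul_sum, smul_smul, ← pow_add]
  rw [← Finset.sum_product' (f := fun (i : Fin (q + 2)) (j : Fin (q + 1)) =>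
    (-1 : ℝ) ^ ((i : ℕ) + j) •
      fderiv ℝ (fun u => fderiv ℝ (A i j) u (Pi.single (i.succAbove j) 1)) 0 (Pi.single i 1))]
  refine Finset.sum_involution (fun p _ => (p.1.succAbove p.2, p.2.predAbove p.1)) ?_ ?_ ?_ ?_
  · rintro ⟨i, j⟩ _
    dsimp only
    have hAA : A (i.succAbove j) (j.predAbove i) = A i j := by
      funext u
      simp only [A]
      rw [← Fin.removeNth_removeNth_eq_swap]
    rw [Fin.neg_one_pow_succAbove_add_predAbove, Fin.succAbove_succAbove_predAbove, hAA,
      fderiv_fderiv_comm (hA i j)]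
    simp
  · rintro ⟨i, j⟩ _ _ e
    exact Fin.succAbove_ne i j (congrArg Prod.fst e)
  · simp
  · rintro ⟨i, j⟩ _
    simp [Fin.succAbove_succAbove_predAbove, Fin.predAbove_predAbove_succAbove]

theorem IsSmoothForm.hasDerivAt_formDeriv (hα : IsSmoothForm α) (hπ : IsFrechetRep π)
    (h : Fin p → Rˣ) (g : Rˣ) (x : Fin q → R) (y : R) :
    HasDerivAt (fun t => α h (flow g y t) x) (formDeriv α h g x y) 0 :=
  (hα.smoothOnUnits h x).hasDerivAt_fd hπ g y

/-- The directional derivative is alternating in the old arguments, by uniqueness of derivatives,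
and linear in the new direction by `fd_add` and `fd_smul`. Its alternation is the exterior
derivative. -/
theorem IsSmoothForm.exists_extDeriv (hα : IsSmoothForm α) (hπ : IsFrechetRep π)
    [CompleteSpace V] : ∃ η : RawForm R V p (q + 1), IsExtDeriv α η := by
  let L : (Fin p → Rˣ) → Rˣ → R →ₗ[ℝ] R [⋀^Fin q]→ₗ[ℝ] V := fun h g =>
    { toFun := fun y =>
        { toFun := fun x => formDeriv α h g x y
          map_update_add' := fun x i a b => by
            refine (hα.hasDerivAt_formDeriv hπ h g _ y).unique ?_
            simp only [AlternatingMap.map_update_add]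
            exact (hα.hasDerivAt_formDeriv hπ h g _ y).add (hα.hasDerivAt_formDeriv hπ h g _ y)
          map_update_smul' := fun x i r a => by
            refine (hα.hasDerivAt_formDeriv hπ h g _ y).unique ?_
            simp only [AlternatingMap.map_update_smul]
            exact (hα.hasDerivAt_formDeriv hπ h g _ y).const_smul r
          map_eq_zero_of_eq' := fun x i j e hij => by
            refine (hα.hasDerivAt_formDeriv hπ h g _ y).unique ?_
            simp only [(α h _).map_eq_zero_of_eq x e hij]
            exact hasDerivAt_const _ _ }
      map_add' := fun y z => by
        ext x
        exact (hα.smoothOnUnits h x).fd_add hπ g y z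
      map_smul' := fun r y => by
        ext x
        exact (hα.smoothOnUnits h x).fd_smul hπ g r y }
  refine ⟨fun h g => AlternatingMap.alternatizeUncurryFin (L h g), fun h g x =>
    ⟨fun i => formDeriv α h g (i.removeNth x) (x i),
      fun i => hα.hasDerivAt_formDeriv hπ h g _ _, ?_⟩⟩
  rw [AlternatingMap.alternatizeUncurryFin_apply]
  exact Finset.sum_congr rfl fun i _ => neg_one_pow_zsmul _ _

theorem IsSmoothForm.extDeriv_eq (hα : IsSmoothForm α) (hπ : IsFrechetRep π)
    {η : RawForm R V p (q + 1)} (hη : IsExtDeriv α η) (h : Fin p → Rˣ) (g : Rˣ)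
    (x : Fin (q + 1) → R) : η h g x =
      ∑ i : Fin (q + 1), (-1 : ℝ) ^ (i : ℕ) • formDeriv α h g (i.removeNth x) (x i) := by
  obtain ⟨y, hy, e⟩ := hη h g x
  rw [e]
  exact Finset.sum_congr rfl fun i _ => by
    rw [(hy i).unique (hα.hasDerivAt_formDeriv hπ h g _ _)]

theorem IsSmoothForm.extDeriv_smooth (hα : IsSmoothForm α) (hπ : IsFrechetRep π)
    [CompleteSpace V] {η : RawForm R V p (q + 1)} (hη : IsExtDeriv α η) : IsSmoothForm η := by
  intro h c x hh hc hx
  simp only [hα.extDeriv_eq hπ hη]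
  refine ContDiff.sum fun i _ => ContDiff.const_smul _ ?_
  exact hα.contDiff_formDeriv hπ (fun j => hπ.isUnitPlot_curve (hh j)) (hπ.isUnitPlot_curve hc)
    (x := fun k => x (i.succAbove k)) (fun k => hπ.isPlot_curve (hx _)) (hπ.isPlot_curve (hx i))

/-- Invariance is inherited directly. For a vertical vector `b g` with `b` the velocity of a curve
`k` in `K`, naturality is used on the plot `(s, u) ↦ k(s) * coordPlot g x u`. The term
differentiating in `s` vanishes because the coefficient is independent of `s` by invariance. In
every other term one argument is vertical throughout, so the function differentiated is zero. -/
theorem IsSmoothForm.extDeriv_basic (hα : IsSmoothForm α) (hπ : IsFrechetRep π)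
    [CompleteSpace V] {K : Subgroup Rˣ} (hb : IsBasicForm K α) {η : RawForm R V p (q + 1)}
    (hη : IsExtDeriv α η) : IsBasicForm K η := by
  refine ⟨fun h g k hk x => ?_, fun h g x i b hbK hx => ?_⟩
  · rw [hα.extDeriv_eq hπ hη, hα.extDeriv_eq hπ hη]
    refine Finset.sum_congr rfl fun i _ => ?_
    congr 1
    have h1 := (hα.smoothOnUnits h (i.removeNth fun j => (k : R) * x j)).hasDerivAt_comp hπ
      ((IsSmoothUnitCurve.const k).mul' (hπ.isSmoothUnitCurve_flow g (x i))) (t := 0)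
      (by simpa using hasDerivAt_const_mul_curve (hπ.hasDerivAt_flow g (x i)) (k : R))
    rw [hπ.flow_zero] at h1
    refine h1.unique ?_
    have h2 := hα.hasDerivAt_formDeriv hπ h g (i.removeNth x) (x i)
    convert h2 using 1
    funext t
    exact hb.1 h _ k hk (i.removeNth x)
  · obtain ⟨k, hk, hkK, hk0, hkb⟩ := hbK
    let Ψ : ℝ × (Fin (q + 1) → ℝ) → Rˣ := fun p => k p.1 * coordPlot g x p.2
    have hψ : IsUnitPlot (coordPlot g x) := hπ.isUnitPlot_coordPlot g x
    have hΨ : IsUnitPlot Ψ :=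
      (hπ.isUnitPlot_of_curve hk contDiff_fst).mul (hψ.comp contDiff_snd)
    let v : Fin (q + 1) → ℝ × (Fin (q + 1) → ℝ) :=
      fun j => if j = i then (1, 0) else (0, Pi.single j 1)
    have hΨ0 : Ψ (0, 0) = g := by simp [Ψ, hk0, hπ.coordPlot_zero]
    have hvert : ∀ s u, ∃ b ∈ lieAlgebraOf K,
        pd (fun p => (Ψ p : R)) (1, 0) (s, u) = b * Ψ (s, u) := by
      intro s u
      have hks : IsSmoothUnitCurve fun t => k (s + t) * (k s)⁻¹ :=
        (((hπ.isUnitPlot_of_curve hk (by fun_prop : ContDiff ℝ ∞ fun t : ℝ => s + t))).mul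
          (.const _)).curve
      refine ⟨_, ⟨_, hks, fun t => K.mul_mem (hkK _) (K.inv_mem (hkK s)), by simp,
        hks.val.hasDerivAt 0⟩, ?_⟩
      refine hπ.unique (hΨ.val.hasDerivAt_pd _ _) ?_
      have h1 := hasDerivAt_mul_const_curve (hks.val.hasDerivAt 0) (Ψ (s, u) : R)
      convert h1 using 1
      funext t
      simp only [Ψ, Prod.mk_add_mk, Prod.smul_mk, smul_eq_mul, mul_one, smul_zero, add_zero]
      rw [← Units.val_mul]
      congr 1
      group
    have hhor : ∀ j s u, pd (fun p => (Ψ p : R)) (0, Pi.single j 1) (s, u) =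
        k s * pd (fun u => (coordPlot g x u : R)) (Pi.single j 1) u := by
      intro j s u
      refine hπ.unique (hΨ.val.hasDerivAt_pd _ _) ?_
      have h1 := hasDerivAt_const_mul_curve (hψ.val.hasDerivAt_pd (Pi.single j 1) u) (k s : R)
      convert h1 using 1
      funext t
      simp [Ψ]
    have hx0 : (fun j => pd (fun p => (Ψ p : R)) (v j) (0, 0)) = x := by
      funext j
      by_cases hj : j = i
      · subst hj
        simp only [v, if_true]
        rw [hx]
        refine hπ.unique (hΨ.val.hasDerivAt_pd _ _) ?_
        have h1 := hasDerivAt_mul_const_curve hkb (g : R)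
        convert h1 using 1
        funext t
        simp [Ψ, hπ.coordPlot_zero]
      · simp only [v, if_neg hj]
        rw [hhor, hk0, hπ.pd_coordPlot]
        simp
    have h1 := hα.extDeriv_apply hπ hη h hΨ v (0, 0)
    rw [hx0, hΨ0] at h1
    rw [h1]
    refine Finset.sum_eq_zero fun j _ => ?_
    by_cases hj : j = i
    · subst hj
      have hc : ContDiff ℝ ∞ fun p => α h (Ψ p)
          (j.removeNth fun l => pd (fun p => (Ψ p : R)) (v l) p) :=
        hα.contDiff (h := fun j _ => h j) (fun j => .const _) hΨ fun l => hπ.isPlot_pd hΨ.val _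
      have h2 := hasDerivAt_fderiv_line hc (0, 0) (v j)
      have h3 : (fun t : ℝ => α h (Ψ ((0, 0) + t • v j))
          (j.removeNth fun l => pd (fun p => (Ψ p : R)) (v l) ((0, 0) + t • v j))) =
          fun _ => α h (coordPlot g x 0)
            (j.removeNth fun l => pd (fun u => (coordPlot g x u : R)) (Pi.single l 1) 0) := by
        funext t
        rw [← hb.1 h (coordPlot g x 0) (k t) (hkK t)]
        simp only [v, if_true, Prod.smul_mk, smul_eq_mul, mul_one, smul_zero, Prod.mk_add_mk,
          zero_add, add_zero]
        refine congrArg (α h (k t * coordPlot g x 0)) (funext fun l => ?_)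
        rw [Fin.removeNth_apply, Fin.removeNth_apply, if_neg (Fin.succAbove_ne j l), hhor]
      rw [h3] at h2
      rw [h2.unique (hasDerivAt_const _ _), smul_zero]
    · obtain ⟨l, hl⟩ := Fin.exists_succAbove_eq (Ne.symm hj)
      have h3 : (fun p => α h (Ψ p)
          (j.removeNth fun l => pd (fun p => (Ψ p : R)) (v l) p)) = fun _ => 0 := by
        funext ⟨s, u⟩
        obtain ⟨b', hb', e⟩ := hvert s u
        refine hb.2 h _ _ l b' hb' ?_
        have hvl : v (j.succAbove l) = (1, 0) := if_pos hl
        rw [Fin.removeNth_apply, hvl, e]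
      rw [h3]
      simp

/-- The homotopy operators below are given by integrals. By this lemma, only smoothness and
basicness of the integrals have to be checked. -/
theorem IsFrechetRep.mem_deRham (hπ : IsFrechetRep π) [CompleteSpace V] {K : Subgroup Rˣ}
    (hα : α ∈ smoothForms V K p q) : α ∈ deRham V K p q := by
  have hs : IsSmoothForm α := hα.1
  have hb : IsBasicForm K α := hα.2
  obtain ⟨η, hη⟩ := hs.exists_extDeriv hπ
  have hηs := hs.extDeriv_smooth hπ hη
  obtain ⟨θ, hθ⟩ := hηs.exists_extDeriv hπ
  refine ⟨hα, η, ⟨hηs, hs.extDeriv_basic hπ hb hη⟩, hη, ?_⟩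
  rw [hs.extDeriv_extDeriv hπ hη hηs hθ] at hθ
  exact hθ

end Forms

/-! ### Exactness of the rows: averaging over `K` -/

section Rows

open MeasureTheory

variable {R : Type u} [Ring R] [Algebra ℝ R] [TopologicalSpace R] [IsTopologicalRing R]
  [ContinuousSMul ℝ R]
variable {B : ℕ → Type*} [∀ i, NormedRing (B i)] [∀ i, NormedAlgebra ℝ (B i)]
  [∀ i, CompleteSpace (B i)]
variable {π : ∀ i, R →ₐ[ℝ] B i}
variable {V : Type v} [NormedAddCommGroup V] [NormedSpace ℝ V]
variable {E : Type*} [NormedAddCommGroup E] [NormedSpace ℝ E]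

/-- The integral of a family of alternating maps. -/
def integralForm {X : Type*} [MeasurableSpace X] (μ : Measure X) {q : ℕ}
    (β : X → R [⋀^Fin q]→ₗ[ℝ] V) (hβ : ∀ x, Integrable (fun k => β k x) μ) :
    R [⋀^Fin q]→ₗ[ℝ] V where
  toFun x := ∫ k, β k x ∂μ
  map_update_add' x i a b := by
    simp only [AlternatingMap.map_update_add]
    exact integral_add (hβ _) (hβ _)
  map_update_smul' x i r a := by
    simp only [AlternatingMap.map_update_smul]
    exact integral_smul _ _
  map_eq_zero_of_eq' x i j e hij := by
    simp only [(β _).map_eq_zero_of_eq x e hij]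
    exact integral_zero _ _

variable {L : Type*} [Group L] [TopologicalSpace L]

variable (E) in
/-- Around each point of `L` there is a parametrisation that is smooth as a map to `Rˣ`. -/
def HasSmoothPlots (ι : L →* Rˣ) : Prop :=
  ∀ k₀ : L, ∃ ψ : E → L, ψ 0 = k₀ ∧ 𝓝 k₀ ≤ Filter.map ψ (𝓝 0) ∧ IsUnitPlot fun u => ι (ψ u)

/-- The condition on neighbourhoods says that a plot is onto near `k₀` in the sense of filters.
Limits at `k₀` can therefore be computed in the parameter space; neither injectivity nor a chart is
required. -/
theorem HasSmoothPlots.continuous_prod {ι : L →* Rˣ} (hι : HasSmoothPlots E ι)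
    {F : L → ℝ → V} (hF : ∀ ψ : E → L, (IsUnitPlot fun u => ι (ψ u)) →
      Continuous fun p : E × ℝ => F (ψ p.1) p.2) : Continuous fun p : L × ℝ => F p.1 p.2 := by
  refine continuous_iff_continuousAt.2 ?_
  rintro ⟨k₀, t₀⟩
  obtain ⟨ψ, hψ0, hψ, hs⟩ := hι k₀
  have h1 := (hF ψ hs).tendsto (0, t₀)
  have h2 : 𝓝 (k₀, t₀) ≤ Filter.map (Prod.map ψ id) (𝓝 ((0 : E), t₀)) := by
    rw [nhds_prod_eq, nhds_prod_eq, ← Filter.prod_map_map_eq', Filter.map_id]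
    exact Filter.prod_mono_left _ hψ
  refine Filter.Tendsto.mono_left ?_ h2
  rw [Filter.tendsto_map'_iff]
  simpa [hψ0] using! h1

theorem HasSmoothPlots.continuous {ι : L →* Rˣ} (hι : HasSmoothPlots E ι)
    {F : L → V} (hF : ∀ ψ : E → L, (IsUnitPlot fun u => ι (ψ u)) →
      ContDiff ℝ ∞ fun u : E => F (ψ u)) : Continuous F :=
  (hι.continuous_prod (F := fun k _ => F k) fun ψ hψ =>
    (hF ψ hψ).continuous.comp continuous_fst).comp (continuous_id.prodMk
      (continuous_const (y := 0)))

variable [CompactSpace L] [SecondCountableTopology L] [MeasurableSpace L] [BorelSpace L]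

theorem HasSmoothPlots.integrable {ι : L →* Rˣ} (hι : HasSmoothPlots E ι) (μ : Measure L)
    [IsFiniteMeasure μ] {F : L → V} (hF : ∀ ψ : E → L, (IsUnitPlot fun u => ι (ψ u)) →
      ContDiff ℝ ∞ fun u : E => F (ψ u)) : Integrable F μ := by
  have h := hι.continuous hF
  obtain ⟨b, hb⟩ := isCompact_univ.exists_bound_of_continuousOn h.continuousOn
  exact Integrable.of_bound h.aestronglyMeasurable b
    (Filter.Eventually.of_forall fun k => hb k (Set.mem_univ k))

theorem HasSmoothPlots.contDiff_integral {ι : L →* Rˣ} (hι : HasSmoothPlots E ι) (μ : Measure L)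
    [IsFiniteMeasure μ] {F : L → ℝ → V} (hF : ∀ ψ : E → L, (IsUnitPlot fun u => ι (ψ u)) →
      ContDiff ℝ ∞ fun p : E × ℝ => F (ψ p.1) p.2) :
    ContDiff ℝ ∞ fun t => ∫ k, F k t ∂μ := by
  have h := contDiff_setIntegral μ (C := (Set.univ : Set L)) isCompact_univ MeasurableSet.univ
    (F := F) (fun k => ?_) fun n => ?_
  · simpa using h
  · exact (hF (fun _ => k) (.const _)).comp ((contDiff_const (c := (0 : E))).prodMk contDiff_id)
  · exact hι.continuous_prod (F := fun k => iteratedDeriv n (F k)) fun ψ hψ =>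
      (contDiff_iteratedDeriv_right (F := fun u => F (ψ u)) (hF ψ hψ) n).continuous

variable {m q : ℕ}

theorem IsUnitPlot.cons {p : ℕ} {c : E → Rˣ} {h : Fin p → E → Rˣ} (hc : IsUnitPlot c)
    (hh : ∀ j, IsUnitPlot (h j)) (j : Fin (p + 1)) :
    IsUnitPlot fun u => (Fin.cons (c u) (fun j => h j u) : Fin (p + 1) → Rˣ) j := by
  refine Fin.cases ?_ (fun j => ?_) j
  · simpa using hc
  · simpa using hh j

/-- Averaging over `K = ι(L)` provides a contracting homotopy of the rows. -/
theorem exists_bicomplexδ_eq (hπ : IsFrechetRep π) [CompleteSpace V] [FiniteDimensional ℝ E]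
    {ι : L →* Rˣ} (hι : HasSmoothPlots E ι) (μ : Measure L) [IsProbabilityMeasure μ]
    [ContinuousMul L] [μ.IsMulLeftInvariant] (x : bicomplex V ι.range (m + 1) q)
    (hx : bicomplexδ ι.range (m + 1) q x = 0) :
    ∃ w : bicomplex V ι.range m q, bicomplexδ ι.range m q w = x := by
  obtain ⟨α, hα⟩ := x
  have hs : IsSmoothForm α := hα.1.1.1
  have hb : IsBasicForm ι.range α := hα.1.1.2
  have hinv : IsInvariantForm α := hα.2.1
  have hdeg : ∀ (h : Fin (m + 2) → Rˣ) (j : Fin (m + 1)), h j.castSucc = h j.succ → α h = 0 :=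
    hα.2.2
  have hδ : homCoboundary α = 0 := congrArg Subtype.val hx
  -- The extra vertex `k⁻¹ g` is put in front. It is equivariant for right translation, and the
  -- average over `k` depends only on the coset of `g`.
  let β : (Fin (m + 1) → Rˣ) → Rˣ → L → R [⋀^Fin q]→ₗ[ℝ] V := fun h g k =>
    α (Fin.cons ((ι k)⁻¹ * g) h) g
  have hplot : ∀ ψ : E → L, (IsUnitPlot fun u => ι (ψ u)) → ∀ (h : Fin (m + 1) → ℝ → Rˣ)
      (c : ℝ → Rˣ)
      (x : Fin q → ℝ → R), (∀ j, IsSmoothUnitCurve (h j)) → IsSmoothUnitCurve c →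
      (∀ i, IsSmoothCurve (x i)) → ContDiff ℝ ∞ fun p : E × ℝ =>
        β (fun j => h j p.2) (c p.2) (ψ p.1) (fun i => x i p.2) := by
    intro ψ hψ h c x hh hc hx
    exact hs.contDiff (IsUnitPlot.cons ((hψ.comp contDiff_fst).inv.mul
      (hπ.isUnitPlot_of_curve hc contDiff_snd)) fun j => hπ.isUnitPlot_of_curve (hh j) contDiff_snd)
      (hπ.isUnitPlot_of_curve hc contDiff_snd)
      fun i => (hπ.isPlot_curve (hx i)).comp contDiff_snd
  have hint : ∀ h g x, Integrable (fun k => β h g k x) μ := fun h g x =>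
    hι.integrable μ fun ψ hψ => (hplot ψ hψ (fun j _ => h j) (fun _ => g) (fun i _ => x i)
      (fun _ => .const _) (.const _) fun _ => .const _).comp
        (contDiff_id.prodMk (contDiff_const (c := 0)))
  let w : RawForm R V (m + 1) q := fun h g => integralForm μ (β h g) (hint h g)
  have hws : IsSmoothForm w := fun h c x hh hc hx =>
    hι.contDiff_integral μ fun ψ hψ => hplot ψ hψ h c x hh hc hx
  have hwb : IsBasicForm ι.range w := by
    refine ⟨fun h g k hk x => ?_, fun h g x i b hbK e => ?_⟩
    · obtain ⟨a, rfl⟩ := hk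
      change ∫ k, α (Fin.cons ((ι k)⁻¹ * (ι a * g)) h) (ι a * g) (fun i => ι a * x i) ∂μ =
        ∫ k, α (Fin.cons ((ι k)⁻¹ * g) h) g x ∂μ
      simp only [hb.1 _ g _ ⟨a, rfl⟩]
      -- Replacing `k` by `a k` turns `k⁻¹ (a g)` into `k⁻¹ g`.
      rw [← integral_mul_left_eq_self (μ := μ) _ a]
      simp [mul_assoc]
    · change ∫ k, α (Fin.cons ((ι k)⁻¹ * g) h) g x ∂μ = 0
      simp only [hb.2 _ g x i b hbK e, integral_zero]
  have hwinv : IsInvariantForm w := by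
    intro y h g x
    change ∫ k, α (Fin.cons ((ι k)⁻¹ * (g * y)) fun j => h j * y) (g * y) (fun i => x i * y) ∂μ =
      ∫ k, α (Fin.cons ((ι k)⁻¹ * g) h) g x ∂μ
    congr 1
    funext k
    rw [← hinv y (Fin.cons ((ι k)⁻¹ * g) h) g x]
    congr 2
    funext j
    refine Fin.cases ?_ (fun j => ?_) j
    · simp [mul_assoc]
    · simp
  refine ⟨⟨w, hπ.mem_deRham ⟨hws, hwb⟩, hwinv, fun h j e => ?_⟩, Subtype.ext ?_⟩
  · funext g
    ext x
    change ∫ k, α (Fin.cons ((ι k)⁻¹ * g) h) g x ∂μ = 0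
    have : ∀ k, α (Fin.cons ((ι k)⁻¹ * g) h) = 0 := fun k => hdeg _ j.succ (by
      rw [← Fin.succ_castSucc, Fin.cons_succ, Fin.cons_succ, e])
    simp [this]
  · funext h g
    ext x
    change homCoboundary w h g x = α h g x
    -- The cocycle identity on `(k⁻¹ g, h₀, …)` is used for each `k` separately. The zeroth face
    -- gives `α h` and the others give the coboundary of `β` with opposite sign. As `μ` has total
    -- mass 1, averaging returns `α h`.
    have h1 : ∀ k, α h g x = ∑ i : Fin (m + 2), (-1 : ℝ) ^ (i : ℕ) •
        β (fun j => h (i.succAbove j)) g k x := by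
      intro k
      have h2 := congrArg (fun a => a g x) (congrFun hδ (Fin.cons ((ι k)⁻¹ * g) h))
      simp only [homCoboundary, Finset.sum_apply, Pi.smul_apply, alternatingMap_sum_apply,
        AlternatingMap.smul_apply] at h2
      rw [Fin.sum_univ_succ] at h2
      have h3 : ∀ i : Fin (m + 2), (fun j => (Fin.cons ((ι k)⁻¹ * g) h : Fin (m + 3) → Rˣ)
          (i.succ.succAbove j)) = Fin.cons ((ι k)⁻¹ * g) fun j => h (i.succAbove j) := by
        intro i
        funext j
        refine Fin.cases ?_ (fun j => ?_) j
        · simp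
        · simp
      simp only [h3, Fin.val_zero, pow_zero, one_smul, Fin.zero_succAbove, Fin.cons_succ,
        Fin.val_succ, pow_succ, mul_neg, mul_one, neg_smul, Finset.sum_neg_distrib] at h2
      exact add_neg_eq_zero.1 h2
    simp only [homCoboundary, Finset.sum_apply, Pi.smul_apply, alternatingMap_sum_apply,
      AlternatingMap.smul_apply]
    change ∑ i : Fin (m + 2), (-1 : ℝ) ^ (i : ℕ) • ∫ k, β (fun j => h (i.succAbove j)) g k x ∂μ = _
    simp only [← integral_smul]
    rw [← integral_finsetSum _ fun i _ => (hint _ g x).fun_smul _]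
    simp only [← h1]
    simp

/-- In degree 0 the cocycle condition compares the values at two arbitrary vertices, so the family
is constant. Invariance under the simultaneous action then becomes invariance of its value. -/
theorem exists_invariantEdge_eq (hπ : IsFrechetRep π) [CompleteSpace V] {K : Subgroup Rˣ}
    (x : bicomplex V K 0 q) (hx : bicomplexδ K 0 q x = 0) :
    ∃ f : invariantForms V K q, invariantEdge K q f = x := by
  obtain ⟨α, hα⟩ := x
  have hs : IsSmoothForm α := hα.1.1.1
  have hb : IsBasicForm K α := hα.1.1.2
  have hinv : IsInvariantForm α := hα.2.1
  have hδ : homCoboundary α = 0 := congrArg Subtype.val hx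
  have hconst : ∀ h h', α h = α h' := by
    intro h h'
    have h1 := congrFun hδ (Fin.cons (h 0) h')
    replace h1 := (Fin.sum_univ_two _).symm.trans h1
    simp only [Fin.val_zero, pow_zero, one_smul, Fin.val_one,
      pow_one, neg_smul, Pi.zero_apply] at h1
    have h2 := (add_neg_eq_zero.1 h1).symm
    convert h2 using 2
    · funext j
      obtain rfl : j = 0 := Fin.fin_one_eq_zero j
      simp
    · funext j
      obtain rfl : j = 0 := Fin.fin_one_eq_zero j
      simp
  let f : RawForm R V 0 q := fun _ => α fun _ => 1
  have hf : f ∈ smoothForms V K 0 q :=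
    ⟨fun h c x hh hc hx => hs (fun _ _ => 1) c x (fun _ => .const _) hc hx,
      fun _ => hb.1 _, fun _ => hb.2 _⟩
  refine ⟨⟨f, hπ.mem_deRham hf, fun y h g x => ?_⟩, Subtype.ext (funext fun h => hconst _ _)⟩
  change α (fun _ => 1) _ _ = α (fun _ => 1) g x
  rw [← hinv y (fun _ => 1) g x, hconst]

end Rows

/-! ### Exactness of the columns: the equivariant Poincaré lemma -/

section Columns

open MeasureTheory

variable {R : Type u} [Ring R] [Algebra ℝ R] [TopologicalSpace R] [IsTopologicalRing R]
  [ContinuousSMul ℝ R]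
variable {B : ℕ → Type*} [∀ i, NormedRing (B i)] [∀ i, NormedAlgebra ℝ (B i)]
  [∀ i, CompleteSpace (B i)]
variable {π : ∀ i, R →ₐ[ℝ] B i}
variable {V : Type v} [NormedAddCommGroup V] [NormedSpace ℝ V]
variable {E : Type*} [NormedAddCommGroup E] [NormedSpace ℝ E]

/-- A homotopy `H` of `Rˣ`, conjugated by right translation by `h 0`. -/
def translatedHomotopy (H : Rˣ → ℝ → Rˣ) {m : ℕ} (h : Fin (m + 1) → Rˣ) (g : Rˣ) (t : ℝ) : Rˣ :=
  H (g * (h 0)⁻¹) t * h 0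

/-- Smoothness of a homotopy. -/
def IsSmoothHomotopy (H : Rˣ → ℝ → Rˣ) : Prop :=
  ∀ (c : ℝ → Rˣ) (s : ℝ → ℝ), IsSmoothUnitCurve c → ContDiff ℝ ∞ s →
    IsSmoothUnitCurve fun t => H (c t) (s t)

variable {H : Rˣ → ℝ → Rˣ} {m q : ℕ}

theorem IsSmoothHomotopy.plot (hH : IsSmoothHomotopy H) {h : Fin (m + 1) → E → Rˣ} {c : E → Rˣ}
    {s : E → ℝ} (hh : ∀ j, IsUnitPlot (h j)) (hc : IsUnitPlot c) (hs : ContDiff ℝ ∞ s) :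
    IsUnitPlot fun u => translatedHomotopy H (fun j => h j u) (c u) (s u) := fun γ hγ =>
  (hH _ _ ((hc.mul (hh 0).inv) γ hγ) (hs.comp hγ)).mul' (hh 0 γ hγ)

/-- The velocity of the homotopy. -/
def homotopyVelocity (H : Rˣ → ℝ → Rˣ) (h : Fin (m + 1) → Rˣ) (g : Rˣ) (t : ℝ) : R :=
  velocity (fun s => (translatedHomotopy H h g (t + s) : R)) 0

/-- The tangent map of the homotopy at time `t`. -/
def homotopyTangent (H : Rˣ → ℝ → Rˣ) (h : Fin (m + 1) → Rˣ) (g : Rˣ) (t : ℝ) (x : R) : R :=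
  velocity (fun s => (translatedHomotopy H h (flow g x s) t : R)) 0

theorem IsSmoothHomotopy.hasDerivAt_velocity (hH : IsSmoothHomotopy H)
    (h : Fin (m + 1) → Rˣ) (g : Rˣ) (t : ℝ) :
    HasDerivAt (fun s => (translatedHomotopy H h g (t + s) : R)) (homotopyVelocity H h g t) 0 :=
  (hH.plot (E := ℝ) (h := fun j _ => h j) (fun _ => .const _) (.const g)
    (contDiff_const.add contDiff_id)).curve.val.hasDerivAt 0

theorem IsSmoothHomotopy.hasDerivAt_tangent (hH : IsSmoothHomotopy H) (hπ : IsFrechetRep π)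
    (h : Fin (m + 1) → Rˣ) (g : Rˣ) (t : ℝ) (x : R) :
    HasDerivAt (fun s => (translatedHomotopy H h (flow g x s) t : R))
      (homotopyTangent H h g t x) 0 :=
  (hH.plot (E := ℝ) (h := fun j _ => h j) (fun _ => .const _)
    (hπ.isUnitPlot_curve (hπ.isSmoothUnitCurve_flow g x)) contDiff_const).curve.val.hasDerivAt 0

theorem IsSmoothHomotopy.smoothOnUnits (hH : IsSmoothHomotopy H) (hπ : IsFrechetRep π)
    (h : Fin (m + 1) → Rˣ) (t : ℝ) (i : ℕ) :
    SmoothOnUnits fun g => π i (translatedHomotopy H h g t : R) := fun _ hc =>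
  hπ.isSmoothCurve_iff.1 (hH.plot (E := ℝ) (h := fun j _ => h j) (fun _ => .const _)
    (hπ.isUnitPlot_curve hc) contDiff_const).curve.val i

theorem IsSmoothHomotopy.map_tangent (hH : IsSmoothHomotopy H) (hπ : IsFrechetRep π)
    (h : Fin (m + 1) → Rˣ) (g : Rˣ) (t : ℝ) (x : R) (i : ℕ) :
    π i (homotopyTangent H h g t x) =
      fd (fun g => π i (translatedHomotopy H h g t : R)) g x :=
  (hπ.hasDerivAt_iff.1 (hH.hasDerivAt_tangent hπ h g t x) i).unique
    ((hH.smoothOnUnits hπ h t i).hasDerivAt_fd hπ g x)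

/-- The tangent map is defined by exponential curves. That it computes velocities along every smooth
curve is the chain rule `SmoothOnUnits.hasDerivAt_comp`, applied in each Banach component. -/
theorem IsSmoothHomotopy.hasDerivAt_comp (hH : IsSmoothHomotopy H) (hπ : IsFrechetRep π)
    (h : Fin (m + 1) → Rˣ) (t : ℝ) {c : ℝ → Rˣ} (hc : IsSmoothUnitCurve c) {s : ℝ} {y : R}
    (hy : HasDerivAt (fun s => (c s : R)) y s) :
    HasDerivAt (fun s => (translatedHomotopy H h (c s) t : R))
      (homotopyTangent H h (c s) t y) s := by
  rw [hπ.hasDerivAt_iff]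
  intro i
  rw [hH.map_tangent hπ]
  exact (hH.smoothOnUnits hπ h t i).hasDerivAt_comp hπ hc hy

/-- The tangent map of the homotopy at time `t`, as a linear map. -/
def homotopyTangentLM (hH : IsSmoothHomotopy H) (hπ : IsFrechetRep π)
    (h : Fin (m + 1) → Rˣ) (g : Rˣ) (t : ℝ) : R →ₗ[ℝ] R where
  toFun := homotopyTangent H h g t
  map_add' x y := hπ.ext fun i => by
    rw [map_add, hH.map_tangent hπ, hH.map_tangent hπ, hH.map_tangent hπ]
    exact (hH.smoothOnUnits hπ h t i).fd_add hπ g x y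
  map_smul' r x := hπ.ext fun i => by
    rw [RingHom.id_apply, map_smul, hH.map_tangent hπ, hH.map_tangent hπ]
    exact (hH.smoothOnUnits hπ h t i).fd_smul hπ g r x

theorem IsSmoothHomotopy.plot_velocity [FiniteDimensional ℝ E] (hH : IsSmoothHomotopy H)
    (hπ : IsFrechetRep π) {h : Fin (m + 1) → E → Rˣ} {c : E → Rˣ}
    {s : E → ℝ} (hh : ∀ j, IsUnitPlot (h j)) (hc : IsUnitPlot c) (hs : ContDiff ℝ ∞ s) :
    IsPlot fun u => homotopyVelocity H (fun j => h j u) (c u) (s u) := by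
  have h1 := hH.plot (E := E × ℝ) (s := fun p => s p.1 + p.2)
    (fun j => (hh j).comp contDiff_fst) (hc.comp contDiff_fst)
    ((hs.comp contDiff_fst).add contDiff_snd)
  have h2 := (hπ.isPlot_pd h1.val (0, 1)).comp (g := fun u : E => (u, (0 : ℝ)))
    (contDiff_id.prodMk contDiff_const)
  convert h2 using 1
  funext u
  refine hπ.unique (hH.hasDerivAt_velocity _ _ _) ?_
  simpa using h1.val.hasDerivAt_pd (0, 1) (u, 0)

theorem IsSmoothHomotopy.plot_tangent [FiniteDimensional ℝ E] (hH : IsSmoothHomotopy H)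
    (hπ : IsFrechetRep π) {h : Fin (m + 1) → E → Rˣ} {c : E → Rˣ}
    {s : E → ℝ} {x : E → R} (hh : ∀ j, IsUnitPlot (h j)) (hc : IsUnitPlot c)
    (hs : ContDiff ℝ ∞ s) (hx : IsPlot x) :
    IsPlot fun u => homotopyTangent H (fun j => h j u) (c u) (s u) (x u) := by
  have h1 := hH.plot (E := E × ℝ) (s := fun p => s p.1)
    (fun j => (hh j).comp contDiff_fst)
    (hπ.isUnitPlot_flow (hc.comp contDiff_fst) (hx.comp contDiff_fst) contDiff_snd)
    (hs.comp contDiff_fst)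
  have h2 := (hπ.isPlot_pd h1.val (0, 1)).comp (g := fun u : E => (u, (0 : ℝ)))
    (contDiff_id.prodMk contDiff_const)
  convert h2 using 1
  funext u
  refine hπ.unique (hH.hasDerivAt_tangent hπ _ _ _ _) ?_
  simpa using h1.val.hasDerivAt_pd (0, 1) (u, 0)

variable {K : Subgroup Rˣ}

/-- The integrand of the homotopy operator. -/
def homotopyIntegrand (hH : IsSmoothHomotopy H) (hπ : IsFrechetRep π)
    (α : RawForm R V (m + 1) (q + 1)) (h : Fin (m + 1) → Rˣ) (g : Rˣ) (t : ℝ) :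
    R [⋀^Fin q]→ₗ[ℝ] V :=
  ((α h (translatedHomotopy H h g t)).curryLeft (homotopyVelocity H h g t)).compLinearMap
    (homotopyTangentLM hH hπ h g t)

theorem homotopyIntegrand_apply (hH : IsSmoothHomotopy H) (hπ : IsFrechetRep π)
    (α : RawForm R V (m + 1) (q + 1)) (h : Fin (m + 1) → Rˣ) (g : Rˣ) (t : ℝ) (x : Fin q → R) :
    homotopyIntegrand hH hπ α h g t x = α h (translatedHomotopy H h g t)
      (Fin.cons (homotopyVelocity H h g t) fun i => homotopyTangent H h g t (x i)) := rfl

theorem IsPlot.cons {c : E → R} {x : Fin q → E → R} (hc : IsPlot c)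
    (hx : ∀ j, IsPlot (x j)) (j : Fin (q + 1)) :
    IsPlot fun u => (Fin.cons (c u) (fun j => x j u) : Fin (q + 1) → R) j := by
  refine Fin.cases ?_ (fun j => ?_) j
  · simpa using hc
  · simpa using hx j

theorem contDiff_homotopyIntegrand [CompleteSpace V] [FiniteDimensional ℝ E]
    (hH : IsSmoothHomotopy H) (hπ : IsFrechetRep π) {α : RawForm R V (m + 1) (q + 1)}
    (hα : IsSmoothForm α) {h : Fin (m + 1) → E → Rˣ} {c : E → Rˣ} {s : E → ℝ} {x : Fin q → E → R}
    (hh : ∀ j, IsUnitPlot (h j)) (hc : IsUnitPlot c) (hs : ContDiff ℝ ∞ s)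
    (hx : ∀ i, IsPlot (x i)) :
    ContDiff ℝ ∞ fun u => homotopyIntegrand hH hπ α (fun j => h j u) (c u) (s u)
      (fun i => x i u) := by
  simp only [homotopyIntegrand_apply]
  exact hα.contDiff hh (hH.plot hh hc hs) (IsPlot.cons (hH.plot_velocity hπ hh hc hs)
    fun i => hH.plot_tangent hπ hh hc hs (hx i))

theorem integrable_homotopyIntegrand [CompleteSpace V]
    (hH : IsSmoothHomotopy H) (hπ : IsFrechetRep π) {α : RawForm R V (m + 1) (q + 1)}
    (hα : IsSmoothForm α) (h : Fin (m + 1) → Rˣ) (g : Rˣ) (x : Fin q → R) :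
    Integrable (fun t => homotopyIntegrand hH hπ α h g t x)
      (volume.restrict (Set.Icc (0 : ℝ) 1)) :=
  (contDiff_homotopyIntegrand (E := ℝ) hH hπ hα (h := fun j _ => h j) (c := fun _ => g)
    (x := fun i _ => x i) (fun _ => .const _) (.const g) contDiff_id
      fun _ => .const _).continuous.integrableOn_Icc

/-- The homotopy operator. -/
def homotopyOperator [CompleteSpace V] (hH : IsSmoothHomotopy H) (hπ : IsFrechetRep π)
    {α : RawForm R V (m + 1) (q + 1)} (hα : IsSmoothForm α) : RawForm R V (m + 1) q :=
  fun h g => integralForm (volume.restrict (Set.Icc (0 : ℝ) 1)) (homotopyIntegrand hH hπ α h g)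
    (integrable_homotopyIntegrand hH hπ hα h g)

theorem homotopyOperator_apply [CompleteSpace V] (hH : IsSmoothHomotopy H) (hπ : IsFrechetRep π)
    {α : RawForm R V (m + 1) (q + 1)} (hα : IsSmoothForm α) (h : Fin (m + 1) → Rˣ) (g : Rˣ)
    (x : Fin q → R) : homotopyOperator hH hπ hα h g x =
      ∫ t in Set.Icc (0 : ℝ) 1, homotopyIntegrand hH hπ α h g t x := rfl

theorem isSmoothForm_homotopyOperator [CompleteSpace V] (hH : IsSmoothHomotopy H)
    (hπ : IsFrechetRep π) {α : RawForm R V (m + 1) (q + 1)} (hα : IsSmoothForm α) :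
    IsSmoothForm (homotopyOperator hH hπ hα) := by
  intro h c x hh hc hx
  simp only [homotopyOperator_apply]
  exact contDiff_integral_unit (F := fun r t => homotopyIntegrand hH hπ α (fun j => h j t) (c t) r
    (fun i => x i t)) (contDiff_homotopyIntegrand (E := ℝ × ℝ) hH hπ hα
      (fun j => hπ.isUnitPlot_of_curve (hh j) contDiff_snd)
      (hπ.isUnitPlot_of_curve hc contDiff_snd) contDiff_fst
      fun i => (hπ.isPlot_curve (hx i)).comp contDiff_snd)

theorem translatedHomotopy_mul_left (hK : ∀ k ∈ K, ∀ g t, H (k * g) t = k * H g t)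
    (h : Fin (m + 1) → Rˣ) (g : Rˣ) (t : ℝ) {k : Rˣ} (hk : k ∈ K) :
    translatedHomotopy H h (k * g) t = k * translatedHomotopy H h g t := by
  simp [translatedHomotopy, mul_assoc, hK k hk]

theorem translatedHomotopy_mul_right (h : Fin (m + 1) → Rˣ) (g : Rˣ) (t : ℝ) (y : Rˣ) :
    translatedHomotopy H (fun j => h j * y) (g * y) t = translatedHomotopy H h g t * y := by
  simp [translatedHomotopy, mul_assoc]

theorem homotopyTangent_mul_left (hH : IsSmoothHomotopy H) (hπ : IsFrechetRep π)
    (hK : ∀ k ∈ K, ∀ g t, H (k * g) t = k * H g t)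
    (h : Fin (m + 1) → Rˣ) (g : Rˣ) (t : ℝ) {k : Rˣ} (hk : k ∈ K) (x : R) :
    homotopyTangent H h (k * g) t (k * x) = k * homotopyTangent H h g t x := by
  have h1 := hH.hasDerivAt_comp hπ h t
    ((IsSmoothUnitCurve.const k).mul' (hπ.isSmoothUnitCurve_flow g x)) (s := 0)
    (by simpa using hasDerivAt_const_mul_curve (hπ.hasDerivAt_flow g x) (k : R))
  rw [hπ.flow_zero] at h1
  refine hπ.unique h1 ?_
  simpa only [translatedHomotopy_mul_left hK h _ t hk, Units.val_mul] using
    hasDerivAt_const_mul_curve (hH.hasDerivAt_tangent hπ h g t x) (k : R)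

theorem homotopyVelocity_mul_left (hH : IsSmoothHomotopy H) (hπ : IsFrechetRep π)
    (hK : ∀ k ∈ K, ∀ g t, H (k * g) t = k * H g t)
    (h : Fin (m + 1) → Rˣ) (g : Rˣ) (t : ℝ) {k : Rˣ} (hk : k ∈ K) :
    homotopyVelocity H h (k * g) t = k * homotopyVelocity H h g t := by
  refine hπ.unique (hH.hasDerivAt_velocity h (k * g) t) ?_
  simpa only [translatedHomotopy_mul_left hK h _ _ hk, Units.val_mul] using
    hasDerivAt_const_mul_curve (hH.hasDerivAt_velocity h g t) (k : R)

theorem homotopyTangent_mul_right (hH : IsSmoothHomotopy H) (hπ : IsFrechetRep π)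
    (h : Fin (m + 1) → Rˣ) (g : Rˣ) (t : ℝ) (y : Rˣ) (x : R) :
    homotopyTangent H (fun j => h j * y) (g * y) t (x * y) = homotopyTangent H h g t x * y := by
  refine hπ.unique (hH.hasDerivAt_tangent hπ _ (g * y) t _) ?_
  simpa only [flow_mul, translatedHomotopy_mul_right, Units.val_mul] using
    hasDerivAt_mul_const_curve (hH.hasDerivAt_tangent hπ h g t x) (y : R)

theorem homotopyVelocity_mul_right (hH : IsSmoothHomotopy H) (hπ : IsFrechetRep π)
    (h : Fin (m + 1) → Rˣ) (g : Rˣ) (t : ℝ) (y : Rˣ) :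
    homotopyVelocity H (fun j => h j * y) (g * y) t = homotopyVelocity H h g t * y := by
  refine hπ.unique (hH.hasDerivAt_velocity _ (g * y) t) ?_
  simpa only [translatedHomotopy_mul_right, Units.val_mul] using
    hasDerivAt_mul_const_curve (hH.hasDerivAt_velocity h g t) (y : R)

/-- A vertical vector is the velocity of `k(s) g`, and the homotopy maps this curve to `k(s)` times
a fixed point. Vertical vectors thus go to vertical vectors, which makes the homotopy operator
preserve basic forms. -/
theorem homotopyTangent_lieAlgebraOf (hH : IsSmoothHomotopy H) (hπ : IsFrechetRep π)
    (hK : ∀ k ∈ K, ∀ g t, H (k * g) t = k * H g t)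
    (h : Fin (m + 1) → Rˣ) (g : Rˣ) (t : ℝ) {b : R} (hb : b ∈ lieAlgebraOf K) :
    homotopyTangent H h g t (b * g) = b * translatedHomotopy H h g t := by
  obtain ⟨k, hk, hkK, hk0, hkb⟩ := hb
  have h1 := hH.hasDerivAt_comp hπ h t (hk.mul' (.const g)) (s := 0)
    (by simpa using hasDerivAt_mul_const_curve hkb (g : R))
  rw [hk0, one_mul] at h1
  refine hπ.unique h1 ?_
  simpa only [translatedHomotopy_mul_left hK h _ t (hkK _), Units.val_mul] using
    hasDerivAt_mul_const_curve hkb (translatedHomotopy H h g t : R)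

theorem isBasicForm_homotopyOperator [CompleteSpace V] (hH : IsSmoothHomotopy H)
    (hπ : IsFrechetRep π) (hK : ∀ k ∈ K, ∀ g t, H (k * g) t = k * H g t)
    {α : RawForm R V (m + 1) (q + 1)} (hα : IsSmoothForm α) (hb : IsBasicForm K α) :
    IsBasicForm K (homotopyOperator hH hπ hα) := by
  refine ⟨fun h g k hk x => ?_, fun h g x i b hbK e => ?_⟩
  · rw [homotopyOperator_apply, homotopyOperator_apply]
    congr 1
    funext t
    rw [homotopyIntegrand_apply, homotopyIntegrand_apply,
      ← hb.1 h (translatedHomotopy H h g t) k hk, translatedHomotopy_mul_left hK h g t hk]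
    congr 1
    funext j
    refine Fin.cases ?_ (fun j => ?_) j
    · simpa using homotopyVelocity_mul_left hH hπ hK h g t hk
    · simpa using homotopyTangent_mul_left hH hπ hK h g t hk (x j)
  · rw [homotopyOperator_apply]
    have : ∀ t, homotopyIntegrand hH hπ α h g t x = 0 := fun t => by
      rw [homotopyIntegrand_apply]
      refine hb.2 h _ _ i.succ b hbK ?_
      rw [Fin.cons_succ, e, homotopyTangent_lieAlgebraOf hH hπ hK h g t hbK]
    simp [this]

theorem isInvariantForm_homotopyOperator [CompleteSpace V] (hH : IsSmoothHomotopy H)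
    (hπ : IsFrechetRep π) {α : RawForm R V (m + 1) (q + 1)} (hα : IsSmoothForm α)
    (hinv : IsInvariantForm α) : IsInvariantForm (homotopyOperator hH hπ hα) := by
  intro y h g x
  rw [homotopyOperator_apply, homotopyOperator_apply]
  congr 1
  funext t
  rw [homotopyIntegrand_apply, homotopyIntegrand_apply, ← hinv y h (translatedHomotopy H h g t),
    translatedHomotopy_mul_right]
  congr 1
  funext j
  refine Fin.cases ?_ (fun j => ?_) j
  · simpa using homotopyVelocity_mul_right hH hπ h g t y
  · simpa using homotopyTangent_mul_right hH hπ h g t y (x j)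

/-- A closed basic form of positive degree is the exterior derivative of its image under the
homotopy operator. -/
theorem isExtDeriv_homotopyOperator [CompleteSpace V] (hH : IsSmoothHomotopy H)
    (hπ : IsFrechetRep π) (h1 : ∀ g, H g 1 = g) (h0 : ∀ g, H g 0 ∈ K)
    {α : RawForm R V (m + 1) (q + 1)} (hα : IsSmoothForm α) (hb : IsBasicForm K α)
    (hcl : IsExtDeriv α 0) : IsExtDeriv (homotopyOperator hH hπ hα) α := by
  obtain ⟨η, hη⟩ := (isSmoothForm_homotopyOperator hH hπ hα).exists_extDeriv hπ
  suffices η = α by rwa [this] at hη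
  funext h g
  ext x
  let ψ := coordPlot g x
  have hψ : IsUnitPlot ψ := hπ.isUnitPlot_coordPlot g x
  -- The form is pulled back along `(t, u) ↦ H_t (ψ u)`. Its component without `dt` is `A`; the
  -- components containing `dt` are the integrands `G j` of the homotopy operator.
  let Ψ : ℝ × (Fin (q + 1) → ℝ) → Rˣ := fun p => translatedHomotopy H h (ψ p.2) p.1
  have hΨ : IsUnitPlot Ψ := hH.plot (h := fun j _ => h j) (fun _ => .const _)
    (hψ.comp contDiff_snd) contDiff_fst
  have hpd : ∀ w, IsPlot (pd (fun p => (Ψ p : R)) w) := hπ.isPlot_pd hΨ.val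
  have hψpd : ∀ w, IsPlot (pd (fun p => (ψ p : R)) w) := hπ.isPlot_pd hψ.val
  have hvel : ∀ t u, pd (fun p => (Ψ p : R)) (1, 0) (t, u) = homotopyVelocity H h (ψ u) t := by
    intro t u
    refine hπ.unique (hΨ.val.hasDerivAt_pd _ _) ?_
    simpa [Ψ] using hH.hasDerivAt_velocity h (ψ u) t
  have htan : ∀ e t u, pd (fun p => (Ψ p : R)) (0, e) (t, u) =
      homotopyTangent H h (ψ u) t (pd (fun u => (ψ u : R)) e u) := by
    intro e t u
    refine hπ.unique (hΨ.val.hasDerivAt_pd _ _) ?_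
    have := hH.hasDerivAt_comp hπ h t (hψ _ (contDiff_line u e)) (hψ.val.hasDerivAt_pd e u)
    simpa [Ψ] using this
  let G : Fin (q + 1) → ℝ × (Fin (q + 1) → ℝ) → V := fun j p =>
    homotopyIntegrand hH hπ α h (ψ p.2) p.1
      (j.removeNth fun k => pd (fun u => (ψ u : R)) (Pi.single k 1) p.2)
  have hG : ∀ j, ContDiff ℝ ∞ (G j) := fun j =>
    contDiff_homotopyIntegrand hH hπ hα (h := fun j _ => h j) (fun _ => .const _)
      (hψ.comp contDiff_snd) contDiff_fst fun k => (hψpd _).comp contDiff_snd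
  let A : ℝ × (Fin (q + 1) → ℝ) → V := fun p =>
    α h (Ψ p) fun k => pd (fun p => (Ψ p : R)) (0, Pi.single k 1) p
  have hA : ContDiff ℝ ∞ A := hα.contDiff (h := fun j _ => h j) (fun _ => .const _) hΨ
    fun k => hpd _
  let v : Fin (q + 2) → ℝ × (Fin (q + 1) → ℝ) := Fin.cons (1, 0) fun k => (0, Pi.single k 1)
  -- Closedness of the pullback, evaluated on `∂_t` and all coordinate vectors. Integrating from 0
  -- to 1 leaves `A` at time 1 minus `A` at time 0.
  have hstokes : ∀ t, fderiv ℝ A (t, 0) (1, 0) =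
      ∑ j : Fin (q + 1), (-1 : ℝ) ^ (j : ℕ) • fderiv ℝ (G j) (t, 0) (0, Pi.single j 1) := by
    intro t
    have h2 := hα.extDeriv_apply hπ hcl h hΨ v (t, 0)
    rw [Fin.sum_univ_succ] at h2
    have e0 : (fun u => α h (Ψ u) ((0 : Fin (q + 2)).removeNth
        fun j => pd (fun u => (Ψ u : R)) (v j) u)) = A := rfl
    have ej : ∀ j : Fin (q + 1), (fun u => α h (Ψ u) (j.succ.removeNth
        fun j => pd (fun u => (Ψ u : R)) (v j) u)) = G j := by
      intro j
      funext ⟨t, u⟩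
      simp only [G]
      rw [homotopyIntegrand_apply]
      refine congrArg (α h (Ψ (t, u))) (funext fun k => ?_)
      refine Fin.cases ?_ (fun k => ?_) k
      · simp only [Fin.removeNth_apply, Fin.succ_succAbove_zero, Fin.cons_zero, v]
        exact hvel t u
      · simp only [Fin.removeNth_apply, Fin.succ_succAbove_succ, Fin.cons_succ, v]
        exact htan _ t u
    simp only [e0, ej] at h2
    have h3 : (0 : V) = fderiv ℝ A (t, 0) (1, 0) + ∑ i : Fin (q + 1), (-1 : ℝ) ^ ((i : ℕ) + 1) •
        fderiv ℝ (G i) (t, 0) (0, Pi.single i 1) := by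
      simpa [v] using h2
    simp only [pow_succ, mul_neg, mul_one, neg_smul, Finset.sum_neg_distrib] at h3
    exact add_neg_eq_zero.1 h3.symm
  have hη1 := (isSmoothForm_homotopyOperator hH hπ hα).extDeriv_apply hπ hη h hψ
    (fun i => Pi.single i 1) 0
  have e0 : (fun i => pd (fun u => (ψ u : R)) (Pi.single i 1) 0) = x :=
    funext fun i => hπ.pd_coordPlot g x i
  rw [e0, show ψ 0 = g from hπ.coordPlot_zero g x] at hη1
  have hint : ∀ j : Fin (q + 1), fderiv ℝ (fun u => homotopyOperator hH hπ hα h (ψ u)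
      (j.removeNth fun k => pd (fun u => (ψ u : R)) (Pi.single k 1) u)) 0 (Pi.single j 1) =
      ∫ t in Set.Icc (0 : ℝ) 1, fderiv ℝ (G j) (t, 0) (0, Pi.single j 1) := by
    intro j
    have hs : ContDiff ℝ ∞ (fun u => homotopyOperator hH hπ hα h (ψ u)
        (j.removeNth fun k => pd (fun u => (ψ u : R)) (Pi.single k 1) u)) :=
      (isSmoothForm_homotopyOperator hH hπ hα).contDiff (h := fun j _ => h j)
        (fun _ => .const _) hψ fun k => hψpd _
    refine (hasDerivAt_fderiv_line hs 0 (Pi.single j 1)).unique ?_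
    have hline : ∀ t s, HasDerivAt (fun s : ℝ => G j (t, 0 + s • Pi.single j 1))
        (fderiv ℝ (G j) (t, 0 + s • Pi.single j 1) (0, Pi.single j 1)) s := fun t s =>
      ((hG j).differentiable (by simp) _).hasFDerivAt.comp_hasDerivAt s
        ((hasDerivAt_const s t).prodMk (hasDerivAt_line 0 (Pi.single j 1) s))
    have hcl : Continuous fun p : ℝ × ℝ =>
        ((p.1, 0 + p.2 • Pi.single j 1) : ℝ × (Fin (q + 1) → ℝ)) := by fun_prop
    have h2 := hasDerivAt_setIntegral volume (isCompact_Icc (a := (0 : ℝ)) (b := 1))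
      measurableSet_Icc ((hG j).continuous.comp hcl)
      ((contDiff_fderiv_apply (hG j) (0, Pi.single j 1)).continuous.comp hcl) hline 0
    simpa [homotopyOperator_apply, G] using h2
  rw [hη1]
  simp only [hint, ← integral_smul]
  rw [← integral_finsetSum]
  · simp only [← hstokes]
    have h2 : ∀ t, HasDerivAt (fun t => A (t, 0)) (fderiv ℝ A (t, 0) (1, 0)) t := fun t =>
      (hA.differentiable (by simp) _).hasFDerivAt.comp_hasDerivAt t
        ((hasDerivAt_id t).prodMk (hasDerivAt_const t _))
    have h3 := intervalIntegral.integral_eq_sub_of_hasDerivAt (a := 0) (b := 1) (fun t _ => h2 t)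
      (((contDiff_fderiv_apply hA (1, 0)).continuous.comp
        (by fun_prop : Continuous fun t : ℝ => (t, (0 : Fin (q + 1) → ℝ)))).intervalIntegrable _ _)
    rw [intervalIntegral.integral_of_le zero_le_one, ← integral_Icc_eq_integral_Ioc] at h3
    refine h3.trans ?_
    have hA1 : A (1, 0) = α h g x := by
      have e1 : Ψ (1, 0) = g := by
        simp [Ψ, translatedHomotopy, h1, ψ, hπ.coordPlot_zero]
      have e2 : (fun k => pd (fun p => (Ψ p : R)) (0, Pi.single k 1) (1, 0)) = x := by
        funext k
        refine (hπ.unique (hΨ.val.hasDerivAt_pd _ _) ?_).trans (hπ.pd_coordPlot g x k)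
        simpa [Ψ, translatedHomotopy, h1] using hψ.val.hasDerivAt_pd (Pi.single k 1) 0
      simp only [A, e1, e2]
    -- At time 0 the homotopy takes values in `K h₀`, so all its tangent vectors are vertical. The
    -- degree is positive, hence there is an argument, numbered 0, on which the basic form vanishes.
    have hA0 : A (0, 0) = 0 := by
      have hc : IsSmoothUnitCurve fun s : ℝ => Ψ (0, s • Pi.single 0 1) :=
        hΨ _ (by fun_prop)
      have hk : IsSmoothUnitCurve fun s : ℝ => Ψ (0, s • Pi.single 0 1) * (Ψ (0, 0))⁻¹ :=
        hc.mul' (.const _)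
      refine hb.2 h _ _ 0 _ ⟨_, hk, fun s => ?_, by simp, hk.val.hasDerivAt 0⟩ ?_
      · have : Ψ (0, s • Pi.single 0 1) * (Ψ (0, 0))⁻¹ =
            H (ψ (s • Pi.single 0 1) * (h 0)⁻¹) 0 * (H (ψ 0 * (h 0)⁻¹) 0)⁻¹ := by
          simp [Ψ, translatedHomotopy]
        rw [this]
        exact K.mul_mem (h0 _) (K.inv_mem (h0 _))
      · refine hπ.unique (hΨ.val.hasDerivAt_pd _ _) ?_
        have := hasDerivAt_mul_const_curve (hk.val.hasDerivAt 0) (Ψ (0, 0) : R)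
        simpa using this
    rw [hA1, hA0, sub_zero]
  · intro j _
    exact (((contDiff_fderiv_apply (hG j) (0, Pi.single j 1)).continuous.comp
        (by fun_prop : Continuous fun t : ℝ => (t, (0 : Fin (q + 1) → ℝ)))).const_smul
          ((-1 : ℝ) ^ (j : ℕ))).integrableOn_Icc

theorem exists_bicomplexD_eq [CompleteSpace V] (hπ : IsFrechetRep π)
    (hK : IsSmoothEquivariantDeformationRetract K) (x : bicomplex V K m (q + 1))
    (hx : bicomplexD K m (q + 1) x = 0) : ∃ w : bicomplex V K m q, bicomplexD K m q w = x := by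
  obtain ⟨H, hH, h1, h0, -, hKH⟩ := hK
  replace hH : IsSmoothHomotopy H := hH
  have hcl : IsExtDeriv x.1 0 := by
    have := bicomplexD_spec x
    rwa [hx] at this
  obtain ⟨α, hα⟩ := x
  have hs : IsSmoothForm α := hα.1.1.1
  have hb : IsBasicForm K α := hα.1.1.2
  have hdeg : ∀ (h : Fin (m + 1) → Rˣ) (j : Fin m), h j.castSucc = h j.succ → α h = 0 := hα.2.2
  refine ⟨⟨homotopyOperator hH hπ hs, hπ.mem_deRham ⟨isSmoothForm_homotopyOperator hH hπ hs,
    isBasicForm_homotopyOperator hH hπ hKH hs hb⟩,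
    isInvariantForm_homotopyOperator hH hπ hs hα.2.1, fun h j e => ?_⟩,
    bicomplexD_eq (isExtDeriv_homotopyOperator hH hπ h1 h0 hs hb hcl)⟩
  funext g
  ext x
  rw [homotopyOperator_apply]
  simp [homotopyIntegrand_apply, hdeg h j e]

theorem IsUnitPlot.partialProd {c : Fin m → E → Rˣ} (hc : ∀ j, IsUnitPlot (c j))
    (i : Fin (m + 1)) : IsUnitPlot fun u => Fin.partialProd (fun j => c j u) i := by
  induction i using Fin.induction with
  | zero => simpa using IsUnitPlot.const (E := E) (1 : Rˣ)
  | succ i ih => simpa only [Fin.partialProd_succ] using ih.mul (hc i)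

/-- A closed function is constant along the path from `g` to a point of `K h₀`, and `K`-invariance
then gives its value at `h₀`. So it is a function of the vertices alone, and by invariance it
descends along `toBar`. -/
theorem exists_diffEdge_eq [CompleteSpace V] (hπ : IsFrechetRep π)
    (hK : IsSmoothEquivariantDeformationRetract K) (x : bicomplex V K m 0)
    (hx : bicomplexD K m 0 x = 0) : ∃ f : diffCochains R V m, diffEdge K m f = x := by
  obtain ⟨H, hH, h1, h0, -, hKH⟩ := hK
  replace hH : IsSmoothHomotopy H := hH
  have hcl : IsExtDeriv x.1 0 := by
    have := bicomplexD_spec x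
    rwa [hx] at this
  obtain ⟨α, hα⟩ := x
  have hs : IsSmoothForm α := hα.1.1.1
  have hb : IsBasicForm K α := hα.1.1.2
  have hinv : IsInvariantForm α := hα.2.1
  have hdeg : ∀ (h : Fin (m + 1) → Rˣ) (j : Fin m), h j.castSucc = h j.succ → α h = 0 := hα.2.2
  have hconst : ∀ h g (y : Fin 0 → R), α h g y = α h (h 0) y := by
    intro h g y
    have hd : ∀ t, HasDerivAt (fun t => α h (translatedHomotopy H h g t) y) 0 t := by
      intro t
      have hc : IsSmoothUnitCurve fun t => translatedHomotopy H h g t :=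
        (hH.plot (E := ℝ) (h := fun j _ => h j) (fun _ => .const _) (.const g) contDiff_id).curve
      have h2 := hs.hasDerivAt hπ h hc (x := fun i _ => y i) (fun i => i.elim0) (x' := y)
        (hc.val.hasDerivAt t) (fun i => i.elim0)
      have h3 := hs.extDeriv_eq hπ hcl h (translatedHomotopy H h g t)
        (fun _ => velocity (fun t => (translatedHomotopy H h g t : R)) t)
      rw [Fin.sum_univ_one] at h3
      simp only [Fin.val_zero, pow_zero, one_smul] at h3
      have h4 : (fun i => y i) = (0 : Fin 1).removeNth
          (fun _ => velocity (fun t => (translatedHomotopy H h g t : R)) t) :=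
        Subsingleton.elim _ _
      have h5 : formDeriv α h (translatedHomotopy H h g t) (fun i => y i)
          (velocity (fun t => (translatedHomotopy H h g t : R)) t) = 0 := by
        rw [h4]
        exact h3.symm
      rw [Fin.sum_univ_zero, add_zero, h5] at h2
      exact h2
    have h2 := is_const_of_deriv_eq_zero (fun t => (hd t).differentiableAt)
      (fun t => (hd t).deriv) 1 0
    have h3 : translatedHomotopy H h g 1 = g := by simp [translatedHomotopy, h1]
    rw [h3] at h2
    rw [h2, ← hb.1 h (h 0) (H (g * (h 0)⁻¹) 0) (h0 _) y]
    exact congrArg _ (Subsingleton.elim _ _)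
  -- A section of `toBar` with zeroth vertex `1`: the products telescope, so `σ (toBar h)` is `h`
  -- translated by `h₀⁻¹`. An entry `g j = 1` gives two equal consecutive vertices, so normalisation
  -- is preserved.
  let σ : (Fin m → Rˣ) → Fin (m + 1) → Rˣ := fun g i => (Fin.partialProd g i)⁻¹
  have hσ : ∀ h : Fin (m + 1) → Rˣ, σ (toBar h) = fun i => h i * (h 0)⁻¹ := by
    intro h
    funext i
    simp only [σ]
    induction i using Fin.induction with
    | zero => simp
    | succ i ih =>
      rw [Fin.partialProd_succ, mul_inv_rev, ih]
      simp [toBar]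
  refine ⟨⟨fun g => α (σ g) (σ g 0) Fin.elim0, fun c hc => ?_, fun g hg => ?_⟩,
    Subtype.ext (funext fun h => funext fun g => AlternatingMap.ext fun y => ?_)⟩
  · have hp : ∀ i, IsUnitPlot fun t : ℝ => σ (fun j => c j t) i := fun i =>
      (IsUnitPlot.partialProd (fun j => hπ.isUnitPlot_curve (hc j)) i).inv
    exact hs (fun i t => σ (fun j => c j t) i) _ (fun i _ => Fin.elim0 i) (fun i => (hp i).curve)
      (hp 0).curve fun i => i.elim0
  · obtain ⟨j, hj⟩ := hg
    have : α (σ g) = 0 := hdeg _ j (by simp [σ, Fin.partialProd_succ, hj])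
    simp [this]
  · change α (σ (toBar h)) (σ (toBar h) 0) Fin.elim0 = α h g y
    rw [hσ, hconst h g y, ← hinv (h 0)⁻¹ h (h 0)]
    exact congrArg _ (Subsingleton.elim _ _)

end Columns

/-! ### The quasi-isomorphisms for a group with a Fréchet representation -/

section Criterion

open MeasureTheory

variable {R : Type u} [Ring R] [Algebra ℝ R] [TopologicalSpace R] [IsTopologicalRing R]
  [ContinuousSMul ℝ R]
variable {B : ℕ → Type*} [∀ i, NormedRing (B i)] [∀ i, NormedAlgebra ℝ (B i)]
  [∀ i, CompleteSpace (B i)]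
variable {π : ∀ i, R →ₐ[ℝ] B i}
variable {V : Type v} [NormedAddCommGroup V] [NormedSpace ℝ V] [CompleteSpace V]
variable {E : Type*} [NormedAddCommGroup E] [NormedSpace ℝ E] [FiniteDimensional ℝ E]

theorem IsFrechetRep.quasiIso (hπ : IsFrechetRep π) {L : Type*} [Group L] [TopologicalSpace L]
    [IsTopologicalGroup L] [CompactSpace L] [SecondCountableTopology L] {ι : L →* Rˣ}
    (hι : HasSmoothPlots E ι) (hK : IsSmoothEquivariantDeformationRetract ι.range) :
    QuasiIso (diffToMiddle (V := V) ι.range) ∧ QuasiIso (invariantToMiddle (V := V) ι.range) := by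
  refine ⟨quasiIso_diffToMiddle (fun m q x hx => exists_bicomplexD_eq hπ hK x hx)
    fun m x hx => exists_diffEdge_eq hπ hK x hx, ?_⟩
  let : MeasurableSpace L := borel L
  have : BorelSpace L := ⟨rfl⟩
  -- The Haar measure normalised on the whole group, which is compact; it is a probability measure.
  let μ : Measure L := Measure.haarMeasure ⊤
  have : IsProbabilityMeasure μ := ⟨by
    simpa using! Measure.haarMeasure_self (K₀ := (⊤ : TopologicalSpace.PositiveCompacts L))⟩
  exact quasiIso_invariantToMiddle (fun m q x hx => exists_bicomplexδ_eq hπ hι μ x hx)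
    fun q x hx => exists_invariantEdge_eq hπ x hx

/-- Local parametrisations are defined only near a point, whereas plots are defined on the whole
vector space. Precomposing with this map extends a parametrisation without changing it near 0. -/
theorem exists_contDiff_bounded_eq_id {E : Type*} [NormedAddCommGroup E] [NormedSpace ℝ E]
    [FiniteDimensional ℝ E] {r : ℝ} (hr : 0 < r) :
    ∃ f : E → E, ContDiff ℝ ∞ f ∧ (∀ᶠ u in 𝓝 0, f u = u) ∧ ∀ u, ‖f u‖ < r := by
  let b : ContDiffBump (0 : E) := ⟨r / 4, r / 2, by linarith, by linarith⟩
  refine ⟨fun u => b u • u, b.contDiff.smul contDiff_id, ?_, fun u => ?_⟩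
  · filter_upwards [b.eventuallyEq_one] with u hu
    simp [hu]
  · by_cases hu : ‖u‖ < r / 2
    · rw [norm_smul, Real.norm_of_nonneg b.nonneg]
      have := mul_le_mul_of_nonneg_right (b.le_one (x := u)) (norm_nonneg u)
      linarith
    · have : b u = 0 := b.zero_of_le_dist (by simpa using! hu)
      simp [this, hr]

theorem IsSmoothHom.hasSmoothPlots {d : ℕ} {L : Type*} [Group L] [TopologicalSpace L]
    [ChartedSpace (EuclideanSpace ℝ (Fin d)) L] [IsManifold (𝓡 d) ∞ L] {ι : L →* Rˣ}
    (hι : IsSmoothHom (d := d) ι) : HasSmoothPlots (EuclideanSpace ℝ (Fin d)) ι := by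
  intro k₀
  let e := chartAt (EuclideanSpace ℝ (Fin d)) k₀
  obtain ⟨r, hr, hball⟩ := Metric.isOpen_iff.1 e.open_target (e k₀)
    (mem_chart_target (EuclideanSpace ℝ (Fin d)) k₀)
  obtain ⟨f, hf, hf0, hfr⟩ := exists_contDiff_bounded_eq_id (E := EuclideanSpace ℝ (Fin d)) hr
  refine ⟨fun u => e.symm (e k₀ + f u), ?_, ?_, fun γ hγ => hι _ ?_⟩
  · simp only [hf0.self_of_nhds, add_zero]
    exact e.left_inv (mem_chart_source _ k₀)
  · have h1 : (fun u => e.symm (e k₀ + f u)) =ᶠ[𝓝 0] fun u => e.symm (e k₀ + u) := by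
      filter_upwards [hf0] with u hu
      rw [hu]
    have h2 : Filter.map (fun u => e k₀ + u) (𝓝 (0 : EuclideanSpace ℝ (Fin d))) = 𝓝 (e k₀) := by
      simp
    have h3 := e.symm.map_nhds_eq (x := e k₀) (mem_chart_target (EuclideanSpace ℝ (Fin d)) k₀)
    rw [e.left_inv (mem_chart_source _ k₀)] at h3
    rw [Filter.map_congr h1, ← h3, ← h2, Filter.map_map]
    rfl
  · refine (contMDiffOn_chart_symm (I := 𝓡 d) (x := k₀)).comp_contMDiff
      (contDiff_const.add (hf.comp hγ)).contMDiff fun t => hball ?_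
    simpa using hfr _

end Criterion

/-! ### Representations of Fréchet algebras and of their matrix algebras -/

section Representations

variable {A : Type u} [Ring A] [Algebra ℝ A]

/-- The algebra `A` with the topology of a single submultiplicative seminorm. -/
def SeminormedBy (p : Seminorm ℝ A) (_ : ∀ a b, p (a * b) ≤ p a * p b) : Type u := A

variable {p : Seminorm ℝ A} {hp : ∀ a b, p (a * b) ≤ p a * p b}

instance : Ring (SeminormedBy p hp) := inferInstanceAs (Ring A)

instance : SeminormedRing (SeminormedBy p hp) :=
  { (inferInstance : Ring (SeminormedBy p hp)),
    p.toAddGroupSeminorm.toSeminormedAddCommGroup with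
    norm_mul_le := hp }

instance : Algebra ℝ (SeminormedBy p hp) := inferInstanceAs (Algebra ℝ A)

instance : NormedAlgebra ℝ (SeminormedBy p hp) where
  norm_smul_le r x := (map_smul_eq_mul p r x).le

instance : NormedAlgebra ℝ (UniformSpace.Completion (SeminormedBy p hp)) where
  norm_smul_le := norm_smul_le

variable (p hp) in
/-- The homomorphism of `A` to its completion for the seminorm `p`. -/
def toSeminormCompletion : A →ₐ[ℝ] UniformSpace.Completion (SeminormedBy p hp) where
  __ := (UniformSpace.Completion.coeRingHom :
    SeminormedBy p hp →+* UniformSpace.Completion (SeminormedBy p hp))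
  commutes' _ := rfl

theorem norm_toSeminormCompletion (a : A) : ‖toSeminormCompletion p hp a‖ = p a :=
  UniformSpace.Completion.norm_coe (E := SeminormedBy p hp) a

theorem dist_toSeminormCompletion (a b : A) :
    dist (toSeminormCompletion p hp a) (toSeminormCompletion p hp b) = p (a - b) := by
  rw [dist_eq_norm, ← map_sub, norm_toSeminormCompletion]

/-- Distances in the `i`-th completion between elements of `A` are values of `p i`. So the seminorm
topology is the initial one, and a sequence that is Cauchy in every completion is Cauchy in `A`,
which is complete. -/
theorem isFrechetRep_toSeminormCompletion [UniformSpace A] [IsUniformAddGroup A]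
    [IsTopologicalRing A] [ContinuousSMul ℝ A] [T2Space A] [CompleteSpace A]
    {p : ℕ → Seminorm ℝ A} (hp : ∀ i a b, p i (a * b) ≤ p i a * p i b) (hA : WithSeminorms p) :
    IsFrechetRep fun i => toSeminormCompletion (p i) (hp i) := by
  have hind : Topology.IsInducing fun (x : A) i => toSeminormCompletion (p i) (hp i) x := by
    refine Topology.isInducing_iff_nhds.2 fun x => le_antisymm ?_ ?_
    · rw [← Filter.map_le_iff_le_comap]
      refine tendsto_pi_nhds.2 fun i => Metric.tendsto_nhds.2 fun ε hε => ?_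
      simp only [dist_toSeminormCompletion]
      exact (hA.tendsto_nhds id x).1 Filter.tendsto_id i ε hε
    · rw [← Filter.tendsto_id']
      refine (hA.tendsto_nhds id x).2 fun i ε hε => ?_
      have h := Metric.tendsto_nhds.1 ((continuous_apply i).continuousAt.tendsto.comp
        (Filter.tendsto_comap (f := fun (x : A) i => toSeminormCompletion (p i) (hp i) x)
          (x := 𝓝 fun i => toSeminormCompletion (p i) (hp i) x))) ε hε
      simpa only [Function.comp_apply, dist_toSeminormCompletion] using! h
  refine ⟨⟨hind, hind.injective⟩, fun f hf => ?_⟩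
  have hc : CauchySeq f := by
    rw [cauchySeq_iff_tendsto, uniformity_eq_comap_nhds_zero, Filter.tendsto_comap_iff]
    refine (hA.tendsto_nhds _ _).2 fun i ε hε => ?_
    obtain ⟨N, hN⟩ := Metric.cauchySeq_iff.1 (hf i) ε hε
    filter_upwards [Filter.eventually_ge_atTop (N, N)] with n hn
    have := hN n.2 hn.2 n.1 hn.1
    rw [dist_toSeminormCompletion] at this
    simpa using! this
  obtain ⟨x, hx⟩ := cauchySeq_tendsto_of_complete hc
  exact ⟨x, fun i => (tendsto_pi_nhds.1 ((hind.tendsto_nhds_iff).1 hx)) i⟩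

end Representations

/-! ### Matrix algebras -/

section Matrices

attribute [local instance] Matrix.linftyOpNormedRing Matrix.linftyOpNormedAlgebra

variable {A : Type u} [Ring A] [Algebra ℝ A] [TopologicalSpace A] [IsTopologicalRing A]
  [ContinuousSMul ℝ A]
variable {B : ℕ → Type*} [∀ i, NormedRing (B i)] [∀ i, NormedAlgebra ℝ (B i)]
  [∀ i, CompleteSpace (B i)]
variable {π : ∀ i, A →ₐ[ℝ] B i}

instance completeSpace_matrix {B : Type*} [NormedRing B] [CompleteSpace B] (n : ℕ) :
    @CompleteSpace (Matrix (Fin n) (Fin n) B)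
      (Matrix.linftyOpNormedRing (n := Fin n) (α := B)).toPseudoMetricSpace.toUniformSpace :=
  inferInstanceAs (CompleteSpace (Fin n → Fin n → B))

theorem tendsto_matrix_iff {B : Type*} [NormedRing B] {n : ℕ} {α : Type*} {l : Filter α}
    {f : α → Matrix (Fin n) (Fin n) B} {x : Matrix (Fin n) (Fin n) B} :
    Filter.Tendsto f l (𝓝 x) ↔ ∀ j k, Filter.Tendsto (fun a => f a j k) l (𝓝 (x j k)) :=
  (tendsto_pi_nhds (f := fun a => (f a : Fin n → Fin n → B))).trans
    (forall_congr' fun _ => tendsto_pi_nhds)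

theorem cauchySeq_matrix_apply {B : Type*} [NormedRing B] {n : ℕ}
    {f : ℕ → Matrix (Fin n) (Fin n) B} (hf : CauchySeq f) (j k : Fin n) :
    CauchySeq fun m => f m j k :=
  (((Pi.uniformContinuous_proj (fun _ : Fin n => B) k).comp
    (Pi.uniformContinuous_proj (fun _ : Fin n => Fin n → B) j)).comp_cauchySeq hf)

/-- The operator norm makes matrices over a Banach algebra into a Banach algebra, while its topology
is that of entrywise convergence. Everything is therefore checked entry by entry. -/
theorem IsFrechetRep.mapMatrix (hπ : IsFrechetRep π) (n : ℕ) :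
    IsFrechetRep fun i => ((π i).mapMatrix : Matrix (Fin n) (Fin n) A →ₐ[ℝ]
      Matrix (Fin n) (Fin n) (B i)) := by
  refine ⟨⟨Topology.isInducing_iff_nhds.2 fun x => le_antisymm ?_ ?_, fun x y h => ?_⟩,
    fun f hf => ?_⟩
  · rw [← Filter.map_le_iff_le_comap]
    refine tendsto_pi_nhds.2 fun i => tendsto_matrix_iff.2 fun j k => ?_
    exact hπ.tendsto_iff.1 ((continuous_id.matrix_elem j k).tendsto x) i
  · rw [← Filter.tendsto_id']
    refine tendsto_pi_nhds.2 fun j => tendsto_pi_nhds.2 fun k => hπ.tendsto_iff.2 fun i => ?_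
    have h := tendsto_pi_nhds.1 (Filter.tendsto_comap
      (f := fun (x : Matrix (Fin n) (Fin n) A) i => (π i).mapMatrix x)
      (x := 𝓝 fun i => (π i).mapMatrix x)) i
    exact tendsto_matrix_iff.1 h j k
  · ext j k
    exact hπ.ext fun i => congrFun (congrFun (congrFun h i) j) k
  · have h := fun j k => hπ.exists_limit (fun m => f m j k) fun i =>
      cauchySeq_matrix_apply (hf i) j k
    choose x hx using h
    exact ⟨x, fun i => tendsto_matrix_iff.2 fun j k => hx j k i⟩

variable {V : Type v} [NormedAddCommGroup V] [NormedSpace ℝ V] [CompleteSpace V]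

theorem IsFrechetRep.quasiIso_matrix (hπ : IsFrechetRep π) {n : ℕ} {E : Type*}
    [NormedAddCommGroup E] [NormedSpace ℝ E] [FiniteDimensional ℝ E] {L : Type*} [Group L]
    [TopologicalSpace L] [IsTopologicalGroup L] [CompactSpace L] [SecondCountableTopology L]
    {ι : L →* (Matrix (Fin n) (Fin n) A)ˣ} (hι : HasSmoothPlots E ι)
    (hK : IsSmoothEquivariantDeformationRetract ι.range) :
    QuasiIso (diffToMiddle (V := V) ι.range) ∧ QuasiIso (invariantToMiddle (V := V) ι.range) :=
  (hπ.mapMatrix n).quasiIso hι hK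

end Matrices

theorem quasiIso_of_isFrechetAlgebra {A : Type u} [Ring A] [Algebra ℝ A] [UniformSpace A]
    [IsFrechetAlgebra A] {n d : ℕ} {L : Type w} [Group L] [TopologicalSpace L]
    [ChartedSpace (EuclideanSpace ℝ (Fin d)) L] [LieGroup (𝓡 d) ∞ L] [CompactSpace L]
    {ι : L →* (Matrix (Fin n) (Fin n) A)ˣ} (hι : IsSmoothHom (d := d) ι)
    (hK : IsSmoothEquivariantDeformationRetract ι.range)
    (V : Type v) [NormedAddCommGroup V] [NormedSpace ℝ V] [CompleteSpace V] :
    QuasiIso (diffToMiddle (V := V) ι.range) ∧ QuasiIso (invariantToMiddle (V := V) ι.range) := by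
  obtain ⟨p, hp, hmul⟩ := IsFrechetAlgebra.exists_seminorms (A := A)
  have := topologicalGroup_of_lieGroup (𝓡 d) ∞ (G := L)
  have := ChartedSpace.secondCountable_of_sigmaCompact (EuclideanSpace ℝ (Fin d)) L
  exact (isFrechetRep_toSeminormCompletion hmul hp).quasiIso_matrix hι.hasSmoothPlots hK

/-! ### The unitary factor of an invertible matrix -/

section GramSchmidt

open InnerProductSpace

variable {n : ℕ}

/-- The columns of a matrix. -/
def columns (M : Matrix (Fin n) (Fin n) ℂ) (j : Fin n) : EuclideanSpace ℂ (Fin n) :=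
  WithLp.toLp 2 fun i => M i j

/-- The matrix obtained from `M` by the Gram–Schmidt process, applied to its columns. -/
def unitaryFactor (M : Matrix (Fin n) (Fin n) ℂ) : Matrix (Fin n) (Fin n) ℂ :=
  Matrix.of fun i j => gramSchmidtNormed ℂ (columns M) j i

theorem columns_unitaryFactor (M : Matrix (Fin n) (Fin n) ℂ) :
    columns (unitaryFactor M) = gramSchmidtNormed ℂ (columns M) := rfl

theorem conjTranspose_mul_apply_eq_inner (M N : Matrix (Fin n) (Fin n) ℂ) (i j : Fin n) :
    (M.conjTranspose * N) i j = inner ℂ (columns M i) (columns N j) := by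
  simp [Matrix.mul_apply, PiLp.inner_apply, columns, mul_comm]

theorem linearIndependent_columns {M : Matrix (Fin n) (Fin n) ℂ} (hM : IsUnit M) :
    LinearIndependent ℂ (columns M) :=
  (Matrix.linearIndependent_cols_of_isUnit hM).map'
    (WithLp.linearEquiv 2 ℂ (Fin n → ℂ)).symm.toLinearMap
    (LinearEquiv.ker _)

theorem conjTranspose_unitaryFactor_mul {M : Matrix (Fin n) (Fin n) ℂ} (hM : IsUnit M) :
    (unitaryFactor M).conjTranspose * unitaryFactor M = 1 := by
  ext i j
  have h := orthonormal_iff_ite.1 (gramSchmidtNormed_orthonormal (linearIndependent_columns hM)) i j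
  rw [conjTranspose_mul_apply_eq_inner, columns_unitaryFactor, h, Matrix.one_apply]

theorem unitaryFactor_mem {M : Matrix (Fin n) (Fin n) ℂ} (hM : IsUnit M) :
    unitaryFactor M ∈ unitary (Matrix (Fin n) (Fin n) ℂ) :=
  Unitary.mem_iff.2 ⟨conjTranspose_unitaryFactor_mul hM,
    mul_eq_one_comm.1 (conjTranspose_unitaryFactor_mul hM)⟩

/-- The recursive formula involves only inner products and norms, which an isometry preserves. This
is the source of the unitary equivariance of the Gram–Schmidt factor. -/
theorem gramSchmidt_comp {E : Type*} [NormedAddCommGroup E] [InnerProductSpace ℂ E]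
    (T : E →ₗᵢ[ℂ] E) (f : Fin n → E) (j : Fin n) :
    gramSchmidt ℂ (fun i => T (f i)) j = T (gramSchmidt ℂ f j) := by
  induction j using WellFoundedLT.induction with
  | ind j ih =>
    have h1 := gramSchmidt_def'' ℂ (fun i => T (f i)) j
    have h2 := congrArg T (gramSchmidt_def'' ℂ f j)
    rw [Finset.sum_congr rfl (g := fun i => (inner ℂ (gramSchmidt ℂ f i) (f j) /
      (‖gramSchmidt ℂ f i‖ : ℂ) ^ 2) • T (gramSchmidt ℂ f i))] at h1
    · simp only [map_add, map_sum, map_smul] at h2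
      exact add_right_cancel (h1.symm.trans h2)
    · intro i hi
      rw [ih i (Finset.mem_Iio.1 hi), T.inner_map_map, T.norm_map]
      rfl

/-- A unitary matrix, as an isometry. -/
def unitaryIsometry {k : Matrix (Fin n) (Fin n) ℂ} (hk : k ∈ unitary (Matrix (Fin n) (Fin n) ℂ)) :
    EuclideanSpace ℂ (Fin n) →ₗᵢ[ℂ] EuclideanSpace ℂ (Fin n) :=
  (Matrix.toEuclideanLin k).isometryOfInner fun x y => by
    have h : star (k.mulVec x.ofLp) ⬝ᵥ k.mulVec y.ofLp = star x.ofLp ⬝ᵥ y.ofLp := by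
      have hk' : k.conjTranspose * k = 1 := (Unitary.mem_iff.1 hk).1
      rw [Matrix.star_mulVec, Matrix.dotProduct_mulVec, Matrix.vecMul_vecMul, hk',
        Matrix.vecMul_one]
    simp only [EuclideanSpace.inner_eq_star_dotProduct]
    simpa [dotProduct_comm] using! h

theorem columns_mul {k : Matrix (Fin n) (Fin n) ℂ} (hk : k ∈ unitary (Matrix (Fin n) (Fin n) ℂ))
    (M : Matrix (Fin n) (Fin n) ℂ) (j : Fin n) :
    columns (k * M) j = unitaryIsometry hk (columns M j) := rfl

theorem unitaryFactor_mul {k : Matrix (Fin n) (Fin n) ℂ}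
    (hk : k ∈ unitary (Matrix (Fin n) (Fin n) ℂ)) (M : Matrix (Fin n) (Fin n) ℂ) :
    unitaryFactor (k * M) = k * unitaryFactor M := by
  ext i j
  have h : gramSchmidtNormed ℂ (columns (k * M)) j =
      unitaryIsometry hk (gramSchmidtNormed ℂ (columns M) j) := by
    have := gramSchmidt_comp (unitaryIsometry hk) (columns M) j
    simp only [gramSchmidtNormed, map_smul, ← this, ← columns_mul]
    rw [← (unitaryIsometry hk).norm_map (gramSchmidt ℂ (columns M) j), ← this]
    rfl
  exact congrArg (fun x : EuclideanSpace ℂ (Fin n) => x i) h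

theorem unitaryFactor_one : unitaryFactor (1 : Matrix (Fin n) (Fin n) ℂ) = 1 := by
  have h : Orthonormal ℂ (columns (1 : Matrix (Fin n) (Fin n) ℂ)) := by
    refine orthonormal_iff_ite.2 fun i j => ?_
    rw [← conjTranspose_mul_apply_eq_inner, Matrix.conjTranspose_one, one_mul, Matrix.one_apply]
  ext i j
  change gramSchmidtNormed ℂ (columns 1) j i = _
  have h1 := gramSchmidt_of_orthogonal ℂ (f := columns (1 : Matrix (Fin n) (Fin n) ℂ)) h.2
  rw [gramSchmidtNormed, h1, h.1 j]
  simp [columns]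

theorem unitaryFactor_of_mem {k : Matrix (Fin n) (Fin n) ℂ}
    (hk : k ∈ unitary (Matrix (Fin n) (Fin n) ℂ)) : unitaryFactor k = k := by
  simpa [unitaryFactor_one] using unitaryFactor_mul hk 1

/-- Squared norms are written as inner products, so the recursion is rational in smooth functions.
The denominators do not vanish because the vectors are independent. -/
theorem contDiff_gramSchmidt {E : Type*} [NormedAddCommGroup E] [InnerProductSpace ℂ E]
    {f : ℝ → Fin n → E} (hf : ∀ j, ContDiff ℝ ∞ fun t => f t j)
    (hli : ∀ t, LinearIndependent ℂ (f t)) (j : Fin n) :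
    ContDiff ℝ ∞ fun t => gramSchmidt ℂ (f t) j := by
  induction j using WellFoundedLT.induction with
  | ind j ih =>
    have h : ∀ t, gramSchmidt ℂ (f t) j = f t j - ∑ i ∈ Finset.Iio j,
        (inner ℂ (gramSchmidt ℂ (f t) i) (f t j) *
          (inner ℂ (gramSchmidt ℂ (f t) i) (gramSchmidt ℂ (f t) i))⁻¹) •
            gramSchmidt ℂ (f t) i := fun t => by
      simp only [inner_self_eq_norm_sq_to_K, ← div_eq_mul_inv]
      exact eq_sub_of_add_eq (gramSchmidt_def'' ℂ (f t) j).symm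
    simp only [h]
    refine (hf j).sub (ContDiff.sum fun i hi => ?_)
    have hi := ih i (Finset.mem_Iio.1 hi)
    refine ContDiff.smul (ContDiff.mul (hi.inner ℂ (hf j)) ((hi.inner ℂ hi).inv fun t => ?_)) hi
    exact inner_self_ne_zero.2 (gramSchmidt_ne_zero i (hli t))

theorem contDiff_unitaryFactor {c : ℝ → Matrix (Fin n) (Fin n) ℂ}
    (hc : ∀ i j, ContDiff ℝ ∞ fun t => c t i j) (hu : ∀ t, IsUnit (c t)) (i j : Fin n) :
    ContDiff ℝ ∞ fun t => unitaryFactor (c t) i j := by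
  have h1 : ContDiff ℝ ∞ fun t => gramSchmidt ℂ (columns (c t)) j :=
    contDiff_gramSchmidt (fun j => contDiff_piLp (p := 2) |>.2 fun i => hc i j)
      (fun t => linearIndependent_columns (hu t)) j
  have h2 : ContDiff ℝ ∞ fun t => ((‖gramSchmidt ℂ (columns (c t)) j‖⁻¹ : ℝ) : ℂ) :=
    Complex.ofRealCLM.contDiff.comp ((h1.norm ℂ fun t => gramSchmidt_ne_zero j
      (linearIndependent_columns (hu t))).inv fun t => norm_ne_zero_iff.2
        (gramSchmidt_ne_zero j (linearIndependent_columns (hu t))))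
  have h3 := (contDiff_piLp (p := 2)).1 (h2.smul h1) i
  simpa [unitaryFactor, gramSchmidtNormed] using! h3

/-- The segment from `1` to `M⁻¹ Q`, with `Q` the unitary factor of `M`, consists of invertible
matrices. -/
theorem isUnit_segment {M M' : Matrix (Fin n) (Fin n) ℂ} (hM : M * M' = 1) {a : ℝ} (h0 : 0 ≤ a)
    (h1 : a ≤ 1) :
    IsUnit (a • (1 : Matrix (Fin n) (Fin n) ℂ) + (1 - a) • (M' * unitaryFactor M)) := by
  have hMu : IsUnit M := ⟨⟨M, M', hM, mul_eq_one_comm.1 hM⟩, rfl⟩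
  have hQ := conjTranspose_unitaryFactor_mul hMu
  set Q := unitaryFactor M
  -- `T` is upper triangular with diagonal entries the positive norms of the Gram–Schmidt vectors.
  -- Multiplying the segment by `T` gives `a T + (1 - a)`, which is triangular with positive
  -- diagonal, so its determinant is nonzero.
  set T := Q.conjTranspose * M with hT
  have hne := fun i => gramSchmidt_ne_zero i (linearIndependent_columns hMu)
  have hin : ∀ i j, T i j = ((‖gramSchmidt ℂ (columns M) i‖⁻¹ : ℝ) : ℂ) *
      inner ℂ (gramSchmidt ℂ (columns M) i) (columns M j) := by
    intro i j
    rw [hT, conjTranspose_mul_apply_eq_inner, columns_unitaryFactor, gramSchmidtNormed,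
      inner_smul_left]
    simp
  have htri : ∀ i j, j < i → T i j = 0 := fun i j hij => by
    rw [hin, gramSchmidt_inv_triangular ℂ _ hij, mul_zero]
  have hdiag : ∀ i, T i i = (‖gramSchmidt ℂ (columns M) i‖ : ℂ) := fun i => by
    have : inner ℂ (gramSchmidt ℂ (columns M) i) (columns M i) =
        (‖gramSchmidt ℂ (columns M) i‖ : ℂ) ^ 2 := by
      have h2 : inner ℂ (gramSchmidt ℂ (columns M) i) (gramSchmidt ℂ (columns M) i) =
          (‖gramSchmidt ℂ (columns M) i‖ : ℂ) ^ 2 :=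
        inner_self_eq_norm_sq_to_K (𝕜 := ℂ) (gramSchmidt ℂ (columns M) i)
      rw [← h2]
      conv_lhs => rw [gramSchmidt_def'' ℂ (columns M) i]
      rw [inner_add_right, inner_sum, add_eq_left]
      refine Finset.sum_eq_zero fun k hk => ?_
      rw [inner_smul_right, gramSchmidt_orthogonal ℂ _ (Finset.mem_Iio.1 hk).ne', mul_zero]
    rw [hin, this]
    have : (‖gramSchmidt ℂ (columns M) i‖ : ℂ) ≠ 0 := by exact_mod_cast norm_ne_zero_iff.2 (hne i)
    push_cast
    field_simp
  have hprod : T * (a • (1 : Matrix (Fin n) (Fin n) ℂ) + (1 - a) • (M' * Q)) =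
      a • T + (1 - a) • (1 : Matrix (Fin n) (Fin n) ℂ) := by
    rw [mul_add, mul_smul_comm, mul_smul_comm, mul_one, hT, Matrix.mul_assoc, ← Matrix.mul_assoc M,
      hM, Matrix.one_mul, hQ]
  have hdet : (a • T + (1 - a) • (1 : Matrix (Fin n) (Fin n) ℂ)).det ≠ 0 := by
    rw [Matrix.det_of_isUpperTriangular]
    · refine Finset.prod_ne_zero_iff.2 fun i _ => ?_
      have h2 : (a • T + (1 - a) • (1 : Matrix (Fin n) (Fin n) ℂ)) i i =
          ((a * ‖gramSchmidt ℂ (columns M) i‖ + (1 - a) : ℝ) : ℂ) := by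
        simp [hdiag]
      rw [h2]
      norm_cast
      have := norm_pos_iff.2 (hne i)
      rcases h0.eq_or_lt with rfl | h0
      · simp
      · have := mul_pos h0 this
        linarith
    · intro i j hij
      have hij' : j < i := hij
      simp [htri i j hij', Matrix.one_apply_ne hij'.ne']
  rw [← hprod, Matrix.det_mul] at hdet
  exact (Matrix.isUnit_iff_isUnit_det _).2 (isUnit_iff_ne_zero.2 (right_ne_zero_of_mul hdet))

end GramSchmidt

/-! ### Limits of holomorphic functions of several variables -/

section Limits

variable {E : Type*} [NormedAddCommGroup E] [NormedSpace ℂ E]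

theorem norm_fderiv_le_of_forall_ball {f : E → ℂ} {c : E} {r b : ℝ} (hr : 0 < r)
    (hf : DifferentiableOn ℂ f (Metric.ball c r)) (hb : ∀ z ∈ Metric.ball c r, ‖f z‖ < b) :
    ‖fderiv ℂ f c‖ ≤ 2 * b / r := by
  refine Complex.norm_fderiv_le_div_of_mapsTo_ball hf (fun z hz => ?_) hr
  have h1 := hb z hz
  have h2 := hb c (Metric.mem_ball_self hr)
  rw [mem_closedBall_iff_norm]
  linarith [norm_sub_le (f z) (f c)]

/-- Weierstrass's theorem in several variables. Cauchy's estimate on balls of radius `r / 2` makes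
the derivatives uniformly Cauchy on the half ball, so limit and derivative can be exchanged. -/
theorem differentiableAt_of_uniformCauchySeqOn {F : ℕ → E → ℂ} {g : E → ℂ} {x : E} {r : ℝ}
    (hr : 0 < r) (hF : ∀ n, DifferentiableOn ℂ (F n) (Metric.ball x r))
    (hu : UniformCauchySeqOn F Filter.atTop (Metric.ball x r))
    (hg : ∀ z ∈ Metric.ball x r, Filter.Tendsto (fun n => F n z) Filter.atTop (𝓝 (g z))) :
    DifferentiableAt ℂ g x := by
  have hsub : ∀ z ∈ Metric.ball x (r / 2), Metric.ball z (r / 2) ⊆ Metric.ball x r := by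
    intro z hz
    refine Metric.ball_subset_ball' ?_
    have := Metric.mem_ball.1 hz
    linarith
  have hd : ∀ n, ∀ z ∈ Metric.ball x (r / 2), DifferentiableAt ℂ (F n) z := fun n z hz =>
    (hF n).differentiableAt (Metric.isOpen_ball.mem_nhds
      (Metric.ball_subset_ball (by linarith) hz))
  have hc : UniformCauchySeqOn (fun n => fderiv ℂ (F n)) Filter.atTop (Metric.ball x (r / 2)) := by
    rw [Metric.uniformCauchySeqOn_iff] at hu ⊢
    intro ε hε
    -- Cauchy's estimate turns this bound into `2 (ε r / 8) / (r / 2) = ε / 2`.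
    obtain ⟨N, hN⟩ := hu (ε * r / 8) (by positivity)
    refine ⟨N, fun m hm n hn z hz => ?_⟩
    rw [dist_eq_norm, ← fderiv_sub (hd m z hz) (hd n z hz)]
    refine (norm_fderiv_le_of_forall_ball (b := ε * r / 8) (half_pos hr)
      (((hF m).sub (hF n)).mono (hsub z hz)) fun w hw => ?_).trans_lt ?_
    · have := hN m hm n hn w (hsub z hz hw)
      rwa [dist_eq_norm] at this
    · have : 2 * (ε * r / 8) / (r / 2) = ε / 2 := by
        field_simp
        norm_num
      rw [this]
      linarith
  have hlim : ∀ z ∈ Metric.ball x (r / 2), ∃ y, Filter.Tendsto (fun n => fderiv ℂ (F n) z)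
      Filter.atTop (𝓝 y) := fun z hz =>
    cauchySeq_tendsto_of_complete (Metric.cauchySeq_iff.2 fun ε hε => by
      obtain ⟨N, hN⟩ := Metric.uniformCauchySeqOn_iff.1 hc ε hε
      exact ⟨N, fun m hm n hn => hN m hm n hn z hz⟩)
  choose! g' hg' using hlim
  exact (hasFDerivAt_of_tendstoUniformlyOn Metric.isOpen_ball
    (hc.tendstoUniformlyOn_of_tendsto hg') (fun n z hz => (hd n z hz).hasFDerivAt)
    (fun z hz => hg z (Metric.ball_subset_ball (by linarith) hz))
    (Metric.mem_ball_self (half_pos hr))).differentiableAt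

end Limits

/-! ### The Fréchet algebra of holomorphic functions on a polydisc -/

section HolomorphicFunctions

theorem mdifferentiable_subtype_iff {E F : Type*} [NormedAddCommGroup E] [NormedSpace ℂ E]
    [NormedAddCommGroup F] [NormedSpace ℂ F] {U : TopologicalSpace.Opens E} {f : E → F} :
    MDifferentiable 𝓘(ℂ, E) 𝓘(ℂ, F) (fun x : U => f x) ↔ ∀ x ∈ U, DifferentiableAt ℂ f x := by
  have h : ∀ x : U, MDifferentiableAt 𝓘(ℂ, E) 𝓘(ℂ, F) (fun x : U => f x) x ↔
      DifferentiableAt ℂ f x := fun x => by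
    rw [← mdifferentiableAt_iff_differentiableAt]
    exact ((differentiableWithinAt_localInvariantProp (I := 𝓘(ℂ, E))
      (I' := 𝓘(ℂ, F))).liftPropAt_iff_comp_subtype_val f x).symm
  exact ⟨fun H x hx => (h ⟨x, hx⟩).1 (H _), fun H x => (h x).2 (H x x.2)⟩

variable {d : ℕ}

theorem mem_unitPolydisc_iff {z : Fin d → ℂ} : z ∈ unitPolydisc d ↔ ‖z‖ < 1 :=
  (pi_norm_lt_iff one_pos).symm

theorem mem_unitPolydisc_of_mem_closedBall {r : ℝ} (hr : r < 1) {z : Fin d → ℂ}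
    (hz : z ∈ Metric.closedBall 0 r) : z ∈ unitPolydisc d :=
  mem_unitPolydisc_iff.2 ((mem_closedBall_zero_iff.1 hz).trans_lt hr)

variable {X : Type*} [TopologicalSpace X] [ChartedSpace (Fin d → ℂ) X]
  {B : TopologicalSpace.Opens X}

theorem HolAlg.ext {f g : HolAlg d B} (h : ∀ x, f.1 x = g.1 x) : f = g :=
  Subtype.ext (ContinuousMap.ext h)

open Classical in
/-- A holomorphic function on `B`, in the coordinates of the polydisc, and extended by zero. -/
def polydiscValue (φ : B ≃ₜ unitPolydisc d) (f : HolAlg d B) (z : Fin d → ℂ) : ℂ :=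
  if h : z ∈ unitPolydisc d then f.1 (φ.symm ⟨z, h⟩) else 0

theorem polydiscValue_of_mem (φ : B ≃ₜ unitPolydisc d) (f : HolAlg d B) {z : Fin d → ℂ}
    (h : z ∈ unitPolydisc d) : polydiscValue φ f z = f.1 (φ.symm ⟨z, h⟩) := dif_pos h

theorem polydiscValue_apply (φ : B ≃ₜ unitPolydisc d) (f : HolAlg d B) (x : B) :
    polydiscValue φ f (φ x) = f.1 x := by
  rw [polydiscValue_of_mem φ f (φ x).2]
  simp

theorem differentiableAt_polydiscValue {φ : B ≃ₜ unitPolydisc d}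
    (hφ : MDifferentiable 𝓘(ℂ, Fin d → ℂ) 𝓘(ℂ, Fin d → ℂ) φ.symm) (f : HolAlg d B)
    {z : Fin d → ℂ} (hz : z ∈ unitPolydisc d) : DifferentiableAt ℂ (polydiscValue φ f) z := by
  refine mdifferentiable_subtype_iff.1 ?_ z hz
  have hf : MDifferentiable 𝓘(ℂ, Fin d → ℂ) 𝓘(ℂ) (f.1 : B → ℂ) := f.2
  have h := hf.comp hφ
  convert! h using 2
  exact polydiscValue_of_mem φ f (Subtype.mem _)

/-- The holomorphic function on `B` with a given expression in the coordinates of the polydisc. -/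
def ofPolydiscValue {φ : B ≃ₜ unitPolydisc d}
    (hφ : MDifferentiable 𝓘(ℂ, Fin d → ℂ) 𝓘(ℂ, Fin d → ℂ) φ) (F : (Fin d → ℂ) → ℂ)
    (hF : ∀ z ∈ unitPolydisc d, DifferentiableAt ℂ F z) : HolAlg d B :=
  have h : MDifferentiable 𝓘(ℂ, Fin d → ℂ) 𝓘(ℂ) fun x : B => F (φ x) :=
    (mdifferentiable_subtype_iff.2 hF).comp hφ
  ⟨⟨fun x => F (φ x), h.continuous⟩, h⟩

/-- Restriction of holomorphic functions to a closed polydisc. -/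
def restrictDisc (φ : B ≃ₜ unitPolydisc d) {r : ℝ} (hr : r < 1) :
    HolAlg d B →ₐ[ℝ] C(Metric.closedBall (0 : Fin d → ℂ) r, ℂ) where
  toFun f := f.1.comp ⟨fun z => φ.symm ⟨z, mem_unitPolydisc_of_mem_closedBall hr z.2⟩, by fun_prop⟩
  map_one' := rfl
  map_mul' _ _ := rfl
  map_zero' := rfl
  map_add' _ _ := rfl
  commutes' _ := rfl

theorem restrictDisc_apply (φ : B ≃ₜ unitPolydisc d) {r : ℝ} (hr : r < 1) (f : HolAlg d B)
    (z : Metric.closedBall (0 : Fin d → ℂ) r) : restrictDisc φ hr f z = polydiscValue φ f z :=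
  (polydiscValue_of_mem φ f _).symm

theorem continuous_restrictDisc (φ : B ≃ₜ unitPolydisc d) {r : ℝ} (hr : r < 1) :
    Continuous (restrictDisc φ hr) :=
  (ContinuousMap.continuous_precomp _).comp continuous_subtype_val

/-- The radii of an exhaustion of the polydisc. -/
def discRadius (m : ℕ) : ℝ := 1 - 1 / (m + 1)

theorem discRadius_lt (m : ℕ) : discRadius m < 1 := by
  have : (0 : ℝ) < 1 / (m + 1) := by positivity
  rw [discRadius]
  linarith

theorem discRadius_nonneg (m : ℕ) : 0 ≤ discRadius m := by
  rw [discRadius, sub_nonneg, div_le_one (by positivity)]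
  linarith [(m.cast_nonneg : (0 : ℝ) ≤ m)]

theorem exists_lt_discRadius {r : ℝ} (hr : r < 1) : ∃ m, r < discRadius m := by
  obtain ⟨m, hm⟩ := exists_nat_one_div_lt (sub_pos.2 hr)
  exact ⟨m, by rw [discRadius]; linarith⟩

theorem exists_norm_le_discRadius (φ : B ≃ₜ unitPolydisc d) {C : Set B} (hC : IsCompact C) :
    ∃ m, ∀ x ∈ C, ((φ x : Fin d → ℂ)) ∈ Metric.closedBall 0 (discRadius m) := by
  rcases C.eq_empty_or_nonempty with rfl | hne
  · exact ⟨0, fun _ h => h.elim⟩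
  · obtain ⟨x, hx, hmax⟩ := hC.exists_isMaxOn hne
      (f := fun x => ‖(φ x : Fin d → ℂ)‖) (by fun_prop)
    obtain ⟨m, hm⟩ := exists_lt_discRadius (mem_unitPolydisc_iff.1 (φ x).2)
    exact ⟨m, fun y hy => mem_closedBall_zero_iff.2 ((hmax hy).trans hm.le)⟩

/-- Every compact subset of `B` lies in one of the closed polydiscs, so uniform convergence on these
countably many sets is uniform convergence on compact sets. -/
theorem isInducing_restrictDisc (φ : B ≃ₜ unitPolydisc d) :
    Topology.IsInducing fun (f : HolAlg d B) m => restrictDisc φ (discRadius_lt m) f := by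
  refine Topology.isInducing_iff_nhds.2 fun f => le_antisymm ?_ ?_
  · rw [← Filter.map_le_iff_le_comap]
    exact tendsto_pi_nhds.2 fun m => (continuous_restrictDisc φ (discRadius_lt m)).tendsto f
  · rw [← Filter.tendsto_id']
    refine (Topology.IsInducing.subtypeVal
      (t := (holomorphicFunctions d B : Set C(B, ℂ)))).tendsto_nhds_iff.2 ?_
    refine ContinuousMap.tendsto_iff_forall_isCompact_tendstoUniformlyOn.2 fun C hC => ?_
    obtain ⟨m, hm⟩ := exists_norm_le_discRadius φ hC
    refine Metric.tendstoUniformlyOn_iff.2 fun ε hε => ?_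
    have h := tendsto_pi_nhds.1 (Filter.tendsto_comap
      (f := fun (f : HolAlg d B) m => restrictDisc φ (discRadius_lt m) f)
      (x := 𝓝 fun m => restrictDisc φ (discRadius_lt m) f)) m
    filter_upwards [Metric.tendsto_nhds.1 h ε hε] with g hg x hx
    have h1 := (ContinuousMap.dist_apply_le_dist (⟨φ x, hm x hx⟩ :
      Metric.closedBall (0 : Fin d → ℂ) (discRadius m))).trans_lt hg
    rw [restrictDisc_apply, restrictDisc_apply, polydiscValue_apply, polydiscValue_apply,
      dist_comm] at h1
    exact h1

/-- A sequence that is Cauchy on each closed polydisc has a locally uniform limit, which is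
holomorphic by Weierstrass's theorem. The Banach algebras are those of continuous functions on the
polydiscs. -/
theorem isFrechetRep_restrictDisc {φ : B ≃ₜ unitPolydisc d}
    (hφ : MDifferentiable 𝓘(ℂ, Fin d → ℂ) 𝓘(ℂ, Fin d → ℂ) φ)
    (hφ' : MDifferentiable 𝓘(ℂ, Fin d → ℂ) 𝓘(ℂ, Fin d → ℂ) φ.symm) :
    IsFrechetRep fun m => restrictDisc φ (discRadius_lt m) := by
  refine ⟨⟨isInducing_restrictDisc φ, fun f g h => HolAlg.ext fun x => ?_⟩, fun f hf => ?_⟩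
  · obtain ⟨m, hm⟩ := exists_norm_le_discRadius φ (isCompact_singleton (x := x))
    have := DFunLike.congr_fun (congrFun h m) ⟨φ x, hm x rfl⟩
    simpa only [restrictDisc_apply, polydiscValue_apply] using this
  · have hu : ∀ m, UniformCauchySeqOn (fun n => polydiscValue φ (f n)) Filter.atTop
        (Metric.closedBall 0 (discRadius m)) := by
      intro m
      refine Metric.uniformCauchySeqOn_iff.2 fun ε hε => ?_
      obtain ⟨N, hN⟩ := Metric.cauchySeq_iff.1 (hf m) ε hε
      refine ⟨N, fun k hk l hl z hz => ?_⟩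
      have := (ContinuousMap.dist_apply_le_dist (⟨z, hz⟩ :
        Metric.closedBall (0 : Fin d → ℂ) (discRadius m))).trans_lt (hN k hk l hl)
      rwa [restrictDisc_apply, restrictDisc_apply] at this
    have hlim : ∀ z ∈ unitPolydisc d, ∃ y,
        Filter.Tendsto (fun n => polydiscValue φ (f n) z) Filter.atTop (𝓝 y) := by
      intro z hz
      obtain ⟨m, hm⟩ := exists_lt_discRadius (mem_unitPolydisc_iff.1 hz)
      refine cauchySeq_tendsto_of_complete (Metric.cauchySeq_iff.2 fun ε hε => ?_)
      obtain ⟨N, hN⟩ := Metric.uniformCauchySeqOn_iff.1 (hu m) ε hε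
      exact ⟨N, fun k hk l hl => hN k hk l hl z (mem_closedBall_zero_iff.2 hm.le)⟩
    choose! g hg using hlim
    have hdiff : ∀ z ∈ unitPolydisc d, DifferentiableAt ℂ g z := by
      intro z hz
      obtain ⟨m, hm⟩ := exists_lt_discRadius (mem_unitPolydisc_iff.1 hz)
      have hsub : Metric.ball z (discRadius m - ‖z‖) ⊆ Metric.closedBall 0 (discRadius m) := by
        refine (Metric.ball_subset_ball' (ε₂ := discRadius m) ?_).trans
          Metric.ball_subset_closedBall
        rw [dist_zero_right]
        linarith
      exact differentiableAt_of_uniformCauchySeqOn (sub_pos.2 hm)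
        (fun n w hw => (differentiableAt_polydiscValue hφ' (f n)
          (mem_unitPolydisc_of_mem_closedBall (discRadius_lt m) (hsub hw))).differentiableWithinAt)
        ((hu m).mono hsub)
        fun w hw => hg w (mem_unitPolydisc_of_mem_closedBall (discRadius_lt m) (hsub hw))
    refine ⟨ofPolydiscValue hφ g hdiff, fun m => ?_⟩
    have h1 := (hu m).tendstoUniformlyOn_of_tendsto (f := g) fun z hz =>
      hg z (mem_unitPolydisc_of_mem_closedBall (discRadius_lt m) hz)
    rw [ContinuousMap.tendsto_iff_tendstoUniformly]
    refine Metric.tendstoUniformly_iff.2 fun ε hε => ?_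
    filter_upwards [Metric.tendstoUniformlyOn_iff.1 h1 ε hε] with n hn z
    have h2 : restrictDisc φ (discRadius_lt m) (ofPolydiscValue hφ g hdiff) z = g z := by
      change g (φ (φ.symm _)) = _
      rw [φ.apply_symm_apply]
    rw [h2, restrictDisc_apply]
    exact hn z z.2

end HolomorphicFunctions

/-! ### Families of smooth curves with continuous derivatives -/

section JointlySmooth

variable {X : Type*} [TopologicalSpace X] {V : Type*} [NormedAddCommGroup V] [NormedSpace ℝ V]

/-- The curves `F x` are smooth, and their derivatives depend continuously on `x` as well. -/
structure JointlySmooth (F : X → ℝ → V) : Prop where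
  contDiff : ∀ x, ContDiff ℝ ∞ (F x)
  continuous : ∀ k, Continuous fun p : X × ℝ => iteratedDeriv k (F p.1) p.2

theorem JointlySmooth.deriv {F : X → ℝ → V} (hF : JointlySmooth F) :
    JointlySmooth fun x => deriv (F x) where
  contDiff x := (contDiff_infty_iff_deriv.1 (hF.contDiff x)).2
  continuous k := by simpa only [iteratedDeriv_succ'] using hF.continuous (k + 1)

theorem JointlySmooth.smul [NormedSpace ℂ V] {K : X → ℝ → ℂ} {F : X → ℝ → V}
    (hK : JointlySmooth K) (hF : JointlySmooth F) : JointlySmooth fun x t => K x t • F x t where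
  contDiff x := (hK.contDiff x).smul (hF.contDiff x)
  continuous k := by
    induction k generalizing K F with
    | zero => simpa using! (hK.continuous 0).smul (hF.continuous 0)
    | succ k ih =>
      have h1 := ih hK hF.deriv
      have h2 := ih hK.deriv hF
      refine (h1.add h2).congr fun p => ?_
      have hd : _root_.deriv (fun t => K p.1 t • F p.1 t) =
          fun t => K p.1 t • _root_.deriv (F p.1) t + _root_.deriv (K p.1) t • F p.1 t := by
        funext t
        exact deriv_fun_smul ((hK.contDiff p.1).differentiable (by simp) t)
          ((hF.contDiff p.1).differentiable (by simp) t)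
      rw [iteratedDeriv_succ', hd]
      exact (iteratedDeriv_fun_add
        (((hK.contDiff p.1).smul (hF.deriv.contDiff p.1)).contDiffAt.of_le (natCast_le_infty k))
        (((hK.deriv.contDiff p.1).smul (hF.contDiff p.1)).contDiffAt.of_le
          (natCast_le_infty k))).symm

theorem jointlySmooth_of_contDiff {E : Type*} [NormedAddCommGroup E] [NormedSpace ℝ E]
    {F : E → ℝ → V} (hF : ContDiff ℝ ∞ fun p : E × ℝ => F p.1 p.2) : JointlySmooth F where
  contDiff _ := hF.comp (contDiff_const.prodMk contDiff_id)
  continuous k := (contDiff_iteratedDeriv_right hF k).continuous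

/-- Only joint continuity of `(x, w) ↦ Λ x w` is assumed, not continuity of `Λ` in operator norm.
Composition with rotations is in general only strongly continuous. -/
theorem jointlySmooth_clm {W : Type*} [NormedAddCommGroup W] [NormedSpace ℝ W]
    {Λ : X → W →L[ℝ] V} (hΛ : Continuous fun p : X × W => Λ p.1 p.2) {u : ℝ → W}
    (hu : ContDiff ℝ ∞ u) : JointlySmooth fun x t => Λ x (u t) where
  contDiff x := (Λ x).contDiff.comp hu
  continuous k := by
    have h : ∀ x, iteratedDeriv k (fun t => Λ x (u t)) = fun t => Λ x (iteratedDeriv k u t) := by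
      intro x
      induction k with
      | zero => simp
      | succ k ih =>
        funext t
        rw [iteratedDeriv_succ, ih]
        exact ((Λ x).hasFDerivAt.comp_hasDerivAt t (hasDerivAt_iteratedDeriv hu k t)).deriv
    simp only [h]
    exact hΛ.comp (continuous_fst.prodMk
      ((hu.continuous_iteratedDeriv k (natCast_le_infty k)).comp continuous_snd))

end JointlySmooth

theorem IsSmoothCurve.contDiff_comp {A : Type*} [AddCommGroup A] [Module ℝ A]
    [TopologicalSpace A] [ContinuousSMul ℝ A] [IsTopologicalAddGroup A] {V : Type*}
    [NormedAddCommGroup V] [NormedSpace ℝ V] (l : A →ₗ[ℝ] V) (hl : Continuous l) {γ : ℝ → A}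
    (hγ : IsSmoothCurve γ) : ContDiff ℝ ∞ fun t => l (γ t) := by
  obtain ⟨c, rfl, hc⟩ := hγ
  refine contDiff_of_hasDerivAt_seq (c := fun k t => l (c k t)) fun k t => ?_
  have h := (hl.tendsto _).comp (hasDerivAt_iff_tendsto_quotient.1 (hc k t))
  refine hasDerivAt_iff_tendsto_quotient.2 ?_
  simpa only [Function.comp_def, map_smul, map_sub] using h

/-! ### Dilations of the polydisc -/

section Dilations

variable {d : ℕ} {X : Type*} [TopologicalSpace X] [ChartedSpace (Fin d → ℂ) X]
  {B : TopologicalSpace.Opens X} {φ : B ≃ₜ unitPolydisc d}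

theorem smul_mem_unitPolydisc (a : unitInterval) {z : Fin d → ℂ} (hz : z ∈ unitPolydisc d) :
    (a : ℝ) • z ∈ unitPolydisc d := by
  rw [mem_unitPolydisc_iff] at hz ⊢
  rw [norm_smul, Real.norm_of_nonneg a.2.1]
  exact (mul_le_of_le_one_left (norm_nonneg z) a.2.2).trans_lt hz

theorem differentiableAt_polydiscValue_smul
    (hφ' : MDifferentiable 𝓘(ℂ, Fin d → ℂ) 𝓘(ℂ, Fin d → ℂ) φ.symm)
    (f : HolAlg d B) (a : unitInterval)
    {z : Fin d → ℂ} (hz : z ∈ unitPolydisc d) :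
    DifferentiableAt ℂ (fun z => polydiscValue φ f ((a : ℝ) • z)) z :=
  (differentiableAt_polydiscValue hφ' f (smul_mem_unitPolydisc a hz)).comp z
    (differentiableAt_id.const_smul (a : ℝ))

/-- The dilation `f ↦ f(a z)` of holomorphic functions on the polydisc. -/
def dilate (hφ : MDifferentiable 𝓘(ℂ, Fin d → ℂ) 𝓘(ℂ, Fin d → ℂ) φ)
    (hφ' : MDifferentiable 𝓘(ℂ, Fin d → ℂ) 𝓘(ℂ, Fin d → ℂ) φ.symm)
    (a : unitInterval) : HolAlg d B →+* HolAlg d B where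
  toFun f := ofPolydiscValue hφ (fun z => polydiscValue φ f ((a : ℝ) • z))
    fun _ hz => differentiableAt_polydiscValue_smul hφ' f a hz
  map_one' := HolAlg.ext fun x => polydiscValue_of_mem φ 1 (smul_mem_unitPolydisc a (φ x).2)
  map_zero' := HolAlg.ext fun x => polydiscValue_of_mem φ 0 (smul_mem_unitPolydisc a (φ x).2)
  map_mul' f g := HolAlg.ext fun x => by
    have h := smul_mem_unitPolydisc a (φ x).2
    change polydiscValue φ (f * g) _ = polydiscValue φ f _ * polydiscValue φ g _
    rw [polydiscValue_of_mem φ _ h, polydiscValue_of_mem φ _ h, polydiscValue_of_mem φ _ h]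
    rfl
  map_add' f g := HolAlg.ext fun x => by
    have h := smul_mem_unitPolydisc a (φ x).2
    change polydiscValue φ (f + g) _ = polydiscValue φ f _ + polydiscValue φ g _
    rw [polydiscValue_of_mem φ _ h, polydiscValue_of_mem φ _ h, polydiscValue_of_mem φ _ h]
    rfl

theorem polydiscValue_dilate (hφ : MDifferentiable 𝓘(ℂ, Fin d → ℂ) 𝓘(ℂ, Fin d → ℂ) φ)
    (hφ' : MDifferentiable 𝓘(ℂ, Fin d → ℂ) 𝓘(ℂ, Fin d → ℂ) φ.symm)
    (a : unitInterval) (f : HolAlg d B) {z : Fin d → ℂ}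
    (hz : z ∈ unitPolydisc d) :
    polydiscValue φ (dilate hφ hφ' a f) z = polydiscValue φ f ((a : ℝ) • z) := by
  rw [polydiscValue_of_mem φ _ hz]
  change polydiscValue φ f ((a : ℝ) • (φ (φ.symm _) : Fin d → ℂ)) = _
  rw [φ.apply_symm_apply]

theorem circleMap_smul_mem {R r : ℝ} (hR : 0 ≤ R) (θ : ℝ)
    (z : Metric.closedBall (0 : Fin d → ℂ) r) :
    circleMap 0 R θ • (z : Fin d → ℂ) ∈ Metric.closedBall 0 (R * r) := by
  rw [mem_closedBall_zero_iff, norm_smul, norm_circleMap_zero, abs_of_nonneg hR]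
  exact mul_le_mul_of_nonneg_left (mem_closedBall_zero_iff.1 z.2) hR

/-- Multiplication by `R e^{iθ}`, between closed polydiscs. -/
def circleDilation {R : ℝ} (hR : 0 ≤ R) (r θ : ℝ) :
    C(Metric.closedBall (0 : Fin d → ℂ) r, Metric.closedBall (0 : Fin d → ℂ) (R * r)) :=
  ⟨fun z => ⟨circleMap 0 R θ • (z : Fin d → ℂ), circleMap_smul_mem hR θ z⟩, by fun_prop⟩

theorem continuous_circleDilation {R : ℝ} (hR : 0 ≤ R) (r : ℝ) :
    Continuous (circleDilation (d := d) hR r) := by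
  refine ContinuousMap.continuous_of_continuous_uncurry _ ?_
  refine Continuous.subtype_mk (f := fun p : ℝ × Metric.closedBall (0 : Fin d → ℂ) r =>
    circleMap 0 R p.1 • (p.2 : Fin d → ℂ)) ?_ _
  have := continuous_circleMap 0 R
  fun_prop

/-- Composition with the multiplication by `R e^{iθ}`. -/
def circleOperator {R : ℝ} (hR : 0 ≤ R) (r θ : ℝ) :
    C(Metric.closedBall (0 : Fin d → ℂ) (R * r), ℂ) →L[ℝ]
      C(Metric.closedBall (0 : Fin d → ℂ) r, ℂ) where
  toFun w := w.comp (circleDilation hR r θ)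
  map_add' _ _ := rfl
  map_smul' _ _ := rfl
  cont := ContinuousMap.continuous_precomp _

/-- The integrand of Cauchy's formula for the dilations. -/
def dilationKernel {R : ℝ} (hR : 0 ≤ R) (r : ℝ) (a : ℝ → unitInterval)
    (u : ℝ → C(Metric.closedBall (0 : Fin d → ℂ) (R * r), ℂ)) (θ t : ℝ) :
    C(Metric.closedBall (0 : Fin d → ℂ) r, ℂ) :=
  (circleMap 0 R θ / (circleMap 0 R θ - ((a t : ℝ) : ℂ))) • circleOperator hR r θ (u t)

theorem circleMap_sub_ne_zero {R : ℝ} (hR : 1 < R) (θ : ℝ) (a : unitInterval) :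
    circleMap 0 R θ - ((a : ℝ) : ℂ) ≠ 0 := by
  intro h
  have h1 := congrArg norm (sub_eq_zero.1 h)
  rw [norm_circleMap_zero, Complex.norm_real, Real.norm_of_nonneg a.2.1, abs_of_pos
    (zero_lt_one.trans hR)] at h1
  linarith [a.2.2]

theorem jointlySmooth_dilationKernel {R : ℝ} (hR : 1 < R) (r : ℝ) {a : ℝ → unitInterval}
    (ha : ContDiff ℝ ∞ fun t => (a t : ℝ))
    {u : ℝ → C(Metric.closedBall (0 : Fin d → ℂ) (R * r), ℂ)} (hu : ContDiff ℝ ∞ u) :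
    JointlySmooth (dilationKernel (zero_le_one.trans hR.le) r a u) := by
  refine JointlySmooth.smul (jointlySmooth_of_contDiff ?_) (jointlySmooth_clm ?_ hu)
  · have h1 : ContDiff ℝ ∞ fun p : ℝ × ℝ => circleMap 0 R p.1 :=
      (contDiff_circleMap 0 R).comp contDiff_fst
    have h2 : ContDiff ℝ ∞ fun p : ℝ × ℝ => ((a p.2 : ℝ) : ℂ) :=
      Complex.ofRealCLM.contDiff.comp (ha.comp contDiff_snd)
    simp only [div_eq_mul_inv]
    exact h1.mul ((h1.sub h2).inv fun p => circleMap_sub_ne_zero hR p.1 (a p.2))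
  · exact Continuous.compCM continuous_snd
      ((continuous_circleDilation _ r).comp continuous_fst)

-- Cauchy's formula for `c ↦ f (c z)` on the disc `|c| ≤ R`, evaluated at `c = a`. Since `R > 1`,
-- the point `a` stays away from the circle even for `a = 1`, and the parameter enters only through
-- a smooth kernel.
open MeasureTheory in
theorem integral_dilationKernel (hφ : MDifferentiable 𝓘(ℂ, Fin d → ℂ) 𝓘(ℂ, Fin d → ℂ) φ)
    (hφ' : MDifferentiable 𝓘(ℂ, Fin d → ℂ) 𝓘(ℂ, Fin d → ℂ) φ.symm)
    {R r : ℝ} (hR : 1 < R) (hr : r < 1) (hRr : R * r < 1)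
    {a : ℝ → unitInterval} (ha : ContDiff ℝ ∞ fun t => (a t : ℝ)) {γ : ℝ → HolAlg d B}
    (hγ : ContDiff ℝ ∞ fun t => restrictDisc φ hRr (γ t)) (t : ℝ) :
    ∫ θ in Set.Icc 0 (2 * Real.pi), dilationKernel (zero_le_one.trans hR.le) r a
      (fun t => restrictDisc φ hRr (γ t)) θ t =
        (2 * Real.pi) • restrictDisc φ hr (dilate hφ hφ' (a t) (γ t)) := by
  have hR0 : 0 < R := zero_lt_one.trans hR
  have hJ := jointlySmooth_dilationKernel hR r ha hγ
  have hcont : Continuous fun θ => dilationKernel hR0.le r a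
      (fun t => restrictDisc φ hRr (γ t)) θ t := by
    simpa using! (hJ.continuous 0).comp (continuous_id.prodMk continuous_const)
  ext z
  have hz := mem_unitPolydisc_of_mem_closedBall hr z.2
  have h1 := (ContinuousMap.evalCLM ℝ z).integral_comp_comm
    (hcont.continuousOn.integrableOn_compact (μ := volume)
      (isCompact_Icc (a := 0) (b := 2 * Real.pi)))
  refine h1.symm.trans ?_
  have hmem : ∀ c : ℂ, c ∈ Metric.closedBall 0 R → c • (z : Fin d → ℂ) ∈ unitPolydisc d := by
    intro c hc
    refine mem_unitPolydisc_of_mem_closedBall hRr (mem_closedBall_zero_iff.2 ?_)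
    rw [norm_smul]
    exact mul_le_mul (mem_closedBall_zero_iff.1 hc) (mem_closedBall_zero_iff.1 z.2)
      (norm_nonneg _) hR0.le
  have hdiff : DifferentiableOn ℂ (fun c : ℂ => polydiscValue φ (γ t) (c • (z : Fin d → ℂ)))
      (Metric.closedBall 0 R) := fun c hc => by
    refine DifferentiableAt.differentiableWithinAt ?_
    exact (differentiableAt_polydiscValue hφ' (γ t) (hmem c hc)).comp c
      (differentiableAt_id.smul_const _)
  have hball : ((a t : ℝ) : ℂ) ∈ Metric.ball (0 : ℂ) R := by
    rw [mem_ball_zero_iff, Complex.norm_real, Real.norm_of_nonneg (a t).2.1]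
    exact (a t).2.2.trans_lt hR
  have h2 := hdiff.circleIntegral_sub_inv_smul hball
  rw [circleIntegral, intervalIntegral.integral_of_le Real.two_pi_pos.le,
    ← integral_Icc_eq_integral_Ioc] at h2
  -- The factor `-I` converts `dc = I c dθ` on the circle into `c dθ`.
  have h3 : ∀ θ, ContinuousMap.evalCLM ℝ z (dilationKernel hR0.le r a
      (fun t => restrictDisc φ hRr (γ t)) θ t) = (-Complex.I) * (deriv (circleMap 0 R) θ •
        (circleMap 0 R θ - ((a t : ℝ) : ℂ))⁻¹ •
          polydiscValue φ (γ t) (circleMap 0 R θ • (z : Fin d → ℂ))) := by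
    intro θ
    have h4 : ContinuousMap.evalCLM ℝ z (dilationKernel hR0.le r a
        (fun t => restrictDisc φ hRr (γ t)) θ t) =
          (circleMap 0 R θ / (circleMap 0 R θ - ((a t : ℝ) : ℂ))) *
            restrictDisc φ hRr (γ t) (circleDilation hR0.le r θ z) := rfl
    rw [h4, restrictDisc_apply, deriv_circleMap, smul_eq_mul, smul_eq_mul, div_eq_mul_inv]
    have h5 : ((circleDilation hR0.le r θ z : Metric.closedBall (0 : Fin d → ℂ) (R * r)) :
      Fin d → ℂ) = circleMap 0 R θ • (z : Fin d → ℂ) := rfl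
    rw [h5]
    linear_combination (circleMap 0 R θ * (circleMap 0 R θ - ((a t : ℝ) : ℂ))⁻¹ *
      polydiscValue φ (γ t) (circleMap 0 R θ • (z : Fin d → ℂ))) * Complex.I_mul_I
  simp only [h3]
  rw [integral_const_mul, h2]
  have h6 : ((2 * Real.pi) • restrictDisc φ hr (dilate hφ hφ' (a t) (γ t))) z =
      (2 * Real.pi) • restrictDisc φ hr (dilate hφ hφ' (a t) (γ t)) z := rfl
  have h7 : ((a t : ℝ) : ℂ) • (z : Fin d → ℂ) = (a t : ℝ) • (z : Fin d → ℂ) := by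
    funext i
    simp
  rw [h6, restrictDisc_apply, polydiscValue_dilate hφ hφ' _ _ hz, h7, smul_eq_mul,
    Complex.real_smul]
  push_cast
  linear_combination (-(2 * Real.pi * polydiscValue φ (γ t) ((a t : ℝ) • (z : Fin d → ℂ)))) *
    Complex.I_mul_I

/-- Both the function and the dilation parameter vary with `t`. The Cauchy integral removes the
parameter from the argument of the function, and the integral over the circle of a jointly smooth
family is smooth. -/
theorem IsSmoothCurve.dilate (hφ : MDifferentiable 𝓘(ℂ, Fin d → ℂ) 𝓘(ℂ, Fin d → ℂ) φ)
    (hφ' : MDifferentiable 𝓘(ℂ, Fin d → ℂ) 𝓘(ℂ, Fin d → ℂ) φ.symm)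
    {a : ℝ → unitInterval} (ha : ContDiff ℝ ∞ fun t => (a t : ℝ))
    {γ : ℝ → HolAlg d B} (hγ : IsSmoothCurve γ) :
    IsSmoothCurve fun t => dilate hφ hφ' (a t) (γ t) := by
  refine (isFrechetRep_restrictDisc hφ hφ').isSmoothCurve_iff.2 fun m => ?_
  set r := discRadius m
  have hr : r < 1 := discRadius_lt m
  have hr0 : 0 ≤ r := discRadius_nonneg m
  -- The radius `R = 2 / (1 + r)` satisfies both `R > 1`, needed for Cauchy's formula at `a = 1`,
  -- and `R * r < 1`, needed to stay inside the polydisc.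
  have hR : 1 < 2 / (1 + r) := by
    rw [lt_div_iff₀ (by linarith)]
    linarith
  have hRr : 2 / (1 + r) * r < 1 := by
    rw [div_mul_eq_mul_div, div_lt_one (by linarith)]
    linarith
  have hs : ContDiff ℝ ∞ fun t => restrictDisc φ hRr (γ t) :=
    hγ.contDiff_comp (restrictDisc φ hRr).toLinearMap (continuous_restrictDisc φ hRr)
  have hJ := jointlySmooth_dilationKernel hR r ha hs
  have h := contDiff_setIntegral MeasureTheory.volume
    (isCompact_Icc (a := 0) (b := 2 * Real.pi)) measurableSet_Icc hJ.contDiff hJ.continuous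
  simp only [integral_dilationKernel hφ hφ' hR hr hRr ha hs] at h
  have h' := h.const_smul (2 * Real.pi)⁻¹
  simpa only [smul_smul, inv_mul_cancel₀ Real.two_pi_pos.ne', one_smul] using! h'

end Dilations

theorem isSmoothCurve_matrix_iff {A : Type*} [Ring A] [Algebra ℝ A] [TopologicalSpace A]
    [IsTopologicalRing A] [ContinuousSMul ℝ A] {n : ℕ} {γ : ℝ → Matrix (Fin n) (Fin n) A} :
    IsSmoothCurve γ ↔ ∀ i j, IsSmoothCurve fun t => γ t i j := by
  have key : ∀ {c : ℝ → Matrix (Fin n) (Fin n) A} {x : Matrix (Fin n) (Fin n) A} {t : ℝ},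
      HasDerivAt c x t ↔ ∀ i j, HasDerivAt (fun s => c s i j) (x i j) t := by
    intro c x t
    simp only [hasDerivAt_iff_tendsto_quotient]
    exact tendsto_pi_nhds.trans (forall_congr' fun i => tendsto_pi_nhds)
  constructor
  · rintro ⟨c, rfl, hc⟩ i j
    exact ⟨fun k t => c k t i j, rfl, fun k t => key.1 (hc k t) i j⟩
  · intro h
    choose c h0 hc using h
    exact ⟨fun k t => Matrix.of fun i j => c i j k t, funext fun t => Matrix.ext fun i j =>
      congrFun (h0 i j) t, fun k t => key.2 fun i j => hc i j k t⟩

/-! ### The unitary group -/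

section UnitaryGroup

variable {n : ℕ}

instance compactSpace_unitary : CompactSpace (unitary (Matrix (Fin n) (Fin n) ℂ)) := by
  refine isCompact_iff_compactSpace.1 (IsCompact.of_isClosed_subset
    (isCompact_univ_pi fun _ => isCompact_univ_pi fun _ => isCompact_closedBall (0 : ℂ) 1)
    isClosed_unitary fun k hk => ?_)
  intro i _ j _
  exact mem_closedBall_zero_iff.2 (entry_norm_bound_of_unitary hk i j)

instance secondCountableTopology_unitary :
    SecondCountableTopology (unitary (Matrix (Fin n) (Fin n) ℂ)) :=
  have : SecondCountableTopology (Matrix (Fin n) (Fin n) ℂ) :=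
    inferInstanceAs (SecondCountableTopology (Fin n → Fin n → ℂ))
  TopologicalSpace.Subtype.secondCountableTopology _

/-- The point with parameter `a` of the segment from `M⁻¹ Q` to `1`, with `Q` the unitary factor of
`M`. -/
def segmentUnit (M : (Matrix (Fin n) (Fin n) ℂ)ˣ) (a : unitInterval) :
    (Matrix (Fin n) (Fin n) ℂ)ˣ :=
  (isUnit_segment M.mul_inv a.2.1 a.2.2).unit

theorem coe_segmentUnit (M : (Matrix (Fin n) (Fin n) ℂ)ˣ) (a : unitInterval) :
    (segmentUnit M a : Matrix (Fin n) (Fin n) ℂ) = (a : ℝ) • (1 : Matrix (Fin n) (Fin n) ℂ) +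
      (1 - (a : ℝ)) • ((M⁻¹ : (Matrix (Fin n) (Fin n) ℂ)ˣ).val * unitaryFactor M) := rfl

theorem segmentUnit_one (M : (Matrix (Fin n) (Fin n) ℂ)ˣ) : segmentUnit M 1 = 1 :=
  Units.ext (by simp [coe_segmentUnit])

theorem mul_segmentUnit_zero (M : (Matrix (Fin n) (Fin n) ℂ)ˣ) :
    ((M * segmentUnit M 0 : (Matrix (Fin n) (Fin n) ℂ)ˣ) : Matrix (Fin n) (Fin n) ℂ) =
      unitaryFactor M := by
  simp [coe_segmentUnit]

theorem segmentUnit_unitary_mul (k : unitary (Matrix (Fin n) (Fin n) ℂ))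
    (M : (Matrix (Fin n) (Fin n) ℂ)ˣ) (a : unitInterval) :
    segmentUnit (Unitary.toUnits k * M) a = segmentUnit M a := by
  refine Units.ext ?_
  have h : ((Unitary.toUnits k)⁻¹ : (Matrix (Fin n) (Fin n) ℂ)ˣ).val *
      (k : Matrix (Fin n) (Fin n) ℂ) =
      1 := (Unitary.toUnits k).inv_mul
  rw [coe_segmentUnit, coe_segmentUnit, Units.val_mul, Unitary.val_toUnits_apply,
    unitaryFactor_mul k.2, mul_inv_rev, Units.val_mul, mul_assoc,
    ← mul_assoc _ (k : Matrix (Fin n) (Fin n) ℂ),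
    h, one_mul]

end UnitaryGroup

/-! ### The deformation of `GL_n(O(B))` onto the unitary group -/

section Polydisc

variable {d : ℕ} {X : Type*} [TopologicalSpace X] [ChartedSpace (Fin d → ℂ) X]
  {B : TopologicalSpace.Opens X} {φ : B ≃ₜ unitPolydisc d} {n : ℕ}

variable (d B) in
/-- Constant matrices. -/
def constantUnits : (Matrix (Fin n) (Fin n) ℂ)ˣ →* (Matrix (Fin n) (Fin n) (HolAlg d B))ˣ :=
  Units.map (algebraMap ℂ (HolAlg d B)).mapMatrix.toMonoidHom

/-- The value at the centre of the polydisc. -/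
def centreValue (φ : B ≃ₜ unitPolydisc d) : HolAlg d B →ₐ[ℝ] ℂ where
  toFun f := f.1 (φ.symm ⟨0, mem_unitPolydisc_iff.2 (by simp)⟩)
  map_one' := rfl
  map_mul' _ _ := rfl
  map_zero' := rfl
  map_add' _ _ := rfl
  commutes' _ := rfl

theorem continuous_centreValue (φ : B ≃ₜ unitPolydisc d) : Continuous (centreValue φ) :=
  (continuous_eval_const (F := C(B, ℂ)) _).comp continuous_subtype_val

theorem IsSmoothCurve.contDiff_centreValue (φ : B ≃ₜ unitPolydisc d) {γ : ℝ → HolAlg d B}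
    (hγ : IsSmoothCurve γ) : ContDiff ℝ ∞ fun t => centreValue φ (γ t) :=
  hγ.contDiff_comp (centreValue φ).toLinearMap (continuous_centreValue φ)

/-- The value at the centre of the polydisc of an invertible matrix. -/
def centreUnits (φ : B ≃ₜ unitPolydisc d) :
    (Matrix (Fin n) (Fin n) (HolAlg d B))ˣ →* (Matrix (Fin n) (Fin n) ℂ)ˣ :=
  Units.map (centreValue φ).toRingHom.mapMatrix.toMonoidHom

theorem centreUnits_constantUnits (φ : B ≃ₜ unitPolydisc d) (M : (Matrix (Fin n) (Fin n) ℂ)ˣ) :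
    centreUnits φ (constantUnits d B M) = M := rfl

/-- The dilation of an invertible matrix of holomorphic functions. -/
def dilateUnits (hφ : MDifferentiable 𝓘(ℂ, Fin d → ℂ) 𝓘(ℂ, Fin d → ℂ) φ)
    (hφ' : MDifferentiable 𝓘(ℂ, Fin d → ℂ) 𝓘(ℂ, Fin d → ℂ) φ.symm) (a : unitInterval) :
    (Matrix (Fin n) (Fin n) (HolAlg d B))ˣ →* (Matrix (Fin n) (Fin n) (HolAlg d B))ˣ :=
  Units.map (dilate hφ hφ' a).mapMatrix.toMonoidHom

theorem isSmoothCurve_algebraMap (hφ : MDifferentiable 𝓘(ℂ, Fin d → ℂ) 𝓘(ℂ, Fin d → ℂ) φ)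
    (hφ' : MDifferentiable 𝓘(ℂ, Fin d → ℂ) 𝓘(ℂ, Fin d → ℂ) φ.symm) {f : ℝ → ℂ}
    (hf : ContDiff ℝ ∞ f) : IsSmoothCurve fun t => algebraMap ℂ (HolAlg d B) (f t) :=
  (isFrechetRep_restrictDisc hφ hφ').isSmoothCurve_iff.2 fun m =>
    ((algebraMapCLM ℂ C(Metric.closedBall (0 : Fin d → ℂ) (discRadius m), ℂ)).restrictScalars
      ℝ).contDiff.comp hf

attribute [local instance] Matrix.linftyOpNormedRing Matrix.linftyOpNormedAlgebra in
theorem isSmoothUnitCurve_constantUnits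
    (hφ : MDifferentiable 𝓘(ℂ, Fin d → ℂ) 𝓘(ℂ, Fin d → ℂ) φ)
    (hφ' : MDifferentiable 𝓘(ℂ, Fin d → ℂ) 𝓘(ℂ, Fin d → ℂ) φ.symm)
    {M : ℝ → (Matrix (Fin n) (Fin n) ℂ)ˣ} (hM : ∀ i j, ContDiff ℝ ∞ fun t => (M t).val i j) :
    IsSmoothUnitCurve fun t => constantUnits d B (M t) :=
  ((isFrechetRep_restrictDisc hφ hφ').mapMatrix n).isSmoothUnitCurve_iff.2
    (isSmoothCurve_matrix_iff.2 fun i j => isSmoothCurve_algebraMap hφ hφ' (hM i j))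

theorem IsSmoothUnitCurve.dilateUnits (hφ : MDifferentiable 𝓘(ℂ, Fin d → ℂ) 𝓘(ℂ, Fin d → ℂ) φ)
    (hφ' : MDifferentiable 𝓘(ℂ, Fin d → ℂ) 𝓘(ℂ, Fin d → ℂ) φ.symm) {a : ℝ → unitInterval}
    (ha : ContDiff ℝ ∞ fun t => (a t : ℝ)) {c : ℝ → (Matrix (Fin n) (Fin n) (HolAlg d B))ˣ}
    (hc : IsSmoothUnitCurve c) : IsSmoothUnitCurve fun t => dilateUnits hφ hφ' (a t) (c t) where
  val := isSmoothCurve_matrix_iff.2 fun i j =>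
    (isSmoothCurve_matrix_iff.1 hc.val i j).dilate hφ hφ' ha
  inv := isSmoothCurve_matrix_iff.2 fun i j =>
    (isSmoothCurve_matrix_iff.1 hc.inv i j).dilate hφ hφ' ha

theorem contDiff_segmentUnit (φ : B ≃ₜ unitPolydisc d) {a : ℝ → unitInterval}
    (ha : ContDiff ℝ ∞ fun t => (a t : ℝ)) {c : ℝ → (Matrix (Fin n) (Fin n) (HolAlg d B))ˣ}
    (hc : IsSmoothUnitCurve c) (i j : Fin n) :
    ContDiff ℝ ∞ fun t => (segmentUnit (centreUnits φ (c t)) (a t)).val i j := by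
  have h1 : ∀ i j, ContDiff ℝ ∞ fun t => (centreUnits φ (c t)).val i j := fun i j =>
    (isSmoothCurve_matrix_iff.1 hc.val i j).contDiff_centreValue φ
  have h2 : ∀ i j, ContDiff ℝ ∞ fun t => ((centreUnits φ (c t))⁻¹).val i j := fun i j =>
    (isSmoothCurve_matrix_iff.1 hc.inv i j).contDiff_centreValue φ
  have h3 := contDiff_unitaryFactor h1 fun t => (centreUnits φ (c t)).isUnit
  simp only [coe_segmentUnit, Matrix.add_apply, Matrix.smul_apply, Matrix.mul_apply]
  exact (ha.smul contDiff_const).add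
    ((contDiff_const.sub ha).smul (ContDiff.sum fun k _ => (h2 i k).mul (h3 k j)))

theorem dilate_algebraMap (hφ : MDifferentiable 𝓘(ℂ, Fin d → ℂ) 𝓘(ℂ, Fin d → ℂ) φ)
    (hφ' : MDifferentiable 𝓘(ℂ, Fin d → ℂ) 𝓘(ℂ, Fin d → ℂ) φ.symm) (a : unitInterval) (c : ℂ) :
    dilate hφ hφ' a (algebraMap ℂ (HolAlg d B) c) = algebraMap ℂ (HolAlg d B) c :=
  HolAlg.ext fun x => polydiscValue_of_mem φ _ (smul_mem_unitPolydisc a (φ x).2)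

theorem dilate_one (hφ : MDifferentiable 𝓘(ℂ, Fin d → ℂ) 𝓘(ℂ, Fin d → ℂ) φ)
    (hφ' : MDifferentiable 𝓘(ℂ, Fin d → ℂ) 𝓘(ℂ, Fin d → ℂ) φ.symm) (f : HolAlg d B) :
    dilate hφ hφ' 1 f = f :=
  HolAlg.ext fun x => by
    change polydiscValue φ f ((1 : ℝ) • (φ x : Fin d → ℂ)) = _
    rw [one_smul, polydiscValue_apply]

theorem dilate_zero (hφ : MDifferentiable 𝓘(ℂ, Fin d → ℂ) 𝓘(ℂ, Fin d → ℂ) φ)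
    (hφ' : MDifferentiable 𝓘(ℂ, Fin d → ℂ) 𝓘(ℂ, Fin d → ℂ) φ.symm) (f : HolAlg d B) :
    dilate hφ hφ' 0 f = algebraMap ℂ (HolAlg d B) (centreValue φ f) :=
  HolAlg.ext fun x => by
    change polydiscValue φ f ((0 : ℝ) • (φ x : Fin d → ℂ)) = centreValue φ f
    rw [zero_smul]
    exact polydiscValue_of_mem φ f _

theorem dilateUnits_constantUnits (hφ : MDifferentiable 𝓘(ℂ, Fin d → ℂ) 𝓘(ℂ, Fin d → ℂ) φ)
    (hφ' : MDifferentiable 𝓘(ℂ, Fin d → ℂ) 𝓘(ℂ, Fin d → ℂ) φ.symm) (a : unitInterval)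
    (M : (Matrix (Fin n) (Fin n) ℂ)ˣ) :
    dilateUnits hφ hφ' a (constantUnits d B M) = constantUnits d B M :=
  Units.ext (Matrix.ext fun _ _ => dilate_algebraMap hφ hφ' a _)

/-- The parameter of the dilations. -/
def dilationParameter (t : ℝ) : unitInterval :=
  ⟨Real.smoothTransition t, Real.smoothTransition.nonneg t, Real.smoothTransition.le_one t⟩

theorem dilationParameter_zero : dilationParameter 0 = 0 := Subtype.ext Real.smoothTransition.zero

theorem dilationParameter_one : dilationParameter 1 = 1 := Subtype.ext Real.smoothTransition.one

/-- The dilation of a matrix to its value at the centre, followed by the Gram–Schmidt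
deformation. -/
def polydiscHomotopy (hφ : MDifferentiable 𝓘(ℂ, Fin d → ℂ) 𝓘(ℂ, Fin d → ℂ) φ)
    (hφ' : MDifferentiable 𝓘(ℂ, Fin d → ℂ) 𝓘(ℂ, Fin d → ℂ) φ.symm)
    (g : (Matrix (Fin n) (Fin n) (HolAlg d B))ˣ) (t : ℝ) :
    (Matrix (Fin n) (Fin n) (HolAlg d B))ˣ :=
  dilateUnits hφ hφ' (dilationParameter t) g *
    constantUnits d B (segmentUnit (centreUnits φ g) (dilationParameter t))

theorem polydiscHomotopy_zero (hφ : MDifferentiable 𝓘(ℂ, Fin d → ℂ) 𝓘(ℂ, Fin d → ℂ) φ)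
    (hφ' : MDifferentiable 𝓘(ℂ, Fin d → ℂ) 𝓘(ℂ, Fin d → ℂ) φ.symm)
    (g : (Matrix (Fin n) (Fin n) (HolAlg d B))ˣ) :
    polydiscHomotopy hφ hφ' g 0 = constantUnits d B (Unitary.toUnits
      ⟨unitaryFactor (centreUnits φ g).val, unitaryFactor_mem (centreUnits φ g).isUnit⟩) := by
  have h : dilateUnits hφ hφ' 0 g = constantUnits d B (centreUnits φ g) :=
    Units.ext (Matrix.ext fun _ _ => dilate_zero hφ hφ' _)
  rw [polydiscHomotopy, dilationParameter_zero, h, ← map_mul]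
  exact congrArg (constantUnits d B) (Units.ext (mul_segmentUnit_zero _))

theorem isSmoothEquivariantDeformationRetract_unitarySubgroup
    (hφ : MDifferentiable 𝓘(ℂ, Fin d → ℂ) 𝓘(ℂ, Fin d → ℂ) φ)
    (hφ' : MDifferentiable 𝓘(ℂ, Fin d → ℂ) 𝓘(ℂ, Fin d → ℂ) φ.symm) :
    IsSmoothEquivariantDeformationRetract (unitarySubgroup d B n) := by
  refine ⟨polydiscHomotopy hφ hφ', fun c s hc hs => ?_, fun g => ?_, fun g => ?_, ?_, ?_⟩
  · have ha : ContDiff ℝ ∞ fun t => (dilationParameter (s t) : ℝ) :=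
      Real.smoothTransition.contDiff.comp hs
    exact (hc.dilateUnits hφ hφ' ha).mul' (isSmoothUnitCurve_constantUnits hφ hφ'
      (contDiff_segmentUnit φ ha hc))
  · have h : dilateUnits hφ hφ' 1 g = g :=
      Units.ext (Matrix.ext fun _ _ => dilate_one hφ hφ' _)
    rw [polydiscHomotopy, dilationParameter_one, segmentUnit_one, map_one, mul_one, h]
  · rw [polydiscHomotopy_zero]
    exact ⟨_, rfl⟩
  · rintro _ ⟨k, rfl⟩
    rw [polydiscHomotopy_zero]
    exact congrArg (constantUnits d B) (Units.ext (unitaryFactor_of_mem k.2))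
  · rintro _ ⟨k, rfl⟩ g t
    change polydiscHomotopy hφ hφ' (constantUnits d B (Unitary.toUnits k) * g) t =
      constantUnits d B (Unitary.toUnits k) * polydiscHomotopy hφ hφ' g t
    -- Dilations fix constant matrices, and the Gram–Schmidt correction is unchanged when the
    -- central value is multiplied on the left by `k`.
    rw [polydiscHomotopy, polydiscHomotopy, map_mul, map_mul, dilateUnits_constantUnits,
      centreUnits_constantUnits, segmentUnit_unitary_mul, mul_assoc]

/-- Near `k₀` the map `x ↦ unitaryFactor (k₀ + x)` parametrises the unitary group: Gram–Schmidt
fixes unitary matrices, so `k ↦ k - k₀` is a local right inverse. The dimension is redundant, which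
plots allow, and no manifold structure on the unitary group is used. -/
theorem hasSmoothPlots_unitary (hφ : MDifferentiable 𝓘(ℂ, Fin d → ℂ) 𝓘(ℂ, Fin d → ℂ) φ)
    (hφ' : MDifferentiable 𝓘(ℂ, Fin d → ℂ) 𝓘(ℂ, Fin d → ℂ) φ.symm) :
    HasSmoothPlots (Fin n → Fin n → ℂ) ((constantUnits d B).comp
      (Unitary.toUnits (R := Matrix (Fin n) (Fin n) ℂ))) := by
  intro k₀
  let N : (Fin n → Fin n → ℂ) → Matrix (Fin n) (Fin n) ℂ := fun x =>
    (k₀ : Matrix (Fin n) (Fin n) ℂ) + Matrix.of x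
  have hN : Continuous fun x => (N x).det :=
    (continuous_const.add (continuous_id (X := Fin n → Fin n → ℂ))).matrix_det
  have h0 : (N 0).det ≠ 0 := by
    have : N 0 = k₀ := add_zero _
    rw [this]
    exact ((Matrix.isUnit_iff_isUnit_det _).1 (Unitary.toUnits k₀).isUnit).ne_zero
  obtain ⟨r, hr, hball⟩ := Metric.isOpen_iff.1 (isOpen_ne_fun hN continuous_const) 0 h0
  obtain ⟨f, hf, hf0, hfr⟩ := exists_contDiff_bounded_eq_id (E := Fin n → Fin n → ℂ) hr
  have hu : ∀ x, IsUnit (N (f x)) := fun x =>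
    (Matrix.isUnit_iff_isUnit_det _).2 (isUnit_iff_ne_zero.2
      (hball (mem_ball_zero_iff.2 (hfr x))))
  refine ⟨fun x => ⟨unitaryFactor (N (f x)), unitaryFactor_mem (hu x)⟩, Subtype.ext ?_, ?_,
    fun γ hγ => isSmoothUnitCurve_constantUnits hφ hφ' fun i j =>
      contDiff_unitaryFactor (fun i j => ?_) (fun t => hu (γ t)) i j⟩
  · change unitaryFactor (N (f 0)) = _
    rw [hf0.self_of_nhds]
    have : N 0 = k₀ := add_zero _
    rw [this, unitaryFactor_of_mem k₀.2]
  · let σ : unitary (Matrix (Fin n) (Fin n) ℂ) → Fin n → Fin n → ℂ := fun k =>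
      (k : Matrix (Fin n) (Fin n) ℂ) - k₀
    have hσ : Filter.Tendsto σ (𝓝 k₀) (𝓝 0) := by
      have h : Filter.Tendsto (fun k : unitary (Matrix (Fin n) (Fin n) ℂ) =>
          (k : Matrix (Fin n) (Fin n) ℂ) - k₀) (𝓝 k₀) (𝓝 (k₀ - k₀)) :=
        (continuous_subtype_val.sub continuous_const).tendsto k₀
      rwa [sub_self] at h
    refine le_trans ?_ (Filter.map_mono hσ)
    rw [Filter.map_map]
    refine (Filter.map_id (f := 𝓝 k₀)).symm.le.trans (Filter.map_congr ?_).le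
    filter_upwards [hσ.eventually hf0] with k hk
    refine Subtype.ext ?_
    change _ = unitaryFactor (N (f (σ k)))
    have : N (σ k) = k := add_sub_cancel _ _
    rw [hk, this, unitaryFactor_of_mem k.2]
    rfl
  · exact contDiff_const.add (contDiff_pi.1 (contDiff_pi.1 (hf.comp hγ) i) j)

theorem IsPolydisc.quasiIso (hB : IsPolydisc d B) (n : ℕ) :
    IsSmoothEquivariantDeformationRetract (unitarySubgroup d B n) ∧
      ∀ (V : Type v) [NormedAddCommGroup V] [NormedSpace ℝ V] [CompleteSpace V],
        QuasiIso (diffToMiddle (R := Matrix (Fin n) (Fin n) (HolAlg d B)) (V := V)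
          (unitarySubgroup d B n)) ∧
        QuasiIso (invariantToMiddle (R := Matrix (Fin n) (Fin n) (HolAlg d B)) (V := V)
          (unitarySubgroup d B n)) := by
  obtain ⟨φ, hφ, hφ'⟩ := hB
  have h := isSmoothEquivariantDeformationRetract_unitarySubgroup (n := n) hφ hφ'
  exact ⟨h, fun V _ _ _ => (isFrechetRep_restrictDisc hφ hφ').quasiIso_matrix
    (hasSmoothPlots_unitary hφ hφ') h⟩

end Polydisc

end FrechetLie

/-! ### The main theorem -/

theorem mainTheorem6 :
    -- the general statement, for a Fréchet algebra `A` and a compact Lie group `L` embedded in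
    -- `GL_n(A)` by `ι`
    (∀ (A : Type u) [Ring A] [Algebra ℝ A] [UniformSpace A] [FrechetLie.IsFrechetAlgebra A] (n : ℕ)
      (d : ℕ) (L : Type w) [Group L] [TopologicalSpace L]
      [ChartedSpace (EuclideanSpace ℝ (Fin d)) L] [LieGroup (𝓡 d) ∞ L] [CompactSpace L]
      (ι : L →* (Matrix (Fin n) (Fin n) A)ˣ),
      Function.Injective ι → FrechetLie.IsSmoothHom (d := d) ι →
      FrechetLie.IsSmoothEquivariantDeformationRetract ι.range →
      ∀ (V : Type v) [NormedAddCommGroup V] [NormedSpace ℝ V] [CompleteSpace V],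
        QuasiIso (FrechetLie.diffToMiddle (V := V) ι.range) ∧
        QuasiIso (FrechetLie.invariantToMiddle (V := V) ι.range)) ∧
    -- the case of a polydisc `B` in a complex manifold `X`
    (∀ (d : ℕ) (X : Type u) [TopologicalSpace X] [ChartedSpace (Fin d → ℂ) X]
      [IsManifold 𝓘(ℂ, Fin d → ℂ) ω X] (B : TopologicalSpace.Opens X),
      FrechetLie.IsPolydisc d B → ∀ n : ℕ,
      FrechetLie.IsSmoothEquivariantDeformationRetract (FrechetLie.unitarySubgroup d B n) ∧
      ∀ (V : Type v) [NormedAddCommGroup V] [NormedSpace ℝ V] [CompleteSpace V],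
        QuasiIso (FrechetLie.diffToMiddle
          (R := Matrix (Fin n) (Fin n) (FrechetLie.HolAlg d B)) (V := V)
          (FrechetLie.unitarySubgroup d B n)) ∧
        QuasiIso (FrechetLie.invariantToMiddle
          (R := Matrix (Fin n) (Fin n) (FrechetLie.HolAlg d B)) (V := V)
          (FrechetLie.unitarySubgroup d B n))) := by
  exact ⟨fun A _ _ _ _ n d L _ _ _ _ _ ι _ hι hK V _ _ _ =>
    FrechetLie.quasiIso_of_isFrechetAlgebra hι hK V, fun d X _ _ _ B hB n => hB.quasiIso n⟩
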